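/- Let $\gamma=\{|t|=1\}$, counter-clockwise, let $1<\kappa<3$ and $\beta=\frac{\log\kappa}{2\pi}$. Let $\gamma_u=\bigcup_{k=1}^n(a_k,b_k)$ be a union of $n$ open arcs of $\gamma$ with pairwise disjoint closures, $(a_k,b_k)$ running counter-clockwise from $a_k$ to $b_k$, and let $\gamma_\sigma=\gamma\setminus\overline{\gamma_u}$ (if $n\ge1$; $\gamma_\sigma=\gamma$ if $n=0$). Write $F(t^+)$ and $F(t^-)$ for the limits of $F$ at $t\in\gamma$ from inside and from outside the unit disk $\mathbb D$, and $l_R(\zeta)=\overline{l(1/\bar\zeta)}$. Let $f$ be a function on $\gamma$ that is uniformly Hölder continuous on the arcs into which the points $a_k,b_k$ divide $\gamma$ (with possible jumps at these points). The canonical function is $$X_0(\zeta)=\prod_{k=1}^n(\zeta-a_k)^{-\frac12+i\beta}(\zeta-b_k)^{-\frac12-i\beta},$$ with the branch on $\mathbb C\setminus\overline{\gamma_u}$ for which $\zeta^nX_0(\zeta)\to1$ as $\zeta\to\infty$. It is holomorphic without zeros there, has non-zero boundary values off the end points, and satisfies $X_0(t^+)=-\kappa X_0(t^-)$ on $\gamma_u$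 and $X_0(t^+)=X_0(t^-)$ on $\gamma_\sigma$. Put $$\Omega_0(\zeta)=\frac{X_0(\zeta)}{2\pi i}\int_\gamma\frac{f(t)\,dt}{X_0(t^+)(t-\zeta)}$$ (the integrand is integrable for $\zeta\notin\gamma$). **The problem.** For an integer $N\ge0$, a solution of the mixed (Riemann–Hilbert) problem is a function $\Omega$, holomorphic on $\mathbb C\setminus(\gamma\cup\{0\})$ and bounded at infinity, with at most a pole of order $\max(N-1,0)$ at $0$ (holomorphic at $0$ if $N\le1$), which extends continuously from either side to all points of $\gamma$ other than the $a_k,b_k$, is $O(|\zeta-c|^{-\delta})$ for some $\delta=\delta(c)<1$ at each end point $c\in\{a_k,b_k\}$, and satisfies $$\Omega(t^+)-\Omega(t^-)=f(t)\ \text{ on }\gamma_\sigma,\qquad \Omega(t^+)+\kappa\,\Omega(t^-)=f(t)\ \text{ on }\gamma_u .$$ **General solution.** $\Omega$ is a solution if and only if there are constants $C_j\in\mathbb C$ with $$\Omega(\zeta)=\Omega_0(\zeta)+X_0(\zeta)R(\zeta),\qquad R(\zeta)=\sum_{j=-\max(N-1,0)}^{n}C_j\zeta^j ,$$ for all $\zeta\notin\gamma$,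 $\zeta\ne0$ (and also at $\zeta=0$ if $N\le1$). This applies in particular to elasticity: let $\omega$ be entire with $\omega(\zeta)=O(|\zeta|^N)$ at infinity (so $\omega_R$ has a pole of order at most $N$ at the origin), let $\Phi,\Psi$ be holomorphic on $\mathbb D$, and let $$\Omega(\zeta)=\begin{cases}(\omega')_R(\zeta)\Phi(\zeta)-\zeta^2\left[\omega_R(\zeta)\Phi'(\zeta)+\omega'(\zeta)\Psi(\zeta)\right],&|\zeta|<1,\\-(\omega')_R(\zeta)\Phi_R(\zeta),&|\zeta|>1.\end{cases}$$ Then $\Omega$ has the required holomorphy, pole order at $0$ and boundedness at infinity; hence, if it satisfies the boundary and end point conditions, it has the above form. **One displacement arc.** Let $n=1$, $\gamma_u=(a,b)$, and $N\le1$ (so that $\Omega$ has no pole at the origin). Then $\Omega$ is a solution if and only if, for some constants $C_0,C_1\in\mathbb C$, for all $\zeta\notin\gamma$, $$\Omega(\zeta)=\Omega_0(\zeta)+X_0(\zeta)\left[C_0+C_1\zeta\right].$$ Suppose moreover that $\gamma_\sigma$ is traction-free, $f=0$ on $\gamma_\sigma$, and that displacements $u=u_1+iu_2$ are prescribed on $\gamma_u$: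 $u$ is a function of the angle $\varphi$, continuous on the closed arc and differentiable on the open arc, with $f(t)=-2\mu i\,t\,\overline{u'(\varphi)}$ at $t=e^{i\varphi}\in\gamma_u$, where $\mu>0$. Let $\omega$ be entire, injective on $\mathbb D$, with $\omega(\zeta)=O(|\zeta|)$ at infinity. Then the system of real-linear equations $$(\kappa+1)\int_{\gamma_\sigma}\Omega_0(t)\frac{dt}{t^2}+(\kappa+1)\int_{\gamma_\sigma}X_0(t)(C_0+C_1t)\frac{dt}{t^2}=2\mu\left[\overline{u(a)}-\overline{u(b)}\right],$$ $$\frac{X_0(0)}{2\pi i}\int_\gamma\frac{f(t)}{X_0(t^+)}\frac{dt}{t}+C_0X_0(0)+\frac{\overline{\omega'(0)}}{\omega'(0)}\,\overline{C_1}=0,$$ where $\gamma_\sigma$ is traversed counter-clockwise from $b$ to $a$ and all integrands are integrable, has exactly one solution $(C_0,C_1)\in\mathbb C^2$; and whenever the function $\Omega$ built from $\omega$ and some $\Phi,\Psi$ holomorphic on $\mathbb D$ as above satisfies the boundary and end point conditions for $f$, it equals $\Omega_0+X_0\,(C_0+C_1\zeta)$ off $\gamma$ with these constants. -/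

import Mathlib

open Complex Filter Topology Bornology
open scoped ComplexConjugate

noncomputable section

namespace RHProblem

/-- `n` open arcs `(a_k, b_k)` of the unit circle with pairwise disjoint closures, listed in
counter-clockwise order: the `k`-th arc runs from `a_k = exp (i * start k)` to
`b_k = exp (i * finish k)`. -/
structure ArcSystem (n : ℕ) where
  start : Fin n → ℝ
  finish : Fin n → ℝ
  start_lt_finish : ∀ k, start k < finish k
  finish_lt_start : ∀ j k, j < k → finish j < start k
  finish_lt_start_add : ∀ j k, finish k < start j + 2 * Real.pi

/-- The point `exp (i φ)` of the unit circle `γ`. -/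
def pt (φ : ℝ) : ℂ := exp (φ * I)

/-- The open unit disk. -/
def disk : Set ℂ := {ζ | ‖ζ‖ < 1}

/-- The exterior of the closed unit disk. -/
def exterior : Set ℂ := {ζ | 1 < ‖ζ‖}

namespace ArcSystem

variable {n : ℕ} (A : ArcSystem n)

/-- The set of end points `a_k`, `b_k`. -/
def ends : Set ℂ := {t | ∃ k, t = pt (A.start k) ∨ t = pt (A.finish k)}

/-- The displacement part `γ_u`, the union of the open arcs `(a_k, b_k)`. -/
def gammaU : Set ℂ := {t | ∃ k, ∃ φ ∈ Set.Ioo (A.start k) (A.finish k), t = pt φ}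

/-- The traction part `γ_σ`: what remains of the circle, end points removed. -/
def gammaS : Set ℂ := {t | ‖t‖ = 1 ∧ t ∉ A.gammaU ∧ t ∉ A.ends}

end ArcSystem

/-- `β = log κ / (2π)`. -/
def beta (κ : ℝ) : ℝ := Real.log κ / (2 * Real.pi)

/-- The branch of `log ((ζ - a) / (ζ - b))`, with `a = pt s` and `b = pt e`, that is cut along the
counter-clockwise arc of the circle from `a` to `b` and vanishes at infinity. The quotient
`(ζ - a) / (ζ - b)` maps this arc onto the ray spanned by `-exp (-i (e - s) / 2)`, which the factor
`exp (i (e - s) / 2)` turns to the cut of the principal logarithm. -/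
def arcLog (s e : ℝ) (ζ : ℂ) : ℂ :=
  log (exp (((e - s) / 2 : ℝ) * I) * ((ζ - pt s) / (ζ - pt e))) - ((e - s) / 2 : ℝ) * I

/-- The branch of `(ζ - a) ^ (-1/2 + iβ) * (ζ - b) ^ (-1/2 - iβ)` cut along the arc from `a = pt s`
to `b = pt e` and asymptotic to `1 / ζ` at infinity. -/
def arcFactor (κ s e : ℝ) (ζ : ℂ) : ℂ :=
  exp ((-1 / 2 + I * beta κ) * arcLog s e ζ) / (ζ - pt e)

/-- `arcFactor` is indeed a product of values of the two complex powers. -/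
theorem arcFactor_eq_powers (κ s e : ℝ) (ζ : ℂ) (ha : ζ ≠ pt s) (hb : ζ ≠ pt e) :
    ∃ la lb : ℂ, exp la = ζ - pt s ∧ exp lb = ζ - pt e ∧
      arcFactor κ s e ζ =
        exp ((-1 / 2 + I * beta κ) * la) * exp ((-1 / 2 - I * beta κ) * lb) := by
  have ha' : ζ - pt s ≠ 0 := sub_ne_zero.2 ha
  have hb' : ζ - pt e ≠ 0 := sub_ne_zero.2 hb
  have hL : exp (arcLog s e ζ) = (ζ - pt s) / (ζ - pt e) := by
    unfold arcLog
    rw [exp_sub, exp_log (mul_ne_zero (exp_ne_zero _) (div_ne_zero ha' hb'))]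
    rw [mul_comm, mul_div_assoc, div_self (exp_ne_zero _), mul_one]
  refine ⟨arcLog s e ζ + log (ζ - pt e), log (ζ - pt e), ?_, exp_log hb', ?_⟩
  · rw [exp_add, hL, exp_log hb', div_mul_cancel₀ _ hb']
  · unfold arcFactor
    rw [← exp_add, div_eq_iff hb']
    conv_rhs => rw [← exp_log hb', ← exp_add]
    rw [exp_log hb']
    congr 1
    ring

/-- The canonical function
`X₀ = ∏ (ζ - a_k) ^ (-1/2 + iβ) * (ζ - b_k) ^ (-1/2 - iβ)`. -/
def X0 {n : ℕ} (A : ArcSystem n) (κ : ℝ) (ζ : ℂ) : ℂ :=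
  ∏ k, arcFactor κ (A.start k) (A.finish k) ζ

/-- The boundary value `F(t⁺)` from inside the disk. -/
def innerValue (F : ℂ → ℂ) (t : ℂ) : ℂ := limUnder (𝓝[disk] t) F

/-- The boundary value `F(t⁻)` from outside the disk. -/
def outerValue (F : ℂ → ℂ) (t : ℂ) : ℂ := limUnder (𝓝[exterior] t) F

/-- `Ω₀(ζ) = X₀(ζ) / (2πi) ∫_γ f(t) dt / (X₀(t⁺) (t - ζ))`. -/
def Omega0 {n : ℕ} (A : ArcSystem n) (κ : ℝ) (f : ℂ → ℂ) (ζ : ℂ) : ℂ :=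
  X0 A κ ζ / (2 * Real.pi * I) * ∮ t in C(0, 1), f t / (innerValue (X0 A κ) t * (t - ζ))

/-- The Laurent polynomial `∑_{j = -m}^{n} C_j ζ^j`. -/
def laurentSum (C : ℤ → ℂ) (m n : ℕ) (ζ : ℂ) : ℂ :=
  ∑ j ∈ Finset.Icc (-(m : ℤ)) (n : ℤ), C j * ζ ^ j

/-- `f` is uniformly Hölder continuous on every arc of the circle that contains no end point
`a_k`, `b_k`; jumps at the end points are allowed. -/
def HolderOnArcs {n : ℕ} (A : ArcSystem n) (f : ℂ → ℂ) : Prop :=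
  ∃ ε > (0 : ℝ), ∃ K : ℝ, ∀ s t : ℝ, s ≤ t → (∀ r ∈ Set.Icc s t, pt r ∉ A.ends) →
    ‖f (pt t) - f (pt s)‖ ≤ K * (t - s) ^ ε

/-- The domain of `Ω` when `ω_R` has at the origin a pole of order at most `N`: the complement
of the circle, from which the origin is removed unless `N ≤ 1`. -/
def domain (N : ℕ) : Set ℂ := {ζ | ‖ζ‖ ≠ 1 ∧ (ζ ≠ 0 ∨ N ≤ 1)}

/-- `Ω` is holomorphic off the circle and the origin, bounded at infinity, and has at the origin
at most a pole of order `N - 1` (it is holomorphic there if `N ≤ 1`). -/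
structure SectionallyHolomorphic (N : ℕ) (Ω : ℂ → ℂ) : Prop where
  holo : ∀ ζ ∈ domain N, DifferentiableAt ℂ Ω ζ
  origin : Ω =O[𝓝[≠] 0] fun ζ => ζ ^ (-((N - 1 : ℕ) : ℤ))
  infinity : Ω =O[cobounded ℂ] fun _ => (1 : ℂ)

/-- The mixed boundary conditions, `Ω(t⁺) - Ω(t⁻) = f(t)` on `γ_σ` and `Ω(t⁺) + κ Ω(t⁻) = f(t)`
on `γ_u`, with weak singularities (of order less than one) at the end points of the arcs. -/
structure BoundaryConditions {n : ℕ} (A : ArcSystem n) (κ : ℝ) (f Ω : ℂ → ℂ) : Prop where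
  traction : ∀ t ∈ A.gammaS, ∃ p m : ℂ, Tendsto Ω (𝓝[disk] t) (𝓝 p) ∧
    Tendsto Ω (𝓝[exterior] t) (𝓝 m) ∧ p - m = f t
  displacement : ∀ t ∈ A.gammaU, ∃ p m : ℂ, Tendsto Ω (𝓝[disk] t) (𝓝 p) ∧
    Tendsto Ω (𝓝[exterior] t) (𝓝 m) ∧ p + κ * m = f t
  ends : ∀ c ∈ A.ends, ∃ δ < (1 : ℝ),
    Ω =O[𝓝[{ζ | ‖ζ‖ ≠ 1}] c] fun ζ => ‖ζ - c‖ ^ (-δ)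

/-- The holomorphic reflection `l_R(ζ) = conj (l (1 / conj ζ))`. -/
def reflect (l : ℂ → ℂ) (ζ : ℂ) : ℂ := conj (l (1 / conj ζ))

/-- The function `Ω` built from the potentials `Φ`, `Ψ` and the mapping `ω`; the symbol `ω_R'`
stands for the reflection of the derivative of `ω`. -/
def OmegaOf (ω Φ Ψ : ℂ → ℂ) (ζ : ℂ) : ℂ :=
  if ‖ζ‖ < 1 then
    reflect (deriv ω) ζ * Φ ζ - ζ ^ 2 * (reflect ω ζ * deriv Φ ζ + deriv ω ζ * Ψ ζ)
  else -(reflect (deriv ω) ζ * reflect Φ ζ)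

/-- For a single displacement arc, `∫ F(t) dt` over the traction arc `γ_σ`, taken
counter-clockwise from `b = pt (finish 0)` to `a = pt (start 0)`. -/
def integralS (A : ArcSystem 1) (F : ℂ → ℂ) : ℂ :=
  ∫ φ in A.finish 0..A.start 0 + 2 * Real.pi, F (pt φ) * (I * pt φ)

/-- Integrability of `F(t) dt` over the traction arc. -/
def IntegrableS (A : ArcSystem 1) (F : ℂ → ℂ) : Prop :=
  IntervalIntegrable (fun φ : ℝ => F (pt φ) * (I * pt φ)) MeasureTheory.volume
    (A.finish 0) (A.start 0 + 2 * Real.pi)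

/-- The real-linear system for the constants `C₀`, `C₁` in the case of one displacement arc and a
free traction arc: continuity of the displacements `u = u₁ + i u₂` at the ends of the arc, and
regularity of the potentials at the origin. -/
def LinearSystem (A : ArcSystem 1) (κ μ : ℝ) (ω : ℂ → ℂ) (u : ℝ → ℂ) (f : ℂ → ℂ)
    (C₀ C₁ : ℂ) : Prop :=
  (κ + 1) * integralS A (fun t => Omega0 A κ f t / t ^ 2)
      + (κ + 1) * integralS A (fun t => X0 A κ t * (C₀ + C₁ * t) / t ^ 2)
    = 2 * μ * (conj (u (A.start 0)) - conj (u (A.finish 0))) ∧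
  X0 A κ 0 / (2 * Real.pi * I) * (∮ t in C(0, 1), f t / (innerValue (X0 A κ) t * t))
      + C₀ * X0 A κ 0 + conj (deriv ω 0) / deriv ω 0 * conj C₁ = 0

end RHProblem

end

noncomputable section

namespace RHProblem

/-! ### Points of the circle -/

/-! The canonical function `X0` solves the homogeneous problem, so division by it unifies the two
boundary conditions. Since `X₀⁺ = -κ X₀⁻` on `γ_u` and `X₀⁺ = X₀⁻` on `γ_σ`, both become the single
jump condition `Ω⁺/X₀⁺ - Ω⁻/X₀⁻ = f/X₀⁺`. The jump ratio comes from the logarithm in `arcLog`: its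
boundary values on the arc differ by `2πi`, and `exp ((-1/2 + iβ)(-2πi)) = -κ`.

A particular solution of the jump problem is the Cauchy integral of `f/X₀⁺`. The jumps of `f` at the
end points do no harm: `1/X₀⁺` is Hölder continuous with exponent `1/2` and vanishes at the end
points, so the product is Hölder continuous on the whole circle (`circleHolder_density`). For such
densities the Sokhotski–Plemelj formulas follow from continuity of `cauchyK` across the circle, and
the Cauchy integral is bounded up to the boundary. Hence `Ω₀ + X₀ R` meets the boundary conditions
for every `R` continuous on the circle.

Conversely, for a solution `Ω` the function `quotient`, which is `Ω/X₀` minus this Cauchy integral,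
has no jump. At an end point `c` the bound with `δ < 1` gives `(ζ - c) * quotient → 0`.
Multiplication by `ζ ^ (N - 1)` and by the polynomial `endsPoly` therefore yields a function
continuous across the circle, bounded at the origin and of polynomial growth. By
`exists_polynomial_of_glued` it is a polynomial; it vanishes at the end points, so `endsPoly`
divides out and a polynomial of degree at most `N - 1 + n` remains, because `1/X₀` grows like `ζ ^
n`.

For one arc, integrate `Ω dt/t²` over circles just inside and just outside the unit circle. The
inner integral is `2πi Ω'(0)`, the outer one is zero, and the inner one plus `κ` times the outer one
tends to the integral of `f` over `γ_u` plus `κ + 1` times that of `Ω` over `γ_σ`. So the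
displacement equation of the linear system says `Ω'(0) = 0` (`displacement_condition_iff`). If `Ω`
comes from potentials, `ω` is affine and both equations can be read off from `Ω` at the origin and
at infinity (`constants_of_OmegaOf`). Eliminating `C₁` leaves an equation `p z + q conj z = r`,
uniquely solvable as soon as `‖p‖ ≠ ‖q‖`. Here this amounts to `|X₀'(0)/X₀(0)| ≠ |X₀(0)|`, which
holds by `norm_logDerivX0_lt`. -/

theorem norm_pt (φ : ℝ) : ‖pt φ‖ = 1 := norm_exp_ofReal_mul_I φ

theorem pt_ne_zero (φ : ℝ) : pt φ ≠ 0 := exp_ne_zero _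

theorem pt_add (φ ψ : ℝ) : pt (φ + ψ) = pt φ * pt ψ := by
  simp [pt, add_mul, exp_add]

theorem pt_neg (φ : ℝ) : pt (-φ) = (pt φ)⁻¹ := by
  simp [pt, exp_neg]

theorem conj_pt (φ : ℝ) : conj (pt φ) = pt (-φ) := by
  simp [pt, ← exp_conj]

theorem pt_add_two_pi (φ : ℝ) : pt (φ + 2 * Real.pi) = pt φ := by
  have := exp_periodic (φ * I)
  simp only [pt]
  rw [← this]
  congr 1
  push_cast
  ring

theorem periodic_pt : Function.Periodic pt (2 * Real.pi) := pt_add_two_pi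

theorem circleMap_eq_pt (φ : ℝ) : circleMap 0 1 φ = pt φ := by
  simp [circleMap, pt]

theorem continuous_pt : Continuous pt := by
  unfold pt; fun_prop

theorem exists_pt_Ico (s : ℝ) {t : ℂ} (ht : ‖t‖ = 1) :
    ∃ φ ∈ Set.Ico s (s + 2 * Real.pi), t = pt φ := by
  have h : t = pt (arg t) := by
    have := norm_mul_exp_arg_mul_I t
    rw [ht] at this
    simpa [pt] using this.symm
  refine ⟨toIcoMod Real.two_pi_pos s (arg t), toIcoMod_mem_Ico _ _ _, ?_⟩
  conv_lhs => rw [h, ← toIcoMod_add_toIcoDiv_zsmul Real.two_pi_pos s (arg t)]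
  exact (periodic_pt.zsmul _) _

theorem eq_of_pt_eq_pt {φ ψ : ℝ} (h : pt φ = pt ψ) (h₁ : φ < ψ + 2 * Real.pi)
    (h₂ : ψ < φ + 2 * Real.pi) : φ = ψ := by
  obtain ⟨m, hm⟩ := exp_eq_exp_iff_exists_int.1 h
  have hm' : φ = ψ + m * (2 * Real.pi) := by
    have := congrArg Complex.im hm
    simpa using this
  have hp := Real.pi_pos
  have h3 : (m : ℝ) < 1 := by
    by_contra! hc
    nlinarith
  have h4 : (-1 : ℝ) < m := by
    by_contra! hc
    nlinarith
  have h5 : m = 0 := by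
    have : m < 1 := by exact_mod_cast h3
    have : -1 < m := by exact_mod_cast h4
    omega
  simpa [h5] using hm'

/-- The half-angle factorisation isolates the phase of a chord; these phases cancel in `arcW`, which
is therefore real on the circle. -/
theorem pt_sub_pt (φ ψ : ℝ) :
    pt φ - pt ψ = pt ((φ + ψ) / 2) * (2 * I * (Real.sin ((φ - ψ) / 2) : ℝ)) := by
  have h1 : pt φ = pt ((φ + ψ) / 2) * pt ((φ - ψ) / 2) := by rw [← pt_add]; congr 1; ring
  have h2 : pt ψ = pt ((φ + ψ) / 2) * pt (-((φ - ψ) / 2)) := by rw [← pt_add]; congr 1; ring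
  rw [h1, h2]
  generalize (φ - ψ) / 2 = x
  have : pt x - pt (-x) = 2 * I * (Real.sin x : ℝ) := by
    simp only [pt, exp_mul_I, ofReal_neg, ofReal_sin, Complex.cos_neg, Complex.sin_neg]
    ring
  rw [← this]
  ring

theorem norm_pt_sub_pt (φ ψ : ℝ) : ‖pt φ - pt ψ‖ = 2 * |Real.sin ((φ - ψ) / 2)| := by
  rw [pt_sub_pt, norm_mul, norm_pt, norm_mul, norm_real]
  simp

/-! ### The Möbius map behind a single factor -/

/-- The Möbius map sending the circle to the real line and the arc to the negative axis. -/
def arcW (s e : ℝ) (ζ : ℂ) : ℂ :=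
  exp (((e - s) / 2 : ℝ) * I) * ((ζ - pt s) / (ζ - pt e))

theorem arcLog_eq (s e : ℝ) (ζ : ℂ) :
    arcLog s e ζ = log (arcW s e ζ) - ((e - s) / 2 : ℝ) * I := rfl

theorem pt_ne_pt {s e : ℝ} (h : s < e) (h' : e < s + 2 * Real.pi) : pt s ≠ pt e := fun hc =>
  h.ne (eq_of_pt_eq_pt hc (by linarith [Real.pi_pos]) h')

/-- For an arc shorter than the full circle the sine is positive, so the disk goes to the lower and
the exterior to the upper half-plane. This decides from which side of the logarithmic cut each
boundary value is taken. -/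
theorem arcW_im (s e : ℝ) {ζ : ℂ} :
    (arcW s e ζ).im = Real.sin ((e - s) / 2) * (‖ζ‖ ^ 2 - 1) / normSq (ζ - pt e) := by
  have h1 : arcW s e ζ = (pt ((e - s) / 2) * (ζ - pt s) * conj (ζ - pt e)) *
      ((normSq (ζ - pt e))⁻¹ : ℝ) := by
    rw [arcW, div_eq_mul_inv (ζ - pt s), Complex.inv_def]
    simp only [pt]
    push_cast
    ring
  rw [h1, im_mul_ofReal, div_eq_mul_inv (_ * _)]
  congr 1
  have ha : pt ((e - s) / 2) * pt s = pt ((e + s) / 2) := by rw [← pt_add]; congr 1; ring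
  have hb : pt ((e - s) / 2) * pt (-e) = pt (-((e + s) / 2)) := by rw [← pt_add]; congr 1; ring
  have hc : pt ((e + s) / 2) * pt (-e) = pt (-((e - s) / 2)) := by rw [← pt_add]; congr 1; ring
  have h2 : pt ((e - s) / 2) * (ζ - pt s) * conj (ζ - pt e) =
      pt ((e - s) / 2) * (ζ * conj ζ) - (pt (-((e + s) / 2)) * ζ + pt ((e + s) / 2) * conj ζ)
        + pt (-((e - s) / 2)) := by
    rw [map_sub, conj_pt, ← hc, ← ha, ← hb]
    ring
  rw [h2, mul_conj, ← Complex.sq_norm, pt_neg ((e + s) / 2)]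
  have h3 : (pt ((e + s) / 2))⁻¹ = conj (pt ((e + s) / 2)) := by rw [conj_pt, pt_neg]
  have h4 : ∀ x : ℝ, (pt x).im = Real.sin x := fun x => by simp [pt, exp_ofReal_mul_I_im]
  rw [h3, add_im, sub_im, add_im, im_mul_ofReal, h4, h4, Real.sin_neg]
  simp only [mul_im, conj_re, conj_im]
  ring

theorem arcW_pt (s e φ : ℝ) :
    arcW s e (pt φ) = ((Real.sin ((φ - s) / 2) / Real.sin ((φ - e) / 2) : ℝ) : ℂ) := by
  rw [arcW, pt_sub_pt, pt_sub_pt]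
  have h : pt ((φ + e) / 2) = pt ((e - s) / 2) * pt ((φ + s) / 2) := by
    rw [← pt_add]; congr 1; ring
  rw [h]
  have h1 := pt_ne_zero ((e - s) / 2)
  have h2 := pt_ne_zero ((φ + s) / 2)
  change pt ((e - s) / 2) * _ = _
  -- At the pole both sides are a division by zero, hence zero.
  by_cases h0 : Real.sin ((φ - e) / 2) = 0
  · simp [h0]
  · have h0' : ((Real.sin ((φ - e) / 2) : ℝ) : ℂ) ≠ 0 := ofReal_ne_zero.2 h0
    rw [ofReal_div]
    field_simp

/-- The closed arc from `pt s` to `pt e`. -/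
def closedArc (s e : ℝ) : Set ℂ := pt '' Set.Icc s e

/-- On the complementary arc the quotient of sines is positive; off the circle the imaginary part is
non-zero. -/
theorem arcW_mem_slitPlane {s e : ℝ} (h : s < e) (h' : e < s + 2 * Real.pi) {ζ : ℂ}
    (hζ : ζ ∉ closedArc s e) : arcW s e ζ ∈ slitPlane := by
  by_cases hn : ‖ζ‖ = 1
  · obtain ⟨φ, hφ, rfl⟩ := exists_pt_Ico s hn
    have hφe : e < φ := by
      by_contra! hc
      exact hζ ⟨φ, ⟨hφ.1, hc⟩, rfl⟩
    rw [arcW_pt, ofReal_mem_slitPlane]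
    exact div_pos
      (Real.sin_pos_of_pos_of_lt_pi (by linarith) (by linarith [hφ.2]))
      (Real.sin_pos_of_pos_of_lt_pi (by linarith) (by linarith [hφ.2]))
  · refine mem_slitPlane_iff.2 (Or.inr ?_)
    rw [arcW_im]
    have hne : ζ - pt e ≠ 0 := fun hc => hn (by rw [sub_eq_zero.1 hc, norm_pt])
    have h2 : ‖ζ‖ ^ 2 - 1 ≠ 0 := by
      intro hc
      exact hn ((pow_eq_one_iff_of_nonneg (norm_nonneg ζ) two_ne_zero).1 (by linarith))
    have h3 : Real.sin ((e - s) / 2) ≠ 0 :=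
      (Real.sin_pos_of_pos_of_lt_pi (by linarith) (by linarith)).ne'
    exact div_ne_zero (mul_ne_zero h3 h2) (by simpa using hne)

theorem arcW_re_neg {s e φ : ℝ} (h' : e < s + 2 * Real.pi) (hφ : φ ∈ Set.Ioo s e) :
    (arcW s e (pt φ)).re < 0 ∧ (arcW s e (pt φ)).im = 0 := by
  rw [arcW_pt, ofReal_re, ofReal_im]
  refine ⟨div_neg_of_pos_of_neg ?_ ?_, rfl⟩
  · exact Real.sin_pos_of_pos_of_lt_pi (by linarith [hφ.1]) (by linarith [hφ.2])
  · exact Real.sin_neg_of_neg_of_neg_pi_lt (by linarith [hφ.2]) (by linarith [hφ.1])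

theorem hasDerivAt_arcLog {s e : ℝ} (h : s < e) (h' : e < s + 2 * Real.pi) {ζ : ℂ}
    (hζ : ζ ∉ closedArc s e) :
    HasDerivAt (arcLog s e) ((ζ - pt s)⁻¹ - (ζ - pt e)⁻¹) ζ := by
  have ha : ζ - pt s ≠ 0 := fun hc => hζ ⟨s, ⟨le_rfl, h.le⟩, (sub_eq_zero.1 hc).symm⟩
  have hb : ζ - pt e ≠ 0 := fun hc => hζ ⟨e, ⟨h.le, le_rfl⟩, (sub_eq_zero.1 hc).symm⟩
  have h1 : HasDerivAt (arcW s e) (exp (((e - s) / 2 : ℝ) * I) *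
      ((1 * (ζ - pt e) - (ζ - pt s) * 1) / (ζ - pt e) ^ 2)) ζ :=
    (((hasDerivAt_id ζ).sub_const (pt s)).div ((hasDerivAt_id ζ).sub_const (pt e)) hb).const_mul _
  have h2 := (h1.clog (arcW_mem_slitPlane h h' hζ)).sub_const (((e - s) / 2 : ℝ) * I)
  refine h2.congr_deriv ?_
  rw [arcW]
  have := exp_ne_zero (((e - s) / 2 : ℝ) * I)
  field_simp

/-- The form with the logarithmic derivative is the one needed for the Hölder estimate of the
reciprocal and for `X₀'/X₀` at the origin. -/
theorem hasDerivAt_arcFactor (κ : ℝ) {s e : ℝ} (h : s < e) (h' : e < s + 2 * Real.pi) {ζ : ℂ}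
    (hζ : ζ ∉ closedArc s e) :
    HasDerivAt (arcFactor κ s e) (arcFactor κ s e ζ *
      ((-1 / 2 + I * beta κ) * (ζ - pt s)⁻¹ + (-1 / 2 - I * beta κ) * (ζ - pt e)⁻¹)) ζ := by
  have hb : ζ - pt e ≠ 0 := fun hc => hζ ⟨e, ⟨h.le, le_rfl⟩, (sub_eq_zero.1 hc).symm⟩
  have ha : ζ - pt s ≠ 0 := fun hc => hζ ⟨s, ⟨le_rfl, h.le⟩, (sub_eq_zero.1 hc).symm⟩
  have h1 := (((hasDerivAt_arcLog h h' hζ).const_mul (-1 / 2 + I * beta κ)).cexp).div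
    ((hasDerivAt_id ζ).sub_const (pt e)) hb
  refine h1.congr_deriv ?_
  simp only [arcFactor, id]
  field_simp
  ring

theorem arcFactor_ne_zero (κ : ℝ) {s e : ℝ} {ζ : ℂ} (hb : ζ ≠ pt e) : arcFactor κ s e ζ ≠ 0 :=
  div_ne_zero (exp_ne_zero _) (sub_ne_zero.2 hb)

theorem exp_arcLog {s e : ℝ} {ζ : ℂ} (ha : ζ ≠ pt s) (hb : ζ ≠ pt e) :
    exp (arcLog s e ζ) = (ζ - pt s) / (ζ - pt e) := by
  have ha' : ζ - pt s ≠ 0 := sub_ne_zero.2 ha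
  have hb' : ζ - pt e ≠ 0 := sub_ne_zero.2 hb
  unfold arcLog
  rw [exp_sub, exp_log (mul_ne_zero (exp_ne_zero _) (div_ne_zero ha' hb')),
    mul_div_cancel_left₀ _ (exp_ne_zero _)]

theorem norm_arcFactor {κ s e : ℝ} {ζ : ℂ} (ha : ζ ≠ pt s) (hb : ζ ≠ pt e) :
    ‖arcFactor κ s e ζ‖ = Real.exp (-(beta κ * (arcLog s e ζ).im)) *
      (‖ζ - pt s‖ ^ (-(1 / 2) : ℝ) * ‖ζ - pt e‖ ^ (-(1 / 2) : ℝ)) := by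
  have ha' : 0 < ‖ζ - pt s‖ := norm_pos_iff.2 (sub_ne_zero.2 ha)
  have hb' : 0 < ‖ζ - pt e‖ := norm_pos_iff.2 (sub_ne_zero.2 hb)
  have hre : (arcLog s e ζ).re = Real.log ‖ζ - pt s‖ - Real.log ‖ζ - pt e‖ := by
    rw [← Real.log_div ha'.ne' hb'.ne', ← norm_div, ← exp_arcLog ha hb, norm_exp, Real.log_exp]
  rw [arcFactor, norm_div, norm_exp, Real.rpow_def_of_pos ha', Real.rpow_def_of_pos hb']
  conv_lhs => rw [← Real.exp_log hb']
  rw [← Real.exp_sub, ← Real.exp_add, ← Real.exp_add]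
  congr 1
  simp only [mul_re, add_re, add_im, I_re, I_im, ofReal_re, ofReal_im, mul_im, hre]
  norm_num
  ring

theorem abs_im_arcLog_le {s e : ℝ} (h : s < e) (h' : e < s + 2 * Real.pi) (ζ : ℂ) :
    |(arcLog s e ζ).im| ≤ 2 * Real.pi := by
  have : (arcLog s e ζ).im = arg (arcW s e ζ) - (e - s) / 2 := by
    rw [arcLog_eq, sub_im, log_im, im_ofReal_mul, I_im, mul_one]
  rw [this, abs_le]
  have h1 := neg_pi_lt_arg (arcW s e ζ)
  have h2 := arg_le_pi (arcW s e ζ)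
  constructor <;> linarith

/-- The imaginary part `β` of the exponent only contributes `exp (-β Im arcLog)`. Since `2πβ = log
κ` and `|Im arcLog| ≤ 2π`, this factor lies between `κ⁻¹` and `κ`. -/
theorem norm_arcFactor_le {κ s e : ℝ} (hκ : 1 < κ) (h : s < e) (h' : e < s + 2 * Real.pi) {ζ : ℂ}
    (ha : ζ ≠ pt s) (hb : ζ ≠ pt e) :
    ‖arcFactor κ s e ζ‖ ≤ κ * (‖ζ - pt s‖ ^ (-(1 / 2) : ℝ) * ‖ζ - pt e‖ ^ (-(1 / 2) : ℝ)) ∧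
    ‖(arcFactor κ s e ζ)⁻¹‖ ≤ κ * (‖ζ - pt s‖ ^ (1 / 2 : ℝ) * ‖ζ - pt e‖ ^ (1 / 2 : ℝ)) := by
  have hβ : beta κ * (2 * Real.pi) = Real.log κ := by
    rw [beta]; field_simp
  have hβ0 : 0 ≤ beta κ := div_nonneg (Real.log_nonneg hκ.le) Real.two_pi_pos.le
  have hle : |beta κ * (arcLog s e ζ).im| ≤ Real.log κ := by
    rw [abs_mul, abs_of_nonneg hβ0, ← hβ]
    exact mul_le_mul_of_nonneg_left (abs_im_arcLog_le h h' ζ) hβ0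
  have hκ' : Real.exp (Real.log κ) = κ := Real.exp_log (by linarith)
  constructor
  · rw [norm_arcFactor ha hb]
    gcongr
    exact (Real.exp_le_exp.2 ((neg_le_abs _).trans hle)).trans_eq hκ'
  · rw [norm_inv, norm_arcFactor ha hb, mul_inv, mul_inv, ← Real.exp_neg, neg_neg,
      Real.rpow_neg (norm_nonneg _), Real.rpow_neg (norm_nonneg _), inv_inv, inv_inv]
    gcongr
    exact (Real.exp_le_exp.2 ((le_abs_self _).trans hle)).trans_eq hκ'

theorem continuousAt_arcW (s e : ℝ) {ζ : ℂ} (hb : ζ ≠ pt e) : ContinuousAt (arcW s e) ζ := by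
  unfold arcW
  exact continuousAt_const.mul ((continuousAt_id.sub continuousAt_const).div
    (continuousAt_id.sub continuousAt_const) (sub_ne_zero.2 hb))

/-- Boundary values of a factor on its arc, which have the ratio `-κ`. -/
theorem exists_tendsto_arcFactor_of_mem_arc {κ s e φ : ℝ} (hκ : 1 < κ) (h : s < e)
    (h' : e < s + 2 * Real.pi) (hφ : φ ∈ Set.Ioo s e) :
    ∃ m : ℂ, m ≠ 0 ∧ Tendsto (arcFactor κ s e) (𝓝[disk] (pt φ)) (𝓝 (-κ * m)) ∧
      Tendsto (arcFactor κ s e) (𝓝[exterior] (pt φ)) (𝓝 m) := by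
  obtain ⟨hre, him⟩ := arcW_re_neg h' hφ
  have hb : pt φ ≠ pt e := pt_ne_pt hφ.2 (by linarith [hφ.1])
  have hb' : pt φ - pt e ≠ 0 := sub_ne_zero.2 hb
  have hc := continuousAt_arcW s e hb
  have hsin : 0 < Real.sin ((e - s) / 2) :=
    Real.sin_pos_of_pos_of_lt_pi (by linarith) (by linarith)
  have hsub : ∀ (l : ℂ) (S : Set ℂ), Tendsto (fun ζ => log (arcW s e ζ)) (𝓝[S] (pt φ)) (𝓝 l) →
      Tendsto (arcFactor κ s e) (𝓝[S] (pt φ)) (𝓝 (exp ((-1 / 2 + I * beta κ) *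
        (l - ((e - s) / 2 : ℝ) * I)) / (pt φ - pt e))) := by
    intro l S hl
    refine Tendsto.div ?_ ((continuousAt_id.sub continuousAt_const).tendsto.mono_left
      nhdsWithin_le_nhds) hb'
    exact (continuous_exp.tendsto _).comp ((hl.sub_const _).const_mul _)
  -- From inside, `arcW` reaches the negative axis from below and the logarithm tends to the value
  -- with imaginary part `-π`; from outside it is `+π`.
  have hin := hsub _ disk ((tendsto_log_nhdsWithin_im_neg_of_re_neg_of_im_zero hre him).comp
    (tendsto_nhdsWithin_iff.2 ⟨hc.tendsto.mono_left nhdsWithin_le_nhds, by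
      filter_upwards [self_mem_nhdsWithin] with ζ hζ
      have hζ' : ‖ζ‖ < 1 := hζ
      have hne : ζ - pt e ≠ 0 := fun hc => by
        rw [sub_eq_zero.1 hc, norm_pt] at hζ'; exact lt_irrefl _ hζ'
      change (arcW s e ζ).im < 0
      rw [arcW_im]
      refine div_neg_of_neg_of_pos (mul_neg_of_pos_of_neg hsin ?_) (normSq_pos.2 hne)
      nlinarith [norm_nonneg ζ]⟩))
  have hout := hsub _ exterior ((tendsto_log_nhdsWithin_im_nonneg_of_re_neg_of_im_zero hre him).comp
    (tendsto_nhdsWithin_iff.2 ⟨hc.tendsto.mono_left nhdsWithin_le_nhds, by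
      filter_upwards [self_mem_nhdsWithin] with ζ hζ
      have hζ' : 1 < ‖ζ‖ := hζ
      change 0 ≤ (arcW s e ζ).im
      rw [arcW_im]
      refine div_nonneg (mul_nonneg hsin.le ?_) (normSq_nonneg _)
      nlinarith [norm_nonneg ζ]⟩))
  refine ⟨_, div_ne_zero (exp_ne_zero _) hb', ?_, hout⟩
  convert hin using 2
  rw [mul_div_assoc']
  congr 1
  -- The two logarithms differ by `-2πi`, so the boundary values have the ratio `exp ((-1/2 +
  -- iβ)(-2πi)) = exp (πi + 2πβ) = -κ`.
  have hβ : (beta κ : ℂ) * (2 * Real.pi) = Real.log κ := by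
    rw [beta]
    push_cast
    field_simp
  have hκ' : (κ : ℂ) = exp (beta κ * (2 * Real.pi)) := by
    rw [hβ, ← ofReal_exp, Real.exp_log (by linarith)]
  have hκ2 : (-κ : ℂ) = exp (Real.pi * I + beta κ * (2 * Real.pi)) := by
    rw [exp_add, exp_pi_mul_I, ← hκ']; ring
  rw [hκ2, ← exp_add]
  congr 1
  linear_combination ((beta κ : ℂ) * 2 * Real.pi) * I_sq

theorem tendsto_mul_arcFactor (κ : ℝ) {s e : ℝ} (h : s < e) (h' : e < s + 2 * Real.pi) :
    Tendsto (fun ζ => ζ * arcFactor κ s e ζ) (cobounded ℂ) (𝓝 1) := by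
  have hinv : ∀ c : ℂ, Tendsto (fun ζ : ℂ => (ζ - c) / ζ) (cobounded ℂ) (𝓝 1) := by
    intro c
    have h1 : Tendsto (fun ζ : ℂ => 1 - c * ζ⁻¹) (cobounded ℂ) (𝓝 (1 - c * 0)) :=
      (tendsto_inv₀_cobounded.const_mul c).const_sub 1
    rw [mul_zero, sub_zero] at h1
    refine h1.congr' ?_
    filter_upwards [eventually_ne_cobounded (0 : ℂ)] with ζ hζ
    field_simp
  have hq : Tendsto (arcW s e) (cobounded ℂ) (𝓝 (exp (((e - s) / 2 : ℝ) * I))) := by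
    have h1 := ((hinv (pt s)).div (hinv (pt e)) one_ne_zero).const_mul
      (exp (((e - s) / 2 : ℝ) * I))
    rw [div_one, mul_one] at h1
    refine h1.congr' ?_
    filter_upwards [eventually_ne_cobounded (0 : ℂ)] with ζ hζ
    simp only [Pi.div_apply]
    rw [div_div_div_cancel_right₀ hζ, arcW]
  have hsl : exp (((e - s) / 2 : ℝ) * I) ∈ slitPlane := by
    refine mem_slitPlane_iff.2 (Or.inr ?_)
    rw [exp_ofReal_mul_I_im]
    exact (Real.sin_pos_of_pos_of_lt_pi (by linarith) (by linarith)).ne'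
  -- As `0 < (e - s)/2 < π`, the principal logarithm of the limit is exactly the constant subtracted
  -- in `arcLog`; this is why the branch vanishes at infinity.
  have hlog : log (exp (((e - s) / 2 : ℝ) * I)) = ((e - s) / 2 : ℝ) * I := by
    refine log_exp ?_ ?_ <;> simp <;> linarith [Real.pi_pos]
  have hL : Tendsto (arcLog s e) (cobounded ℂ) (𝓝 0) := by
    have h1 := (hq.clog hsl).sub_const (((e - s) / 2 : ℝ) * I)
    rwa [hlog, sub_self] at h1
  have hE := (continuous_exp.tendsto _).comp (hL.const_mul (-1 / 2 + I * beta κ))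
  rw [mul_zero, exp_zero] at hE
  have h2 := hE.div (hinv (pt e)) one_ne_zero
  rw [div_one] at h2
  refine h2.congr fun ζ => ?_
  simp only [Pi.div_apply, Function.comp, arcFactor]
  rw [div_div_eq_mul_div]
  ring

/-! ### The canonical function -/

namespace ArcSystem

variable {n : ℕ} (A : ArcSystem n)

theorem finish_lt (k : Fin n) : A.finish k < A.start k + 2 * Real.pi :=
  A.finish_lt_start_add k k

theorem notMem_closedArc {j k : Fin n} (hjk : j ≠ k) {t : ℂ}
    (ht : t ∈ closedArc (A.start k) (A.finish k)) : t ∉ closedArc (A.start j) (A.finish j) := by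
  rintro ⟨ψ, hψ, h⟩
  obtain ⟨φ, hφ, rfl⟩ := ht
  have h1 := A.finish_lt_start_add j k
  have h2 := A.finish_lt_start_add k j
  have h3 := eq_of_pt_eq_pt h (by linarith [hψ.2, hφ.1]) (by linarith [hψ.1, hφ.2])
  subst h3
  rcases lt_or_gt_of_ne hjk with h4 | h4
  · linarith [A.finish_lt_start j k h4, hψ.2, hφ.1]
  · linarith [A.finish_lt_start k j h4, hψ.1, hφ.2]

theorem gammaU_union_ends : A.gammaU ∪ A.ends = ⋃ k, closedArc (A.start k) (A.finish k) := by
  ext t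
  simp only [Set.mem_union, gammaU, ends, Set.mem_ofPred_eq, Set.mem_iUnion, closedArc,
    Set.mem_image]
  constructor
  · rintro (⟨k, φ, hφ, rfl⟩ | ⟨k, rfl | rfl⟩)
    · exact ⟨k, φ, ⟨hφ.1.le, hφ.2.le⟩, rfl⟩
    · exact ⟨k, _, ⟨le_rfl, (A.start_lt_finish k).le⟩, rfl⟩
    · exact ⟨k, _, ⟨(A.start_lt_finish k).le, le_rfl⟩, rfl⟩
  · rintro ⟨k, φ, hφ, rfl⟩
    rcases hφ.1.eq_or_lt with h | h
    · exact Or.inr ⟨k, Or.inl (by rw [h])⟩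
    rcases hφ.2.eq_or_lt with h' | h'
    · exact Or.inr ⟨k, Or.inr (by rw [h'])⟩
    · exact Or.inl ⟨k, φ, ⟨h, h'⟩, rfl⟩

theorem norm_of_mem_ends {t : ℂ} (ht : t ∈ A.ends) : ‖t‖ = 1 := by
  obtain ⟨k, rfl | rfl⟩ := ht <;> exact norm_pt _

theorem norm_of_mem_gammaU {t : ℂ} (ht : t ∈ A.gammaU) : ‖t‖ = 1 := by
  obtain ⟨k, φ, -, rfl⟩ := ht
  exact norm_pt _

theorem finite_ends : A.ends.Finite := by
  have : A.ends = Set.range (fun k => pt (A.start k)) ∪ Set.range (fun k => pt (A.finish k)) := by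
    ext t
    simp only [ends, Set.mem_ofPred_eq, Set.mem_union, Set.mem_range, exists_or, eq_comm]
  rw [this]
  exact (Set.finite_range _).union (Set.finite_range _)

theorem notMem_ends_of_mem_gammaU {t : ℂ} (ht : t ∈ A.gammaU) : t ∉ A.ends := by
  obtain ⟨k, φ, hφ, rfl⟩ := ht
  rintro ⟨j, hj⟩
  have hφ' : pt φ ∈ closedArc (A.start k) (A.finish k) := ⟨φ, ⟨hφ.1.le, hφ.2.le⟩, rfl⟩
  have hlt := A.finish_lt k
  by_cases hjk : j = k
  · subst hjk
    rcases hj with hj | hj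
    · exact pt_ne_pt hφ.1 (by linarith [hφ.2]) hj.symm
    · exact pt_ne_pt hφ.2 (by linarith [hφ.1]) hj
  · refine A.notMem_closedArc hjk hφ' ?_
    rcases hj with hj | hj
    · exact ⟨_, ⟨le_rfl, (A.start_lt_finish j).le⟩, hj.symm⟩
    · exact ⟨_, ⟨(A.start_lt_finish j).le, le_rfl⟩, hj.symm⟩

theorem mem_gammaU_union_gammaS_iff {t : ℂ} :
    t ∈ A.gammaU ∪ A.gammaS ↔ ‖t‖ = 1 ∧ t ∉ A.ends := by
  constructor
  · rintro (h | h)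
    · exact ⟨A.norm_of_mem_gammaU h, A.notMem_ends_of_mem_gammaU h⟩
    · exact ⟨h.1, h.2.2⟩
  · rintro ⟨h, h'⟩
    by_cases hU : t ∈ A.gammaU
    · exact Or.inl hU
    · exact Or.inr ⟨h, hU, h'⟩

theorem notMem_closedArc_of_notMem {t : ℂ} (ht : t ∉ A.gammaU ∪ A.ends) (k : Fin n) :
    t ∉ closedArc (A.start k) (A.finish k) := by
  rw [A.gammaU_union_ends] at ht
  exact fun h => ht (Set.mem_iUnion.2 ⟨k, h⟩)

theorem notMem_of_norm_ne_one {t : ℂ} (ht : ‖t‖ ≠ 1) : t ∉ A.gammaU ∪ A.ends := by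
  rintro (h | h)
  · exact ht (A.norm_of_mem_gammaU h)
  · exact ht (A.norm_of_mem_ends h)

end ArcSystem

theorem ne_pt_of_notMem_closedArc {s e : ℝ} (h : s ≤ e) {ζ : ℂ} (hζ : ζ ∉ closedArc s e) :
    ζ ≠ pt s ∧ ζ ≠ pt e :=
  ⟨fun hc => hζ ⟨s, ⟨le_rfl, h⟩, hc.symm⟩, fun hc => hζ ⟨e, ⟨h, le_rfl⟩, hc.symm⟩⟩

section CanonicalFunction

variable {n : ℕ} (A : ArcSystem n) {κ : ℝ}

theorem differentiableAt_X0 (κ : ℝ) {ζ : ℂ} (hζ : ζ ∉ A.gammaU ∪ A.ends) :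
    DifferentiableAt ℂ (X0 A κ) ζ := by
  have h : X0 A κ = ∏ k, arcFactor κ (A.start k) (A.finish k) := by
    ext z
    simp [X0]
  rw [h]
  exact DifferentiableAt.finsetProd fun k _ => (hasDerivAt_arcFactor κ (A.start_lt_finish k)
    (A.finish_lt k) (A.notMem_closedArc_of_notMem hζ k)).differentiableAt

theorem X0_ne_zero (κ : ℝ) {ζ : ℂ} (hζ : ζ ∉ A.ends) : X0 A κ ζ ≠ 0 :=
  Finset.prod_ne_zero_iff.2 fun k _ => arcFactor_ne_zero κ fun h => hζ ⟨k, Or.inr h⟩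

theorem tendsto_pow_mul_X0 (κ : ℝ) :
    Tendsto (fun ζ => ζ ^ n * X0 A κ ζ) (cobounded ℂ) (𝓝 1) := by
  have h := tendsto_finsetProd Finset.univ fun k _ =>
    tendsto_mul_arcFactor κ (A.start_lt_finish k) (A.finish_lt k)
  rw [Finset.prod_const_one] at h
  refine h.congr fun ζ => ?_
  rw [Finset.prod_mul_distrib]
  simp [X0]

theorem closure_disk_mem {t : ℂ} (ht : ‖t‖ = 1) : t ∈ closure disk := by
  have : disk = Metric.ball (0 : ℂ) 1 := by ext; simp [disk]
  rw [this, closure_ball _ one_ne_zero]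
  simp [ht]

theorem closure_exterior_mem {t : ℂ} (ht : ‖t‖ = 1) : t ∈ closure exterior := by
  have : exterior = (Metric.closedBall (0 : ℂ) 1)ᶜ := by ext; simp [exterior]
  rw [this, closure_compl, interior_closedBall _ one_ne_zero]
  simp [ht]

theorem neBot_disk {t : ℂ} (ht : ‖t‖ = 1) : (𝓝[disk] t).NeBot :=
  mem_closure_iff_nhdsWithin_neBot.1 (closure_disk_mem ht)

theorem neBot_exterior {t : ℂ} (ht : ‖t‖ = 1) : (𝓝[exterior] t).NeBot :=
  mem_closure_iff_nhdsWithin_neBot.1 (closure_exterior_mem ht)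

theorem isOpen_disk : IsOpen disk := isOpen_lt continuous_norm continuous_const

theorem isOpen_exterior : IsOpen exterior := isOpen_lt continuous_const continuous_norm

/-- Only the factor of the arc containing `t` jumps; the closed arcs are disjoint, so the other
factors are continuous and non-zero at `t`. -/
theorem exists_tendsto_X0_of_mem_gammaU (hκ : 1 < κ) {t : ℂ} (ht : t ∈ A.gammaU) :
    ∃ m : ℂ, m ≠ 0 ∧ Tendsto (X0 A κ) (𝓝[disk] t) (𝓝 (-κ * m)) ∧
      Tendsto (X0 A κ) (𝓝[exterior] t) (𝓝 m) := by
  obtain ⟨k, φ, hφ, rfl⟩ := ht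
  obtain ⟨m, hm, h1, h2⟩ := exists_tendsto_arcFactor_of_mem_arc hκ (A.start_lt_finish k)
    (A.finish_lt k) hφ
  have hφ' : pt φ ∈ closedArc (A.start k) (A.finish k) := ⟨φ, ⟨hφ.1.le, hφ.2.le⟩, rfl⟩
  set r : ℂ := ∏ j ∈ Finset.univ.erase k, arcFactor κ (A.start j) (A.finish j) (pt φ) with hr
  have hc : Tendsto (fun ζ => ∏ j ∈ Finset.univ.erase k, arcFactor κ (A.start j) (A.finish j) ζ)
      (𝓝 (pt φ)) (𝓝 r) := by
    refine tendsto_finsetProd _ fun j hj => ?_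
    exact (hasDerivAt_arcFactor κ (A.start_lt_finish j) (A.finish_lt j)
      (A.notMem_closedArc (Finset.ne_of_mem_erase hj) hφ')).continuousAt
  have hr0 : r ≠ 0 := Finset.prod_ne_zero_iff.2 fun j hj => arcFactor_ne_zero κ
    (ne_pt_of_notMem_closedArc (A.start_lt_finish j).le
      (A.notMem_closedArc (Finset.ne_of_mem_erase hj) hφ')).2
  have hX : ∀ ζ, arcFactor κ (A.start k) (A.finish k) ζ *
      ∏ j ∈ Finset.univ.erase k, arcFactor κ (A.start j) (A.finish j) ζ = X0 A κ ζ :=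
    fun ζ => Finset.mul_prod_erase _ (fun j => arcFactor κ (A.start j) (A.finish j) ζ)
      (Finset.mem_univ k)
  refine ⟨m * r, mul_ne_zero hm hr0, ?_, ?_⟩
  · rw [← mul_assoc]
    exact (h1.mul (hc.mono_left nhdsWithin_le_nhds)).congr hX
  · exact (h2.mul (hc.mono_left nhdsWithin_le_nhds)).congr hX

theorem continuousAt_X0_of_mem_gammaS (κ : ℝ) {t : ℂ} (ht : t ∈ A.gammaS) :
    ContinuousAt (X0 A κ) t :=
  (differentiableAt_X0 A κ (fun h => h.elim ht.2.1 ht.2.2)).continuousAt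

theorem innerValue_eq {F : ℂ → ℂ} {t l : ℂ} (ht : ‖t‖ = 1) (h : Tendsto F (𝓝[disk] t) (𝓝 l)) :
    innerValue F t = l :=
  have := neBot_disk ht
  h.limUnder_eq

theorem outerValue_eq {F : ℂ → ℂ} {t l : ℂ} (ht : ‖t‖ = 1)
    (h : Tendsto F (𝓝[exterior] t) (𝓝 l)) : outerValue F t = l :=
  have := neBot_exterior ht
  h.limUnder_eq

theorem boundary_X0_of_mem_gammaU (hκ : 1 < κ) {t : ℂ} (ht : t ∈ A.gammaU) :
    Tendsto (X0 A κ) (𝓝[disk] t) (𝓝 (innerValue (X0 A κ) t)) ∧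
    Tendsto (X0 A κ) (𝓝[exterior] t) (𝓝 (outerValue (X0 A κ) t)) ∧
    innerValue (X0 A κ) t ≠ 0 ∧
    innerValue (X0 A κ) t = -κ * outerValue (X0 A κ) t := by
  obtain ⟨m, hm, h1, h2⟩ := exists_tendsto_X0_of_mem_gammaU A hκ ht
  have hn := A.norm_of_mem_gammaU ht
  rw [innerValue_eq hn h1, outerValue_eq hn h2]
  exact ⟨h1, h2, mul_ne_zero (neg_ne_zero.2 (ofReal_ne_zero.2 (by linarith))) hm, rfl⟩

theorem boundary_X0_of_mem_gammaS (κ : ℝ) {t : ℂ} (ht : t ∈ A.gammaS) :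
    innerValue (X0 A κ) t = X0 A κ t ∧ outerValue (X0 A κ) t = X0 A κ t :=
  have hc := (continuousAt_X0_of_mem_gammaS A κ ht).tendsto
  ⟨innerValue_eq ht.1 (hc.mono_left nhdsWithin_le_nhds),
    outerValue_eq ht.1 (hc.mono_left nhdsWithin_le_nhds)⟩

theorem boundary_X0 (hκ : 1 < κ) {t : ℂ} (ht : t ∈ A.gammaU ∪ A.gammaS) :
    Tendsto (X0 A κ) (𝓝[disk] t) (𝓝 (innerValue (X0 A κ) t)) ∧
    Tendsto (X0 A κ) (𝓝[exterior] t) (𝓝 (outerValue (X0 A κ) t)) ∧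
    innerValue (X0 A κ) t ≠ 0 ∧ outerValue (X0 A κ) t ≠ 0 := by
  rcases ht with ht | ht
  · obtain ⟨h1, h2, h3, h4⟩ := boundary_X0_of_mem_gammaU A hκ ht
    exact ⟨h1, h2, h3, fun h => h3 (by rw [h4, h, mul_zero])⟩
  · obtain ⟨h1, h2⟩ := boundary_X0_of_mem_gammaS A κ ht
    have hc := (continuousAt_X0_of_mem_gammaS A κ ht).tendsto
    rw [h1, h2]
    exact ⟨hc.mono_left nhdsWithin_le_nhds, hc.mono_left nhdsWithin_le_nhds,
      X0_ne_zero A κ ht.2.2, X0_ne_zero A κ ht.2.2⟩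

/-- At an end point, a factor is of order `-1/2`. -/
theorem isBigO_arcFactor {κ s e : ℝ} (hκ : 1 < κ) (h : s < e) (h' : e < s + 2 * Real.pi) {c : ℂ}
    (hc : c = pt s ∨ c = pt e) :
    arcFactor κ s e =O[𝓝[{ζ | ‖ζ‖ ≠ 1}] c] fun ζ => ‖ζ - c‖ ^ (-(1 / 2) : ℝ) := by
  have hne := pt_ne_pt h h'
  have hlim : ∀ d : ℂ, c ≠ d → (fun ζ : ℂ => ‖ζ - d‖ ^ (-(1 / 2) : ℝ))
      =O[𝓝[{ζ | ‖ζ‖ ≠ 1}] c] fun _ => (1 : ℝ) := by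
    intro d hd
    have h1 : ContinuousAt (fun ζ : ℂ => ‖ζ - d‖ ^ (-(1 / 2) : ℝ)) c := by
      refine ContinuousAt.rpow_const (by fun_prop) (Or.inl ?_)
      exact (norm_pos_iff.2 (sub_ne_zero.2 hd)).ne'
    exact (h1.tendsto.mono_left nhdsWithin_le_nhds).isBigO_one ℝ
  have hmain : arcFactor κ s e =O[𝓝[{ζ | ‖ζ‖ ≠ 1}] c] fun ζ =>
      ‖ζ - pt s‖ ^ (-(1 / 2) : ℝ) * ‖ζ - pt e‖ ^ (-(1 / 2) : ℝ) := by
    refine Asymptotics.IsBigO.of_bound κ ?_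
    filter_upwards [self_mem_nhdsWithin] with ζ hζ
    have hζ' : ‖ζ‖ ≠ 1 := hζ
    rw [Real.norm_of_nonneg (by positivity)]
    exact (norm_arcFactor_le hκ h h' (fun h => hζ' (by rw [h, norm_pt]))
      (fun h => hζ' (by rw [h, norm_pt]))).1
  refine hmain.trans ?_
  rcases hc with rfl | rfl
  · simpa using (Asymptotics.isBigO_refl _ _).mul (hlim _ hne)
  · simpa using (hlim _ hne.symm).mul (Asymptotics.isBigO_refl _ _)

theorem isBigO_X0 (hκ : 1 < κ) {c : ℂ} (hc : c ∈ A.ends) :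
    X0 A κ =O[𝓝[{ζ | ‖ζ‖ ≠ 1}] c] fun ζ => ‖ζ - c‖ ^ (-(1 / 2) : ℝ) := by
  obtain ⟨k, hk⟩ := hc
  have hc' : c ∈ closedArc (A.start k) (A.finish k) := by
    rcases hk with rfl | rfl
    · exact ⟨_, ⟨le_rfl, (A.start_lt_finish k).le⟩, rfl⟩
    · exact ⟨_, ⟨(A.start_lt_finish k).le, le_rfl⟩, rfl⟩
  have h1 : (fun ζ => ∏ j ∈ Finset.univ.erase k, arcFactor κ (A.start j) (A.finish j) ζ)
      =O[𝓝[{ζ | ‖ζ‖ ≠ 1}] c] fun _ => (1 : ℝ) := by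
    have : Tendsto (fun ζ => ∏ j ∈ Finset.univ.erase k, arcFactor κ (A.start j) (A.finish j) ζ)
        (𝓝 c) (𝓝 (∏ j ∈ Finset.univ.erase k, arcFactor κ (A.start j) (A.finish j) c)) :=
      tendsto_finsetProd _ fun j hj =>
        (hasDerivAt_arcFactor κ (A.start_lt_finish j) (A.finish_lt j)
          (A.notMem_closedArc (Finset.ne_of_mem_erase hj) hc')).continuousAt
    exact (this.mono_left nhdsWithin_le_nhds).isBigO_one ℝ
  have h2 := (isBigO_arcFactor hκ (A.start_lt_finish k) (A.finish_lt k) hk).mul h1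
  simp only [mul_one] at h2
  refine h2.congr_left fun ζ => ?_
  exact Finset.mul_prod_erase _ (fun j => arcFactor κ (A.start j) (A.finish j) ζ)
    (Finset.mem_univ k)

/-! ### Hölder continuity of the reciprocal of the canonical function -/

/-- A bounded function on the disk that is Hölder continuous with exponent `1/2`. -/
def HalfHolder (F : ℂ → ℂ) : Prop :=
  ∃ M : ℝ, 0 ≤ M ∧ (∀ z ∈ disk, ‖F z‖ ≤ M) ∧
    ∀ z ∈ disk, ∀ w ∈ disk, ‖F z - F w‖ ≤ M * ‖z - w‖ ^ (1 / 2 : ℝ)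

theorem HalfHolder.one : HalfHolder fun _ => 1 :=
  ⟨1, zero_le_one, by simp, fun z _ w _ => by simpa using Real.rpow_nonneg (norm_nonneg _) _⟩

theorem HalfHolder.mul {F G : ℂ → ℂ} (hF : HalfHolder F) (hG : HalfHolder G) :
    HalfHolder fun z => F z * G z := by
  obtain ⟨M, hM, hF1, hF2⟩ := hF
  obtain ⟨L, hL, hG1, hG2⟩ := hG
  refine ⟨2 * (M * L), by positivity, fun z hz => ?_, fun z hz w hw => ?_⟩
  · rw [norm_mul]
    have := mul_le_mul (hF1 z hz) (hG1 z hz) (norm_nonneg _) hM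
    nlinarith [mul_nonneg hM hL]
  · have h : F z * G z - F w * G w = (F z - F w) * G z + F w * (G z - G w) := by ring
    rw [h]
    refine (norm_add_le _ _).trans ?_
    rw [norm_mul, norm_mul]
    have h1 := mul_le_mul (hF2 z hz w hw) (hG1 z hz) (norm_nonneg _) (by positivity)
    have h2 := mul_le_mul (hF1 w hw) (hG2 z hz w hw) (norm_nonneg _) hM
    linarith

theorem HalfHolder.finsetProd {ι : Type*} (s : Finset ι) {F : ι → ℂ → ℂ}
    (h : ∀ i ∈ s, HalfHolder (F i)) : HalfHolder fun z => ∏ i ∈ s, F i z := by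
  classical
  induction s using Finset.induction_on with
  | empty => simpa using HalfHolder.one
  | insert a s ha ih =>
    simp only [Finset.prod_insert ha]
    exact (h a (Finset.mem_insert_self _ _)).mul
      (ih fun i hi => h i (Finset.mem_insert_of_mem hi))

/-- If `z` is closer than `2‖z - w‖` to `a` or `b`, both values are small by the square-root bounds.
Otherwise the segment from `z` to `w` keeps the distance `d = ‖z - w‖` from both points; there `F/(ξ
- c)` is of order `d ^ (-1/2)`, and the mean value inequality gives `d ^ (1/2)`. -/
theorem halfHolder_of_hasDerivAt {F : ℂ → ℂ} {a b p q : ℂ} {M : ℝ} (ha : ‖a‖ = 1)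
    (hM : 0 ≤ M) (hd : ∀ z ∈ disk, HasDerivAt F (F z * (p * (z - a)⁻¹ + q * (z - b)⁻¹)) z)
    (h1 : ∀ z ∈ disk, ‖F z‖ ≤ M * ‖z - a‖ ^ (1 / 2 : ℝ))
    (h2 : ∀ z ∈ disk, ‖F z‖ ≤ M * ‖z - b‖ ^ (1 / 2 : ℝ)) : HalfHolder F := by
  have hconv : Convex ℝ disk := by
    have : disk = Metric.ball (0 : ℂ) 1 := by ext; simp [disk]
    rw [this]; exact convex_ball _ _
  have h4 : ∀ d : ℝ, 0 ≤ d → (4 * d) ^ (1 / 2 : ℝ) = 2 * d ^ (1 / 2 : ℝ) := by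
    intro d hd
    rw [Real.mul_rpow (by norm_num) hd, show (4 : ℝ) = 2 ^ (2 : ℝ) by norm_num,
      ← Real.rpow_mul (by norm_num)]
    norm_num
  have far : ∀ c : ℂ, (∀ z ∈ disk, ‖F z‖ ≤ M * ‖z - c‖ ^ (1 / 2 : ℝ)) → ∀ z ∈ disk, ∀ w ∈ disk,
      ‖z - c‖ < 2 * ‖z - w‖ → ‖F z - F w‖ ≤ 4 * M * ‖z - w‖ ^ (1 / 2 : ℝ) := by
    intro c hc z hz w hw hlt
    have hw' : ‖w - c‖ ≤ 4 * ‖z - w‖ := by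
      have : w - c = (z - c) - (z - w) := by ring
      rw [this]
      linarith [norm_sub_le (z - c) (z - w), norm_nonneg (z - w)]
    have hz' : ‖z - c‖ ≤ 4 * ‖z - w‖ := by linarith [norm_nonneg (z - w)]
    have e1 := (hc z hz).trans (mul_le_mul_of_nonneg_left
      (Real.rpow_le_rpow (norm_nonneg _) hz' (by norm_num : (0 : ℝ) ≤ 1 / 2)) hM)
    have e2 := (hc w hw).trans (mul_le_mul_of_nonneg_left
      (Real.rpow_le_rpow (norm_nonneg _) hw' (by norm_num : (0 : ℝ) ≤ 1 / 2)) hM)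
    rw [h4 _ (norm_nonneg _)] at e1 e2
    linarith [norm_sub_le (F z) (F w)]
  -- The first entry bounds `F` itself, as `‖z - a‖ ≤ 4` on the disk. In the second, `4 * M` serves
  -- the points near `a` or `b`, and the remaining term is the mean value constant.
  refine ⟨max (M * 2) (4 * M + (‖p‖ + ‖q‖) * M), by positivity, fun z hz => ?_,
    fun z hz w hw => ?_⟩
  · refine le_trans ((h1 z hz).trans (mul_le_mul_of_nonneg_left ?_ hM)) (le_max_left _ _)
    have hz1 : ‖z‖ < 1 := hz
    have : ‖z - a‖ ≤ 4 := by linarith [norm_sub_le z a]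
    refine (Real.rpow_le_rpow (norm_nonneg _) this (by norm_num)).trans_eq ?_
    have := h4 1 zero_le_one
    simpa using this
  · have hr : (0 : ℝ) ≤ ‖z - w‖ ^ (1 / 2 : ℝ) := by positivity
    refine le_trans ?_ (mul_le_mul_of_nonneg_right (le_max_right _ _) hr)
    by_cases hA : ‖z - a‖ < 2 * ‖z - w‖
    · refine (far a h1 z hz w hw hA).trans (mul_le_mul_of_nonneg_right ?_ hr)
      have : 0 ≤ (‖p‖ + ‖q‖) * M := by positivity
      linarith
    by_cases hB : ‖z - b‖ < 2 * ‖z - w‖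
    · refine (far b h2 z hz w hw hB).trans (mul_le_mul_of_nonneg_right ?_ hr)
      have : 0 ≤ (‖p‖ + ‖q‖) * M := by positivity
      linarith
    by_cases hzw : z = w
    · subst hzw
      simp
    have hd0 : 0 < ‖z - w‖ := norm_pos_iff.2 (sub_ne_zero.2 hzw)
    set d := ‖z - w‖ with hdd
    have hseg : ∀ ξ ∈ segment ℝ z w, ∀ c : ℂ, ¬ ‖z - c‖ < 2 * d → d ≤ ‖ξ - c‖ := by
      intro ξ hξ c hc
      have h5 : ‖z - ξ‖ ≤ d := by
        have := norm_sub_le_of_mem_segment hξ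
        rw [norm_sub_rev, hdd, norm_sub_rev z w]
        exact this
      have h6 : z - c = (z - ξ) + (ξ - c) := by ring
      have h7 := norm_add_le (z - ξ) (ξ - c)
      rw [← h6] at h7
      linarith [not_lt.1 hc]
    have term : ∀ ξ ∈ disk, ∀ c r : ℂ, ‖F ξ‖ ≤ M * ‖ξ - c‖ ^ (1 / 2 : ℝ) → d ≤ ‖ξ - c‖ →
        ‖F ξ * (r * (ξ - c)⁻¹)‖ ≤ ‖r‖ * M * d ^ (-(1 / 2) : ℝ) := by
      intro ξ hξ c r hF hdc
      have hpos : 0 < ‖ξ - c‖ := hd0.trans_le hdc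
      rw [norm_mul, norm_mul, norm_inv]
      calc ‖F ξ‖ * (‖r‖ * ‖ξ - c‖⁻¹)
          ≤ (M * ‖ξ - c‖ ^ (1 / 2 : ℝ)) * (‖r‖ * ‖ξ - c‖⁻¹) := by gcongr
        _ = ‖r‖ * M * ‖ξ - c‖ ^ (-(1 / 2) : ℝ) := by
            have : ‖ξ - c‖ ^ (-(1 / 2) : ℝ) = ‖ξ - c‖ ^ (1 / 2 : ℝ) * ‖ξ - c‖⁻¹ := by
              rw [← Real.rpow_neg_one, ← Real.rpow_add hpos]
              norm_num
            rw [this]; ring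
        _ ≤ ‖r‖ * M * d ^ (-(1 / 2) : ℝ) := by
            gcongr ?_ * ?_
            exact Real.rpow_le_rpow_of_nonpos hd0 hdc (by norm_num)
    have hmv := (convex_segment z w).norm_image_sub_le_of_norm_hasDerivWithin_le
      (f := F) (C := (‖p‖ + ‖q‖) * M * d ^ (-(1 / 2) : ℝ))
      (fun ξ hξ => (hd ξ (hconv.segment_subset hz hw hξ)).hasDerivWithinAt)
      (fun ξ hξ => by
        have hξ' := hconv.segment_subset hz hw hξ
        rw [mul_add]
        refine (norm_add_le _ _).trans ?_
        have e1 := term ξ hξ' a p (h1 ξ hξ') (hseg ξ hξ a hA)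
        have e2 := term ξ hξ' b q (h2 ξ hξ') (hseg ξ hξ b hB)
        linarith)
      (right_mem_segment ℝ z w) (left_mem_segment ℝ z w)
    refine hmv.trans ?_
    rw [← hdd, mul_assoc]
    have : d ^ (-(1 / 2) : ℝ) * d = d ^ (1 / 2 : ℝ) := by
      conv_lhs => rw [← Real.rpow_one d, ← Real.rpow_mul hd0.le, ← Real.rpow_add hd0]
      norm_num
    rw [this]
    gcongr
    linarith

/-- On the disk either of the two square roots is at most `2`, which leaves the vanishing at the
other end point visible. -/
theorem norm_inv_arcFactor_le {κ s e : ℝ} (hκ : 1 < κ) (h : s < e) (h' : e < s + 2 * Real.pi)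
    {z : ℂ} (hz : z ∈ disk) :
    ‖(arcFactor κ s e z)⁻¹‖ ≤ κ * 2 * ‖z - pt s‖ ^ (1 / 2 : ℝ) ∧
    ‖(arcFactor κ s e z)⁻¹‖ ≤ κ * 2 * ‖z - pt e‖ ^ (1 / 2 : ℝ) := by
  have hz1 : ‖z‖ < 1 := hz
  have hne : ∀ φ, z ≠ pt φ := fun φ hc => by rw [hc, norm_pt] at hz1; exact lt_irrefl _ hz1
  have h2 : ∀ φ, ‖z - pt φ‖ ^ (1 / 2 : ℝ) ≤ 2 := by
    intro φ
    have : ‖z - pt φ‖ ≤ 2 ^ (2 : ℝ) := by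
      have := norm_sub_le z (pt φ)
      rw [norm_pt] at this
      norm_num
      linarith
    refine (Real.rpow_le_rpow (norm_nonneg _) this (by norm_num)).trans_eq ?_
    rw [← Real.rpow_mul (by norm_num)]
    norm_num
  have h3 := (norm_arcFactor_le hκ h h' (hne s) (hne e)).2
  have p1 : (0 : ℝ) ≤ ‖z - pt s‖ ^ (1 / 2 : ℝ) := by positivity
  have p2 : (0 : ℝ) ≤ ‖z - pt e‖ ^ (1 / 2 : ℝ) := by positivity
  constructor
  · refine h3.trans ?_
    have := mul_le_mul_of_nonneg_left (h2 e) p1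
    nlinarith
  · refine h3.trans ?_
    have := mul_le_mul_of_nonneg_right (h2 s) p2
    nlinarith

theorem notMem_closedArc_of_mem_disk {s e : ℝ} {z : ℂ} (hz : z ∈ disk) : z ∉ closedArc s e := by
  rintro ⟨φ, -, rfl⟩
  have : ‖pt φ‖ < 1 := hz
  rw [norm_pt] at this
  exact lt_irrefl _ this

theorem halfHolder_inv_arcFactor {κ s e : ℝ} (hκ : 1 < κ) (h : s < e)
    (h' : e < s + 2 * Real.pi) : HalfHolder fun z => (arcFactor κ s e z)⁻¹ := by
  refine halfHolder_of_hasDerivAt (a := pt s) (b := pt e) (p := 1 / 2 - I * beta κ)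
    (q := 1 / 2 + I * beta κ) (M := κ * 2) (norm_pt s) (by linarith) ?_
    (fun z hz => (norm_inv_arcFactor_le hκ h h' hz).1)
    (fun z hz => (norm_inv_arcFactor_le hκ h h' hz).2)
  intro z hz
  have hz' : z ∉ closedArc s e := notMem_closedArc_of_mem_disk hz
  have hne := arcFactor_ne_zero κ (s := s) (ne_pt_of_notMem_closedArc h.le hz').2
  refine ((hasDerivAt_arcFactor κ h h' hz').inv hne).congr_deriv ?_
  field_simp
  ring

theorem halfHolder_inv_X0 (hκ : 1 < κ) : HalfHolder fun z => (X0 A κ z)⁻¹ := by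
  have := HalfHolder.finsetProd Finset.univ fun k _ =>
    halfHolder_inv_arcFactor hκ (A.start_lt_finish k) (A.finish_lt k)
  simpa only [X0, Finset.prod_inv_distrib] using this

/-- Uniform continuity on the disk sends the Cauchy filter of interior neighbourhoods of `t` to a
Cauchy filter. -/
theorem HalfHolder.exists_tendsto {F : ℂ → ℂ} (hF : HalfHolder F) {t : ℂ} (ht : ‖t‖ = 1) :
    Tendsto F (𝓝[disk] t) (𝓝 (innerValue F t)) := by
  obtain ⟨M, hM, -, hF2⟩ := hF
  have := neBot_disk ht
  have huc : UniformContinuousOn F disk := by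
    have hlim : Tendsto (fun x : ℝ => M * x ^ (1 / 2 : ℝ)) (𝓝 0) (𝓝 0) := by
      have h := ((Real.continuous_rpow_const (q := (1 / 2 : ℝ)) (by norm_num)).tendsto 0).const_mul M
      rwa [Real.zero_rpow (by norm_num), mul_zero] at h
    rw [Metric.uniformContinuousOn_iff]
    intro ε hε
    obtain ⟨δ, hδ, h⟩ := Metric.eventually_nhds_iff.1 (hlim.eventually (gt_mem_nhds hε))
    refine ⟨δ, hδ, fun z hz w hw hzw => ?_⟩
    rw [dist_eq_norm] at hzw ⊢
    refine (hF2 z hz w hw).trans_lt (h ?_)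
    rwa [dist_zero_right, norm_norm]
  have hc : Cauchy (map F (𝓝[disk] t)) := by
    have h1 : Cauchy (𝓝[disk] t) := cauchy_nhds.mono nhdsWithin_le_nhds
    refine ⟨inferInstance, ?_⟩
    rw [prod_map_map_eq]
    refine huc.mono_left ?_
    refine le_inf h1.2 ?_
    rw [le_principal_iff]
    exact prod_mem_prod self_mem_nhdsWithin self_mem_nhdsWithin
  obtain ⟨l, hl⟩ := cauchy_map_iff_exists_tendsto.1 hc
  exact tendsto_nhds_limUnder ⟨l, hl⟩

theorem HalfHolder.innerValue {F : ℂ → ℂ} (hF : HalfHolder F) :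
    ∃ M : ℝ, 0 ≤ M ∧ (∀ t, ‖t‖ = 1 → ‖innerValue F t‖ ≤ M) ∧ ∀ t t', ‖t‖ = 1 → ‖t'‖ = 1 →
      ‖RHProblem.innerValue F t - RHProblem.innerValue F t'‖ ≤ M * ‖t - t'‖ ^ (1 / 2 : ℝ) := by
  have hF' := hF
  obtain ⟨M, hM, hF1, hF2⟩ := hF'
  refine ⟨M, hM, fun t ht => ?_, fun t t' ht ht' => ?_⟩
  · have := neBot_disk ht
    refine le_of_tendsto (hF.exists_tendsto ht).norm ?_
    filter_upwards [self_mem_nhdsWithin] with z hz using hF1 z hz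
  · have := neBot_disk ht
    have := neBot_disk ht'
    have h1 := (hF.exists_tendsto ht).comp (tendsto_fst (g := 𝓝[disk] t'))
    have h2 := (hF.exists_tendsto ht').comp (tendsto_snd (f := 𝓝[disk] t))
    have h3 : Tendsto (fun p : ℂ × ℂ => M * ‖p.1 - p.2‖ ^ (1 / 2 : ℝ)) (𝓝[disk] t ×ˢ 𝓝[disk] t')
        (𝓝 (M * ‖t - t'‖ ^ (1 / 2 : ℝ))) := by
      have hc : Continuous fun p : ℂ × ℂ => M * ‖p.1 - p.2‖ ^ (1 / 2 : ℝ) :=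
        continuous_const.mul (Continuous.rpow_const (by fun_prop) fun _ => Or.inr (by norm_num))
      refine (hc.tendsto (t, t')).mono_left ?_
      rw [nhds_prod_eq]
      exact prod_mono nhdsWithin_le_nhds nhdsWithin_le_nhds
    refine le_of_tendsto_of_tendsto (h1.sub h2).norm h3 ?_
    filter_upwards [prod_mem_prod (self_mem_nhdsWithin (a := t) (s := disk))
      (self_mem_nhdsWithin (a := t') (s := disk))] with p hp using hF2 _ hp.1 _ hp.2

/-- The reciprocal of the inner boundary value of `X₀`; it vanishes at the end points. -/
def recipX0 {n : ℕ} (A : ArcSystem n) (κ : ℝ) (t : ℂ) : ℂ := innerValue (fun z => (X0 A κ z)⁻¹) t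

theorem recipX0_eq (hκ : 1 < κ) {t : ℂ} (ht : t ∈ A.gammaU ∪ A.gammaS) :
    recipX0 A κ t = (innerValue (X0 A κ) t)⁻¹ := by
  obtain ⟨h1, -, h3, -⟩ := boundary_X0 A hκ ht
  exact innerValue_eq (A.mem_gammaU_union_gammaS_iff.1 ht).1 (h1.inv₀ h3)

/-- The factor belonging to `c` has a reciprocal of order `‖z - c‖ ^ (1/2)`, and the other
reciprocals are bounded. Taking the limit of the reciprocal, not the reciprocal of the limit, gives
a meaningful value here, where `X₀` itself has no finite limit. -/
theorem recipX0_of_mem_ends (hκ : 1 < κ) {c : ℂ} (hc : c ∈ A.ends) : recipX0 A κ c = 0 := by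
  refine innerValue_eq (A.norm_of_mem_ends hc) ?_
  obtain ⟨k, hk⟩ := hc
  have hn : ‖c‖ = 1 := by rcases hk with rfl | rfl <;> exact norm_pt _
  obtain ⟨M, hM, hb, -⟩ := HalfHolder.finsetProd (Finset.univ.erase k) fun j _ =>
    halfHolder_inv_arcFactor hκ (A.start_lt_finish j) (A.finish_lt j)
  have hlim : Tendsto (fun z : ℂ => κ * 2 * ‖z - c‖ ^ (1 / 2 : ℝ) * M) (𝓝[disk] c) (𝓝 0) := by
    have hcont : Continuous fun z : ℂ => κ * 2 * ‖z - c‖ ^ (1 / 2 : ℝ) * M :=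
      (continuous_const.mul (Continuous.rpow_const (by fun_prop)
        fun _ => Or.inr (by norm_num))).mul continuous_const
    have := (hcont.tendsto c).mono_left (nhdsWithin_le_nhds (s := disk))
    simpa using this
  refine squeeze_zero_norm' ?_ hlim
  filter_upwards [self_mem_nhdsWithin] with z hz
  have hX : (X0 A κ z)⁻¹ = (arcFactor κ (A.start k) (A.finish k) z)⁻¹ *
      ∏ j ∈ Finset.univ.erase k, (arcFactor κ (A.start j) (A.finish j) z)⁻¹ := by
    rw [Finset.mul_prod_erase _ (fun j => (arcFactor κ (A.start j) (A.finish j) z)⁻¹)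
      (Finset.mem_univ k), Finset.prod_inv_distrib, X0]
  rw [hX, norm_mul]
  have h1 := norm_inv_arcFactor_le hκ (A.start_lt_finish k) (A.finish_lt k) hz
  have h2 := hb z hz
  gcongr
  rcases hk with rfl | rfl
  · exact h1.1
  · exact h1.2

end CanonicalFunction

/-! ### Cauchy integrals of Hölder continuous densities -/

/-- Hölder continuity on the unit circle. -/
def CircleHolder (g : ℂ → ℂ) : Prop :=
  ∃ ε : ℝ, 0 < ε ∧ ε ≤ 1 ∧ ∃ K : ℝ, 0 ≤ K ∧ ∀ t t' : ℂ, ‖t‖ = 1 → ‖t'‖ = 1 →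
    ‖g t - g t'‖ ≤ K * ‖t - t'‖ ^ ε

theorem CircleHolder.continuousOn {g : ℂ → ℂ} (hg : CircleHolder g) :
    ContinuousOn g {t | ‖t‖ = 1} := by
  obtain ⟨ε, hε, -, K, hK, h⟩ := hg
  intro t ht
  rw [ContinuousWithinAt, tendsto_iff_norm_sub_tendsto_zero]
  have hlim : Tendsto (fun z : ℂ => K * ‖z - t‖ ^ ε) (𝓝[{t | ‖t‖ = 1}] t) (𝓝 0) := by
    have hc : Continuous fun z : ℂ => K * ‖z - t‖ ^ ε :=
      continuous_const.mul (Continuous.rpow_const (by fun_prop) fun _ => Or.inr hε.le)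
    have := (hc.tendsto t).mono_left (nhdsWithin_le_nhds (s := {t : ℂ | ‖t‖ = 1}))
    simpa [Real.zero_rpow hε.ne'] using this
  refine squeeze_zero' (Eventually.of_forall fun _ => norm_nonneg _) ?_ hlim
  filter_upwards [self_mem_nhdsWithin] with z hz using h z t hz ht

theorem CircleHolder.continuous_comp {g : ℂ → ℂ} (hg : CircleHolder g) {α : Type*}
    [TopologicalSpace α] {p : α → ℂ} (hp : Continuous p) (h1 : ∀ x, ‖p x‖ = 1) :
    Continuous fun x => g (p x) :=
  hg.continuousOn.comp_continuous hp h1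

theorem CircleHolder.circleIntegrable_div {g : ℂ → ℂ} (hg : CircleHolder g) {ζ : ℂ}
    (hζ : ‖ζ‖ ≠ 1) : CircleIntegrable (fun t => g t / (t - ζ)) 0 1 := by
  refine ContinuousOn.circleIntegrable zero_le_one ?_
  have hs : Metric.sphere (0 : ℂ) 1 = {t | ‖t‖ = 1} := by ext; simp
  rw [hs]
  refine hg.continuousOn.div (by fun_prop) fun t ht h => hζ ?_
  rw [← sub_eq_zero.1 h]
  exact ht

/-- The Cauchy integral of the density `g`, up to the factor `2πi`. -/
def cauchyT (g : ℂ → ℂ) (ζ : ℂ) : ℂ := ∮ t in C(0, 1), g t / (t - ζ)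

/-- The Cauchy integral at `ζ` with the density diminished by its value at the point of the circle
closest to `ζ`, in the angle seen from this point. -/
def cauchyK (g : ℂ → ℂ) (ζ : ℂ) : ℂ :=
  ∫ θ in -Real.pi..Real.pi,
    (g (ζ / ‖ζ‖ * pt θ) - g (ζ / ‖ζ‖)) / (pt θ - ‖ζ‖) * (I * pt θ)

theorem circleIntegral_eq_integral (F : ℂ → ℂ) (s : ℝ) :
    ∮ t in C(0, 1), F t = ∫ φ in s..s + 2 * Real.pi, F (pt φ) * (I * pt φ) := by
  have hp : Function.Periodic (fun φ : ℝ => F (pt φ) * (I * pt φ)) (2 * Real.pi) := by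
    intro φ
    simp only [pt_add_two_pi]
  rw [hp.intervalIntegral_add_eq s 0, zero_add, circleIntegral]
  refine intervalIntegral.integral_congr fun φ _ => ?_
  simp only [deriv_circleMap, circleMap_eq_pt, smul_eq_mul]
  ring

/-- The rotation places the point of the circle nearest to `ζ` at angle zero. The singularity then
stays at `θ = 0` while `ζ` moves, as domination uniform in `ζ` requires. -/
theorem circleIntegral_eq_integral_rotate (F : ℂ → ℂ) {u : ℂ} (hu : ‖u‖ = 1) :
    ∮ t in C(0, 1), F t = ∫ θ in -Real.pi..Real.pi, F (u * pt θ) * (I * (u * pt θ)) := by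
  obtain ⟨ψ, -, rfl⟩ := exists_pt_Ico 0 hu
  rw [circleIntegral_eq_integral F (-Real.pi + ψ)]
  simp only [← pt_add]
  have := intervalIntegral.integral_comp_add_right (a := -Real.pi) (b := Real.pi)
    (fun φ : ℝ => F (pt φ) * (I * pt φ)) ψ
  simp only [add_comm _ ψ] at this
  rw [this]
  congr 1 <;> ring

/-! ### Integrability of weak singularities on the circle -/

theorem norm_pt_sub_one_ge {θ : ℝ} (hθ : |θ| ≤ Real.pi) : 2 / Real.pi * |θ| ≤ ‖pt θ - 1‖ := by
  have h := norm_pt_sub_pt θ 0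
  have h0 : pt 0 = 1 := by simp [pt]
  rw [h0, sub_zero] at h
  rw [h]
  have h1 := Real.mul_abs_le_abs_sin (x := θ / 2) (by rw [abs_div, abs_two]; linarith)
  rw [abs_div, abs_two] at h1
  linarith

theorem intervalIntegrable_abs_rpow {r : ℝ} (hr : -1 < r) {a : ℝ} (ha : 0 ≤ a) :
    IntervalIntegrable (fun θ : ℝ => |θ| ^ r) MeasureTheory.volume (-a) a := by
  have h1 : IntervalIntegrable (fun θ : ℝ => |θ| ^ r) MeasureTheory.volume 0 a := by
    refine (intervalIntegral.intervalIntegrable_rpow' (a := 0) (b := a) hr).congr fun θ hθ => ?_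
    rw [Set.uIoc_of_le ha] at hθ
    simp only [abs_of_pos hθ.1]
  have h2 := ((IntervalIntegrable.iff_comp_neg (by finiteness)).1 h1).symm
  simp only [neg_zero, abs_neg] at h2
  exact h2.trans h1

theorem intervalIntegrable_norm_pt_sub_one_rpow {r : ℝ} (hr : -1 < r) (hr0 : r ≤ 0) :
    IntervalIntegrable (fun θ : ℝ => ‖pt θ - 1‖ ^ r) MeasureTheory.volume
      (-Real.pi) Real.pi := by
  refine ((intervalIntegrable_abs_rpow hr Real.pi_pos.le).const_mul
    ((2 / Real.pi) ^ r)).mono_fun ?_ ?_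
  · have : Measurable fun θ : ℝ => ‖pt θ - 1‖ ^ r := by
      have := continuous_pt.measurable
      fun_prop
    exact this.aestronglyMeasurable
  · rw [EventuallyLE, MeasureTheory.ae_restrict_iff' measurableSet_uIoc]
    refine (MeasureTheory.ae_iff.2 ?_ : ∀ᵐ θ : ℝ, θ ≠ 0).mono fun θ hθ0 hθ => ?_
    · simp
    rw [Set.uIoc_of_le (by linarith [Real.pi_pos])] at hθ
    have h1 := norm_pt_sub_one_ge (abs_le.2 ⟨hθ.1.le, hθ.2⟩)
    rw [← Real.mul_rpow (by positivity) (abs_nonneg _), Real.norm_of_nonneg (by positivity),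
      Real.norm_of_nonneg (by positivity)]
    exact Real.rpow_le_rpow_of_nonpos (by positivity) h1 hr0

theorem intervalIntegrable_norm_pt_sub_rpow {r : ℝ} (hr : -1 < r) (hr0 : r ≤ 0) {c : ℂ}
    (hc : ‖c‖ = 1) (a b : ℝ) :
    IntervalIntegrable (fun θ : ℝ => ‖pt θ - c‖ ^ r) MeasureTheory.volume a b := by
  obtain ⟨ψ, -, rfl⟩ := exists_pt_Ico 0 hc
  have h1 : IntervalIntegrable (fun θ : ℝ => ‖pt θ - pt 0‖ ^ r) MeasureTheory.volume
      (-Real.pi) (-Real.pi + 2 * Real.pi) := by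
    have h0 : pt 0 = 1 := by simp [pt]
    rw [h0, show -Real.pi + 2 * Real.pi = Real.pi by ring]
    exact intervalIntegrable_norm_pt_sub_one_rpow hr hr0
  have hp : Function.Periodic (fun θ : ℝ => ‖pt θ - pt 0‖ ^ r) (2 * Real.pi) := by
    intro φ
    simp only [pt_add_two_pi]
  have h2 := (hp.intervalIntegrable Real.two_pi_pos.ne' h1 (a - ψ) (b - ψ)).comp_sub_right ψ
  simp only [sub_add_cancel] at h2
  refine h2.congr fun θ _ => ?_
  have : pt θ - pt ψ = pt ψ * (pt (θ - ψ) - pt 0) := by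
    rw [mul_sub, ← pt_add, ← pt_add]; congr 2 <;> ring
  simp only [this, norm_mul, norm_pt, one_mul]

/-- The point of the circle closest to `ζ` is at most twice as far from a point of the circle
as `ζ`. -/
theorem norm_sub_direction_le {t ζ : ℂ} (ht : ‖t‖ = 1) (hζ : ζ ≠ 0) :
    ‖t - ζ / ‖ζ‖‖ ≤ 2 * ‖t - ζ‖ := by
  have hn : (‖ζ‖ : ℂ) ≠ 0 := ofReal_ne_zero.2 (norm_ne_zero_iff.2 hζ)
  have h1 : ‖ζ - ζ / ‖ζ‖‖ = |‖ζ‖ - 1| := by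
    have : ζ - ζ / ‖ζ‖ = (ζ / ‖ζ‖) * ((‖ζ‖ - 1 : ℝ) : ℂ) := by
      push_cast
      field_simp
    rw [this, norm_mul, norm_div, norm_real, norm_norm, div_self (norm_ne_zero_iff.2 hζ), one_mul,
      norm_real, Real.norm_eq_abs]
  have h2 : |‖ζ‖ - 1| ≤ ‖t - ζ‖ := by
    rw [← ht, norm_sub_rev]
    exact abs_norm_sub_norm_le ζ t
  have h3 : t - ζ / ‖ζ‖ = (t - ζ) + (ζ - ζ / ‖ζ‖) := by ring
  rw [h3]
  linarith [norm_add_le (t - ζ) (ζ - ζ / ‖ζ‖)]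

theorem norm_direction {ζ : ℂ} (hζ : ζ ≠ 0) : ‖ζ / (‖ζ‖ : ℂ)‖ = 1 := by
  rw [norm_div, norm_real, norm_norm, div_self (norm_ne_zero_iff.2 hζ)]

theorem direction_eq_self {t : ℂ} (ht : ‖t‖ = 1) : t / (‖t‖ : ℂ) = t := by
  rw [ht, ofReal_one, div_one]

theorem continuousAt_direction {ζ : ℂ} (hζ : ζ ≠ 0) : ContinuousAt (fun z : ℂ => z / (‖z‖ : ℂ)) ζ :=
  continuousAt_id.div (by fun_prop) (ofReal_ne_zero.2 (norm_ne_zero_iff.2 hζ))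

theorem pt_ne_one {θ : ℝ} (h0 : θ ≠ 0) (hθ : |θ| ≤ Real.pi) : pt θ ≠ 1 := by
  intro h
  have := norm_pt_sub_one_ge hθ
  rw [h, sub_self, norm_zero] at this
  have h1 : 0 < 2 / Real.pi * |θ| := by positivity
  linarith

/-! ### Boundary behaviour, bounds and holomorphy of the Cauchy integral -/

section CauchyK

variable {g : ℂ → ℂ}

/-- The majorant is independent of `ζ`: the numerator is of order `‖pt θ - 1‖ ^ ε`, and `‖pt θ - 1‖`
is at most twice the modulus of the denominator, wherever `ζ` lies. -/
theorem cauchyK_integrand_le {ε K : ℝ} (hK : 0 ≤ K)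
    (hg : ∀ t t' : ℂ, ‖t‖ = 1 → ‖t'‖ = 1 → ‖g t - g t'‖ ≤ K * ‖t - t'‖ ^ ε)
    {ζ : ℂ} (hζ : ζ ≠ 0) (θ : ℝ) :
    ‖(g (ζ / ‖ζ‖ * pt θ) - g (ζ / ‖ζ‖)) / (pt θ - ‖ζ‖) * (I * pt θ)‖ ≤
      2 * K * ‖pt θ - 1‖ ^ (ε - 1) := by
  have hu := norm_direction hζ
  have h1 : ‖g (ζ / ‖ζ‖ * pt θ) - g (ζ / ‖ζ‖)‖ ≤ K * ‖pt θ - 1‖ ^ ε := by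
    refine (hg _ _ (by rw [norm_mul, hu, norm_pt, one_mul]) hu).trans_eq ?_
    have : ζ / ‖ζ‖ * pt θ - ζ / ‖ζ‖ = ζ / ‖ζ‖ * (pt θ - 1) := by ring
    rw [this, norm_mul, hu, one_mul]
  rw [norm_mul, norm_mul, norm_I, norm_pt, mul_one, mul_one, norm_div]
  have hn : (‖ζ‖ : ℂ) ≠ 0 := ofReal_ne_zero.2 (norm_ne_zero_iff.2 hζ)
  have h2 : ‖pt θ - 1‖ ≤ 2 * ‖pt θ - ‖ζ‖‖ := by
    have := norm_sub_direction_le (norm_pt θ) hn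
    rwa [norm_real, norm_norm, div_self hn] at this
  -- The denominator may vanish here, but so does the numerator.
  by_cases h0 : pt θ = 1
  · have : ‖g (ζ / ‖ζ‖ * pt θ) - g (ζ / ‖ζ‖)‖ = 0 := by simp [h0]
    rw [this, zero_div]
    positivity
  · have hpos : 0 < ‖pt θ - 1‖ := norm_pos_iff.2 (sub_ne_zero.2 h0)
    have hpos' : 0 < ‖pt θ - ‖ζ‖‖ := by linarith
    rw [div_le_iff₀ hpos', Real.rpow_sub_one hpos.ne']
    refine h1.trans ?_
    have h3 : 0 ≤ K * ‖pt θ - 1‖ ^ ε := by positivity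
    have h4 : 1 ≤ 2 * ‖pt θ - ‖ζ‖‖ / ‖pt θ - 1‖ := by rwa [one_le_div hpos]
    calc K * ‖pt θ - 1‖ ^ ε ≤ K * ‖pt θ - 1‖ ^ ε * (2 * ‖pt θ - ‖ζ‖‖ / ‖pt θ - 1‖) :=
          le_mul_of_one_le_right h3 h4
      _ = _ := by ring

theorem intervalIntegrable_cauchyK_bound {ε : ℝ} (hε : 0 < ε) (hε1 : ε ≤ 1) (K : ℝ) :
    IntervalIntegrable (fun θ : ℝ => 2 * K * ‖pt θ - 1‖ ^ (ε - 1)) MeasureTheory.volume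
      (-Real.pi) Real.pi :=
  (intervalIntegrable_norm_pt_sub_one_rpow (by linarith) (by linarith)).const_mul _

theorem CircleHolder.measurable_integrand (hg : CircleHolder g) {ζ : ℂ} (hζ : ζ ≠ 0) :
    Measurable fun θ : ℝ =>
      (g (ζ / ‖ζ‖ * pt θ) - g (ζ / ‖ζ‖)) / (pt θ - ‖ζ‖) * (I * pt θ) := by
  have h1 : Continuous fun θ : ℝ => g (ζ / ‖ζ‖ * pt θ) :=
    hg.continuous_comp (continuous_const.mul continuous_pt) fun θ => by
      rw [norm_mul, norm_direction hζ, norm_pt, one_mul]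
  have h2 := h1.measurable
  have h3 := continuous_pt.measurable
  exact ((h2.sub_const _).div (h3.sub_const _)).mul (h3.const_mul _)

theorem CircleHolder.bounded_cauchyK (hg : CircleHolder g) :
    ∃ B : ℝ, 0 ≤ B ∧ ∀ ζ, ζ ≠ 0 → ‖cauchyK g ζ‖ ≤ B := by
  obtain ⟨ε, hε, hε1, K, hK, h⟩ := hg
  have hpi : -Real.pi ≤ Real.pi := by linarith [Real.pi_pos]
  refine ⟨∫ θ in -Real.pi..Real.pi, 2 * K * ‖pt θ - 1‖ ^ (ε - 1), ?_, fun ζ hζ => ?_⟩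
  · exact intervalIntegral.integral_nonneg hpi fun θ _ => by positivity
  · exact intervalIntegral.norm_integral_le_of_norm_le hpi
      (Eventually.of_forall fun θ _ => cauchyK_integrand_le hK h hζ θ)
      (intervalIntegrable_cauchyK_bound hε hε1 K)

/-- Dominated convergence, valid also at points of the circle: for `θ ≠ 0` the denominator cannot
vanish, since `pt θ = ‖ζ‖` forces `pt θ = 1`. The whole jump of the Cauchy integral thus sits in the
explicit term split off by `cauchyK`. -/
theorem CircleHolder.continuousAt_cauchyK (hg : CircleHolder g) {ζ : ℂ} (hζ : ζ ≠ 0) :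
    ContinuousAt (cauchyK g) ζ := by
  have hg' := hg
  obtain ⟨ε, hε, hε1, K, hK, h⟩ := hg'
  have hev : ∀ᶠ z in 𝓝 ζ, z ≠ (0 : ℂ) := isOpen_ne.mem_nhds hζ
  refine intervalIntegral.continuousAt_of_dominated_interval
    (bound := fun θ : ℝ => 2 * K * ‖pt θ - 1‖ ^ (ε - 1)) ?_ ?_
    (intervalIntegrable_cauchyK_bound hε hε1 K) ?_
  · filter_upwards [hev] with z hz using (hg.measurable_integrand hz).aestronglyMeasurable
  · filter_upwards [hev] with z hz using
      Eventually.of_forall fun θ _ => cauchyK_integrand_le hK h hz θ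
  · refine (MeasureTheory.ae_iff.2 ?_ : ∀ᵐ θ : ℝ, θ ≠ 0).mono fun θ hθ0 hθ => ?_
    · simp
    rw [Set.uIoc_of_le (by linarith [Real.pi_pos])] at hθ
    have hp1 := pt_ne_one hθ0 (abs_le.2 ⟨hθ.1.le, hθ.2⟩)
    have hcomp : ∀ p : ℂ → ℂ, ContinuousAt p ζ → (∀ z, z ≠ 0 → ‖p z‖ = 1) →
        ContinuousAt (fun z => g (p z)) ζ := by
      intro p hp hp1
      refine Tendsto.comp (hg.continuousOn (p ζ) (hp1 ζ hζ)) (tendsto_nhdsWithin_iff.2 ⟨hp, ?_⟩)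
      filter_upwards [hev] with z hz using hp1 z hz
    have c1 := hcomp _ (continuousAt_direction hζ) fun z hz => norm_direction hz
    have c2 := hcomp (fun z => z / ‖z‖ * pt θ)
      ((continuousAt_direction hζ).mul (continuousAt_const (y := pt θ))) fun z hz => by rw [norm_mul, norm_direction hz, norm_pt, one_mul]
    refine ((c2.sub c1).div (by fun_prop) ?_).mul continuousAt_const
    intro hc
    have hc' := sub_eq_zero.1 hc
    have : ‖ζ‖ = 1 := by
      have := congrArg norm hc'
      rwa [norm_pt, norm_real, norm_norm, eq_comm] at this
    rw [this, ofReal_one] at hc'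
    exact hp1 hc'

theorem cauchyK_eq_circleIntegral {ζ : ℂ} (hζ : ζ ≠ 0) :
    cauchyK g ζ = ∮ t in C(0, 1), (g t - g (ζ / ‖ζ‖)) / (t - ζ) := by
  rw [circleIntegral_eq_integral_rotate _ (norm_direction hζ), cauchyK]
  refine intervalIntegral.integral_congr fun θ _ => ?_
  have hu : ζ / (‖ζ‖ : ℂ) ≠ 0 := fun h => by
    have := norm_direction hζ
    rw [h, norm_zero] at this
    exact zero_ne_one this
  have hn : (‖ζ‖ : ℂ) ≠ 0 := ofReal_ne_zero.2 (norm_ne_zero_iff.2 hζ)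
  have h1 : ζ / (‖ζ‖ : ℂ) * pt θ - ζ = ζ / ‖ζ‖ * (pt θ - ‖ζ‖) := by
    field_simp
  simp only [h1]
  generalize ζ / (‖ζ‖ : ℂ) = u at hu
  by_cases hd : pt θ - (‖ζ‖ : ℂ) = 0
  · simp [hd]
  · field_simp

/-- Where the density vanishes nothing is subtracted, so the plain integral on the circle agrees
with the boundary values. This gives `Ω₀` its meaning on a traction-free arc. -/
theorem cauchyT_eq_cauchyK_of_eq_zero {t : ℂ} (ht : ‖t‖ = 1) (h0 : g t = 0) :
    cauchyT g t = cauchyK g t := by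
  have : t ≠ 0 := norm_ne_zero_iff.1 (by rw [ht]; exact one_ne_zero)
  rw [cauchyK_eq_circleIntegral this, direction_eq_self ht, h0]
  simp only [sub_zero, cauchyT]

theorem CircleHolder.cauchyT_sub (hg : CircleHolder g) {ζ : ℂ} (hζ : ζ ≠ 0) (h1 : ‖ζ‖ ≠ 1) :
    cauchyT g ζ = cauchyK g ζ + g (ζ / ‖ζ‖) * ∮ t in C(0, 1), (t - ζ)⁻¹ := by
  have hc : CircleIntegrable (fun t => g (ζ / ‖ζ‖) * (t - ζ)⁻¹) 0 1 := by
    refine ContinuousOn.circleIntegrable zero_le_one ?_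
    refine continuousOn_const.mul (ContinuousOn.inv₀ (by fun_prop) fun t ht h => h1 ?_)
    rw [← sub_eq_zero.1 h]
    simpa using ht
  rw [cauchyK_eq_circleIntegral hζ, ← circleIntegral.integral_const_mul, cauchyT]
  simp only [sub_div]
  simp only [div_eq_mul_inv (g (ζ * (‖ζ‖ : ℂ)⁻¹)), div_eq_mul_inv ζ] at hc ⊢
  rw [circleIntegral.integral_sub (hg.circleIntegrable_div h1) hc, sub_add_cancel]

theorem CircleHolder.cauchyT_of_lt (hg : CircleHolder g) {ζ : ℂ} (hζ : ζ ≠ 0) (h1 : ‖ζ‖ < 1) :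
    cauchyT g ζ = cauchyK g ζ + 2 * Real.pi * I * g (ζ / ‖ζ‖) := by
  rw [hg.cauchyT_sub hζ h1.ne, circleIntegral.integral_sub_inv_of_mem_ball (by simpa using h1)]
  ring

theorem CircleHolder.cauchyT_of_gt (hg : CircleHolder g) {ζ : ℂ} (h1 : 1 < ‖ζ‖) :
    cauchyT g ζ = cauchyK g ζ := by
  have hζ : ζ ≠ 0 := fun h => by rw [h, norm_zero] at h1; linarith
  have hne : ∀ t ∈ Metric.closedBall (0 : ℂ) 1, t - ζ ≠ 0 := by
    intro t ht h
    rw [sub_eq_zero.1 h] at ht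
    simp at ht
    linarith
  have : ∮ t in C(0, 1), (t - ζ)⁻¹ = 0 := by
    refine circleIntegral_eq_zero_of_differentiable_on_off_countable zero_le_one
      Set.countable_empty (ContinuousOn.inv₀ (by fun_prop) hne) fun z hz => ?_
    exact DifferentiableAt.inv (by fun_prop) (hne z (Metric.ball_subset_closedBall hz.1))
  rw [hg.cauchyT_sub hζ h1.ne', this, mul_zero, add_zero]

/-- The Sokhotski–Plemelj formulas. -/
theorem CircleHolder.tendsto_cauchyT_disk (hg : CircleHolder g) {t : ℂ} (ht : ‖t‖ = 1) :
    Tendsto (cauchyT g) (𝓝[disk] t) (𝓝 (cauchyK g t + 2 * Real.pi * I * g t)) := by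
  have h0 : t ≠ 0 := norm_ne_zero_iff.1 (by rw [ht]; exact one_ne_zero)
  have h1 := (hg.continuousAt_cauchyK h0).tendsto.mono_left (nhdsWithin_le_nhds (s := disk))
  have h2 : Tendsto (fun z : ℂ => g (z / ‖z‖)) (𝓝[disk] t) (𝓝 (g t)) := by
    have h3 : Tendsto (fun z : ℂ => z / (‖z‖ : ℂ)) (𝓝[disk] t) (𝓝[{t | ‖t‖ = 1}] t) := by
      refine tendsto_nhdsWithin_iff.2 ⟨?_, ?_⟩
      · have := (continuousAt_direction h0).tendsto.mono_left (nhdsWithin_le_nhds (s := disk))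
        rwa [direction_eq_self ht] at this
      · filter_upwards [nhdsWithin_le_nhds (isOpen_ne.mem_nhds h0)] with z hz
        exact norm_direction hz
    exact (hg.continuousOn t ht).tendsto.comp h3
  refine (h1.add (h2.const_mul (2 * Real.pi * I))).congr' ?_
  filter_upwards [self_mem_nhdsWithin, nhdsWithin_le_nhds (isOpen_ne.mem_nhds h0)] with z hz hz0
  exact (hg.cauchyT_of_lt hz0 hz).symm

theorem CircleHolder.tendsto_cauchyT_exterior (hg : CircleHolder g) {t : ℂ} (ht : ‖t‖ = 1) :
    Tendsto (cauchyT g) (𝓝[exterior] t) (𝓝 (cauchyK g t)) := by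
  have h0 : t ≠ 0 := norm_ne_zero_iff.1 (by rw [ht]; exact one_ne_zero)
  refine ((hg.continuousAt_cauchyK h0).tendsto.mono_left
    (nhdsWithin_le_nhds (s := exterior))).congr' ?_
  filter_upwards [self_mem_nhdsWithin] with z hz using (hg.cauchyT_of_gt hz).symm

theorem CircleHolder.exists_norm_le (hg : CircleHolder g) :
    ∃ M : ℝ, 0 ≤ M ∧ ∀ t, ‖t‖ = 1 → ‖g t‖ ≤ M := by
  have hs : {t : ℂ | ‖t‖ = 1} = Metric.sphere (0 : ℂ) 1 := by ext; simp
  have hc := hg.continuousOn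
  rw [hs] at hc
  obtain ⟨M, hM⟩ := (isCompact_sphere (0 : ℂ) 1).exists_bound_of_continuousOn hc
  exact ⟨M, (norm_nonneg _).trans (hM 1 (by simp)), fun t ht => hM t (by simpa using ht)⟩

theorem CircleHolder.bounded_cauchyT (hg : CircleHolder g) :
    ∃ B : ℝ, 0 ≤ B ∧ ∀ ζ, ζ ≠ 0 → ‖ζ‖ ≠ 1 → ‖cauchyT g ζ‖ ≤ B := by
  obtain ⟨B, hB, h⟩ := hg.bounded_cauchyK
  obtain ⟨M, hM, h'⟩ := hg.exists_norm_le
  refine ⟨B + 2 * Real.pi * M, by positivity, fun ζ h0 h1 => ?_⟩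
  have hpi := Real.pi_pos
  rcases lt_or_gt_of_ne h1 with h1 | h1
  · rw [hg.cauchyT_of_lt h0 h1]
    refine (norm_add_le _ _).trans (add_le_add (h ζ h0) ?_)
    have := h' _ (norm_direction h0)
    simp only [norm_mul, norm_real, norm_I, Real.norm_of_nonneg hpi.le, norm_ofNat, mul_one]
    gcongr
  · rw [hg.cauchyT_of_gt h1]
    have : 0 ≤ 2 * Real.pi * M := by positivity
    linarith [h ζ h0]

theorem CircleHolder.tendsto_cauchyT_cobounded (hg : CircleHolder g) :
    Tendsto (cauchyT g) (cobounded ℂ) (𝓝 0) := by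
  obtain ⟨M, hM, h'⟩ := hg.exists_norm_le
  have hlim : Tendsto (fun ζ : ℂ => 2 * Real.pi * 1 * (M / (‖ζ‖ - 1))) (cobounded ℂ) (𝓝 0) := by
    have h1 : Tendsto (fun ζ : ℂ => ‖ζ‖ - 1) (cobounded ℂ) atTop :=
      tendsto_atTop_add_const_right _ _ tendsto_norm_cobounded_atTop
    have := (tendsto_const_nhds (x := M)).div_atTop h1
    simpa using this.const_mul (2 * Real.pi * 1)
  refine squeeze_zero_norm' ?_ hlim
  filter_upwards [tendsto_norm_cobounded_atTop.eventually_gt_atTop 1] with ζ hζ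
  refine circleIntegral.norm_integral_le_of_norm_le_const zero_le_one fun t ht => ?_
  have ht1 : ‖t‖ = 1 := by simpa using ht
  rw [norm_div]
  have : ‖ζ‖ - 1 ≤ ‖t - ζ‖ := by
    rw [norm_sub_rev, ← ht1]
    exact norm_sub_norm_le ζ t
  have h0 : 0 < ‖ζ‖ - 1 := by linarith
  have := h' t ht1
  gcongr

theorem CircleHolder.differentiableAt_cauchyT (hg : CircleHolder g) {ζ : ℂ} (hζ : ‖ζ‖ ≠ 1) :
    DifferentiableAt ℂ (cauchyT g) ζ := by
  obtain ⟨M, hM, h'⟩ := hg.exists_norm_le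
  have hd0 : 0 < |‖ζ‖ - 1| := abs_pos.2 (sub_ne_zero.2 hζ)
  set d := |‖ζ‖ - 1| with hd
  have hdist : ∀ z ∈ Metric.ball ζ (d / 2), ∀ φ : ℝ, d / 2 ≤ ‖pt φ - z‖ := by
    intro z hz φ
    rw [mem_ball_iff_norm] at hz
    have h1 : d ≤ ‖ζ - pt φ‖ := by
      have := abs_norm_sub_norm_le ζ (pt φ)
      rwa [norm_pt] at this
    have h2 : ζ - pt φ = -(z - ζ) - (pt φ - z) := by ring
    have h3 := norm_sub_le (-(z - ζ)) (pt φ - z)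
    rw [← h2, norm_neg] at h3
    linarith
  have hgc : Continuous fun φ : ℝ => g (pt φ) := hg.continuous_comp continuous_pt norm_pt
  have hcont : ∀ z ∈ Metric.ball ζ (d / 2), ∀ k : ℕ, Continuous fun φ : ℝ =>
      g (pt φ) / (pt φ - z) ^ k * (I * pt φ) := by
    intro z hz k
    have := continuous_pt
    refine (hgc.div (by fun_prop) fun φ => pow_ne_zero _ ?_).mul (by fun_prop)
    exact norm_pos_iff.1 (by linarith [hdist z hz φ])
  have key := intervalIntegral.hasDerivAt_integral_of_dominated_loc_of_deriv_le
    (𝕜 := ℂ) (μ := MeasureTheory.volume) (a := 0) (b := 0 + 2 * Real.pi) (x₀ := ζ)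
    (s := Metric.ball ζ (d / 2))
    (F := fun z φ => g (pt φ) / (pt φ - z) * (I * pt φ))
    (F' := fun z φ => g (pt φ) / (pt φ - z) ^ 2 * (I * pt φ))
    (bound := fun _ => M / (d / 2) ^ 2) (Metric.ball_mem_nhds _ (by positivity)) ?_ ?_ ?_ ?_ ?_ ?_
  · have hT : cauchyT g = fun z => ∫ φ in (0 : ℝ)..0 + 2 * Real.pi,
        g (pt φ) / (pt φ - z) * (I * pt φ) := by
      ext z
      exact circleIntegral_eq_integral _ 0
    rw [hT]
    exact key.2.differentiableAt
  · filter_upwards [Metric.ball_mem_nhds ζ (half_pos hd0)] with z hz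
    have := hcont z hz 1
    simp only [pow_one] at this
    exact this.aestronglyMeasurable
  · have := hcont ζ (Metric.mem_ball_self (half_pos hd0)) 1
    simp only [pow_one] at this
    exact this.intervalIntegrable _ _
  · exact (hcont ζ (Metric.mem_ball_self (half_pos hd0)) 2).aestronglyMeasurable
  · refine Eventually.of_forall fun φ _ z hz => ?_
    rw [norm_mul, norm_mul, norm_I, norm_pt, mul_one, mul_one, norm_div, norm_pow]
    have := h' _ (norm_pt φ)
    have := hdist z hz φ
    gcongr
  · exact intervalIntegrable_const
  · refine Eventually.of_forall fun φ _ z hz => ?_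
    have hne : pt φ - z ≠ 0 := norm_pos_iff.1 (by linarith [hdist z hz φ])
    have h1 := (((hasDerivAt_id z).const_sub (pt φ)).inv hne).const_mul (g (pt φ))
    refine (h1.mul_const (I * pt φ)).congr_deriv ?_
    simp only [id]
    ring

end CauchyK

/-! ### The density `f / X₀⁺` -/

section Density

variable {n : ℕ} {A : ArcSystem n} {κ : ℝ} {f : ℂ → ℂ}

theorem ArcSystem.exists_punctured_notMem_ends (A : ArcSystem n) (φ₀ : ℝ) :
    ∃ η > 0, ∀ φ, φ ≠ φ₀ → |φ - φ₀| < η → pt φ ∉ A.ends := by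
  have hcl : IsClosed (A.ends \ {pt φ₀}) := (A.finite_ends.subset Set.sdiff_subset).isClosed
  have hev : ∀ᶠ φ in 𝓝 φ₀, pt φ ∉ A.ends \ {pt φ₀} :=
    continuous_pt.continuousAt.eventually (hcl.isOpen_compl.mem_nhds (by simp))
  obtain ⟨η, hη, h⟩ := Metric.eventually_nhds_iff.1 hev
  -- The cap `π` makes `pt` injective on the neighbourhood, so that `φ ≠ φ₀` also separates the
  -- points of the circle.
  refine ⟨min η Real.pi, lt_min hη Real.pi_pos, fun φ hne hφ hmem => ?_⟩
  refine h (y := φ) (by rw [Real.dist_eq]; exact hφ.trans_le (min_le_left _ _)) ⟨hmem, ?_⟩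
  intro heq
  have hpi := hφ.trans_le (min_le_right _ _)
  rw [abs_lt] at hpi
  exact hne (eq_of_pt_eq_pt heq (by linarith [Real.pi_pos]) (by linarith [Real.pi_pos]))

/-- The Hölder condition compares only points of one arc and says nothing of the values at the end
points. Compactness reduces the bound to a neighbourhood of each angle, which splits into two
one-sided pieces and the centre. -/
theorem HolderOnArcs.exists_norm_le (hf : HolderOnArcs A f) :
    ∃ M : ℝ, 0 ≤ M ∧ ∀ t, ‖t‖ = 1 → ‖f t‖ ≤ M := by
  obtain ⟨ε, hε, K, h⟩ := hf
  have key : ∃ M : ℝ, ∀ φ ∈ Set.Icc (0 : ℝ) (0 + 2 * Real.pi), ‖f (pt φ)‖ ≤ M := by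
    refine isCompact_Icc.induction_on (p := fun s => ∃ M : ℝ, ∀ φ ∈ s, ‖f (pt φ)‖ ≤ M)
      ⟨0, by simp⟩ (fun s t hst ⟨M, hM⟩ => ⟨M, fun φ hφ => hM φ (hst hφ)⟩)
      (fun s t ⟨M, hM⟩ ⟨L, hL⟩ => ⟨max M L, fun φ hφ => hφ.elim
        (fun h => (hM φ h).trans (le_max_left _ _)) fun h => (hL φ h).trans (le_max_right _ _)⟩) ?_
    intro φ₀ _
    obtain ⟨η, hη, hne⟩ := A.exists_punctured_notMem_ends φ₀
    have hpair : ∀ φ ψ, φ ≤ ψ → (∀ r ∈ Set.Icc φ ψ, r ≠ φ₀ ∧ |r - φ₀| < η) →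
        ‖f (pt ψ) - f (pt φ)‖ ≤ |K| * η ^ ε := by
      intro φ ψ hle hr
      refine (h φ ψ hle fun r hr' => hne r (hr r hr').1 (hr r hr').2).trans ?_
      -- Two angles more than `η` apart would have `φ₀` between them.
      have h1 : ψ - φ ≤ η := by
        by_contra! hlt
        have h2 := (hr φ ⟨le_rfl, hle⟩).2
        have h3 := (hr ψ ⟨hle, le_rfl⟩).2
        have h4 : φ < φ₀ ∧ φ₀ < ψ := by
          rw [abs_lt] at h2 h3
          constructor <;> linarith
        exact (hr φ₀ ⟨h4.1.le, h4.2.le⟩).1 rfl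
      have h2 : (ψ - φ) ^ ε ≤ η ^ ε := Real.rpow_le_rpow (by linarith) h1 hε.le
      have h3 : 0 ≤ (ψ - φ) ^ ε := Real.rpow_nonneg (by linarith) _
      calc K * (ψ - φ) ^ ε ≤ |K| * (ψ - φ) ^ ε := by gcongr; exact le_abs_self K
        _ ≤ |K| * η ^ ε := by gcongr
    have hC : 0 ≤ |K| * η ^ ε := by positivity
    have hside : ∀ φ ψ, (∀ r ∈ Set.uIcc φ ψ, r ≠ φ₀ ∧ |r - φ₀| < η) →
        ‖f (pt φ)‖ ≤ ‖f (pt ψ)‖ + |K| * η ^ ε := by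
      intro φ ψ hr
      rcases le_total φ ψ with hle | hle
      · rw [Set.uIcc_of_le hle] at hr
        have := norm_sub_norm_le (f (pt φ)) (f (pt ψ))
        have h2 := hpair φ ψ hle hr
        rw [norm_sub_rev] at h2
        linarith
      · rw [Set.uIcc_of_ge hle] at hr
        have := norm_sub_norm_le (f (pt φ)) (f (pt ψ))
        have h2 := hpair ψ φ hle hr
        linarith
    -- The bound adds the value at the centre and one reference value on either side, each enlarged
    -- by the oscillation on that side.
    refine ⟨Metric.ball φ₀ η, mem_nhdsWithin_of_mem_nhds (Metric.ball_mem_nhds _ hη),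
      ‖f (pt φ₀)‖ + (‖f (pt (φ₀ + η / 2))‖ + |K| * η ^ ε) +
        (‖f (pt (φ₀ - η / 2))‖ + |K| * η ^ ε), fun φ hφ => ?_⟩
    rw [Metric.mem_ball, Real.dist_eq, abs_lt] at hφ
    have e1 := norm_nonneg (f (pt φ₀))
    have e2 := norm_nonneg (f (pt (φ₀ + η / 2)))
    have e3 := norm_nonneg (f (pt (φ₀ - η / 2)))
    rcases lt_trichotomy φ φ₀ with hlt | rfl | hlt
    · have := hside φ (φ₀ - η / 2) fun r hr => by
        rcases Set.mem_uIcc.1 hr with hr | hr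
        · exact ⟨by linarith [hr.2], abs_lt.2 ⟨by linarith [hr.1], by linarith [hr.2]⟩⟩
        · exact ⟨by linarith [hr.2], abs_lt.2 ⟨by linarith [hr.1], by linarith [hr.2]⟩⟩
      linarith
    · linarith
    · have := hside φ (φ₀ + η / 2) fun r hr => by
        rcases Set.mem_uIcc.1 hr with hr | hr
        · exact ⟨by linarith [hr.1], abs_lt.2 ⟨by linarith [hr.1], by linarith [hr.2]⟩⟩
        · exact ⟨by linarith [hr.1], abs_lt.2 ⟨by linarith [hr.1], by linarith [hr.2]⟩⟩
      linarith
  obtain ⟨M, hM⟩ := key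
  refine ⟨|M|, abs_nonneg M, fun t ht => ?_⟩
  obtain ⟨φ, hφ, rfl⟩ := exists_pt_Ico 0 ht
  exact (hM φ ⟨hφ.1, hφ.2.le⟩).trans (le_abs_self M)

theorem abs_sin_half_le {x y : ℝ} (hxy : |x| ≤ |y|) (hy : |y| ≤ Real.pi) :
    |Real.sin (x / 2)| ≤ |Real.sin (y / 2)| := by
  have habs : ∀ z : ℝ, |z| ≤ Real.pi → |Real.sin (z / 2)| = Real.sin (|z| / 2) := by
    intro z hz
    rcases abs_cases z with ⟨h, h0⟩ | ⟨h, h0⟩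
    · rw [h] at hz ⊢
      exact abs_of_nonneg (Real.sin_nonneg_of_nonneg_of_le_pi (by linarith) (by linarith))
    · rw [h] at hz ⊢
      rw [neg_div, Real.sin_neg]
      refine abs_of_nonpos (Real.sin_nonpos_of_nonpos_of_neg_pi_le (by linarith) (by linarith))
  rw [habs x (hxy.trans hy), habs y hy]
  refine Real.sin_le_sin_of_le_of_le_pi_div_two ?_ (by linarith) (by linarith)
  linarith [abs_nonneg x, Real.pi_pos]

/-- The chord grows with the angle up to `π`, so if `t'` is nearer to `t` than every end point, the
shorter arc between them contains no end point. The constant `π / 2` compares this angle with the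
chord. -/
theorem HolderOnArcs.exists_local (hf : HolderOnArcs A f) :
    ∃ ε > (0 : ℝ), ∃ K : ℝ, 0 ≤ K ∧ ∀ t t' : ℂ, ‖t‖ = 1 → ‖t'‖ = 1 →
      (∀ c ∈ A.ends, ‖t - t'‖ < ‖t - c‖) → ‖f t - f t'‖ ≤ K * ‖t - t'‖ ^ ε := by
  obtain ⟨ε, hε, K, h⟩ := hf
  refine ⟨ε, hε, |K| * (Real.pi / 2) ^ ε, by positivity, fun t t' ht ht' hE => ?_⟩
  obtain ⟨φ, -, rfl⟩ := exists_pt_Ico 0 ht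
  obtain ⟨ψ, hψ, rfl⟩ := exists_pt_Ico (φ - Real.pi) ht'
  have habs : |ψ - φ| ≤ Real.pi := abs_le.2 ⟨by linarith [hψ.1], by linarith [hψ.2]⟩
  have hE' : ∀ r, |r - φ| ≤ |ψ - φ| → pt r ∉ A.ends := by
    intro r hr hmem
    have h1 := hE _ hmem
    rw [norm_sub_rev (pt φ), norm_sub_rev (pt φ), norm_pt_sub_pt, norm_pt_sub_pt] at h1
    linarith [abs_sin_half_le hr habs]
  have hd : |ψ - φ| ≤ Real.pi / 2 * ‖pt φ - pt ψ‖ := by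
    rw [norm_sub_rev, norm_pt_sub_pt]
    have h1 := Real.mul_abs_le_abs_sin (x := (ψ - φ) / 2) (by rw [abs_div, abs_two]; linarith)
    rw [abs_div, abs_two] at h1
    have hpi := Real.pi_pos
    have h2 := mul_le_mul_of_nonneg_left h1 hpi.le
    have h3 : Real.pi * (2 / Real.pi * (|ψ - φ| / 2)) = |ψ - φ| := by field_simp
    linarith
  have hfin : ‖f (pt φ) - f (pt ψ)‖ ≤ |K| * |ψ - φ| ^ ε := by
    have hK : K * |ψ - φ| ^ ε ≤ |K| * |ψ - φ| ^ ε := by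
      gcongr
      exact le_abs_self K
    refine le_trans ?_ hK
    rcases le_total φ ψ with hle | hle
    · rw [norm_sub_rev, abs_of_nonneg (by linarith : 0 ≤ ψ - φ)]
      refine h φ ψ hle fun r hr => hE' r ?_
      rw [abs_of_nonneg (by linarith [hr.1]), abs_of_nonneg (by linarith)]
      linarith [hr.2]
    · rw [abs_of_nonpos (by linarith : ψ - φ ≤ 0), neg_sub]
      refine h ψ φ hle fun r hr => hE' r ?_
      rw [abs_of_nonpos (by linarith [hr.2]), abs_of_nonpos (by linarith)]
      linarith [hr.1]
  refine hfin.trans ?_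
  rw [mul_assoc, ← Real.mul_rpow (by positivity) (norm_nonneg _)]
  gcongr

theorem rpow_le_mul_rpow_of_le_two {d ε δ : ℝ} (hd : 0 ≤ d) (hd2 : d ≤ 2) (hδ : 0 < δ)
    (h : δ ≤ ε) : d ^ ε ≤ 2 ^ ε * d ^ δ := by
  rcases hd.eq_or_lt with rfl | hd
  · rw [Real.zero_rpow (by linarith), Real.zero_rpow hδ.ne', mul_zero]
  · have h1 : d ^ ε = d ^ (ε - δ) * d ^ δ := by
      rw [← Real.rpow_add hd]
      congr 1
      ring
    rw [h1]
    gcongr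
    calc d ^ (ε - δ) ≤ 2 ^ (ε - δ) := Real.rpow_le_rpow hd.le hd2 (by linarith)
      _ ≤ 2 ^ ε := Real.rpow_le_rpow_of_exponent_le (by norm_num) (by linarith)

/-- The density `f / X₀⁺`, continued by zero to the end points. -/
def density {n : ℕ} (A : ArcSystem n) (κ : ℝ) (f : ℂ → ℂ) (t : ℂ) : ℂ := f t * recipX0 A κ t

/-- If no end point lies within `‖t - t'‖` of `t`, the two Hölder estimates combine as for a
product. Otherwise both points are within `4 * ‖t - t'‖` of an end point; there `recipX0` vanishes,
so both values are of order `‖t - t'‖ ^ (1/2)` and a jump of `f` is irrelevant. -/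
theorem circleHolder_density (hκ : 1 < κ) (hf : HolderOnArcs A f) :
    CircleHolder (density A κ f) := by
  obtain ⟨M, hM, hfM⟩ := hf.exists_norm_le
  obtain ⟨ε, hε, K, hK, hfK⟩ := hf.exists_local
  obtain ⟨L, hL, hZL, hZ⟩ := (halfHolder_inv_X0 A hκ).innerValue
  change ∀ t, ‖t‖ = 1 → ‖recipX0 A κ t‖ ≤ L at hZL
  change ∀ t t', ‖t‖ = 1 → ‖t'‖ = 1 → ‖recipX0 A κ t - recipX0 A κ t'‖ ≤ _ at hZ
  have hδ : 0 < min ε (1 / 2) := lt_min hε (by norm_num)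
  set δ := min ε (1 / 2) with hδdef
  refine ⟨δ, hδ, (min_le_right _ _).trans (by norm_num),
    K * 2 ^ ε * L + 4 * (M * L) * 2 ^ (1 / 2 : ℝ), by positivity, fun t t' ht ht' => ?_⟩
  have hd2 : ‖t - t'‖ ≤ 2 := by
    have := norm_sub_le t t'
    linarith
  have hp1 := rpow_le_mul_rpow_of_le_two (norm_nonneg (t - t')) hd2 hδ (min_le_left ε (1 / 2))
  have hp2 := rpow_le_mul_rpow_of_le_two (norm_nonneg (t - t')) hd2 hδ (min_le_right ε (1 / 2))
  have hq : 0 ≤ ‖t - t'‖ ^ δ := by positivity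
  by_cases hE : ∀ c ∈ A.ends, ‖t - t'‖ < ‖t - c‖
  · have h : density A κ f t - density A κ f t' =
        (f t - f t') * recipX0 A κ t + f t' * (recipX0 A κ t - recipX0 A κ t') := by
      simp only [density]
      ring
    rw [h]
    refine (norm_add_le _ _).trans ?_
    rw [norm_mul, norm_mul]
    have h1 : ‖f t - f t'‖ * ‖recipX0 A κ t‖ ≤ K * (2 ^ ε * ‖t - t'‖ ^ δ) * L := by
      have := hfK t t' ht ht' hE
      have := hZL t ht
      have : K * ‖t - t'‖ ^ ε ≤ K * (2 ^ ε * ‖t - t'‖ ^ δ) := by gcongr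
      have : ‖f t - f t'‖ ≤ K * (2 ^ ε * ‖t - t'‖ ^ δ) := by linarith
      gcongr
    have h2 : ‖f t'‖ * ‖recipX0 A κ t - recipX0 A κ t'‖ ≤
        M * (L * (2 ^ (1 / 2 : ℝ) * ‖t - t'‖ ^ δ)) := by
      have := hfM t' ht'
      have h3 := hZ t t' ht ht'
      have : L * ‖t - t'‖ ^ (1 / 2 : ℝ) ≤ L * (2 ^ (1 / 2 : ℝ) * ‖t - t'‖ ^ δ) := by gcongr
      have := h3.trans this
      gcongr
    have h3 : 0 ≤ M * (L * (2 ^ (1 / 2 : ℝ) * ‖t - t'‖ ^ δ)) := by positivity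
    nlinarith
  · push Not at hE
    obtain ⟨c, hc, hct⟩ := hE
    have hc1 := A.norm_of_mem_ends hc
    have hct' : ‖t' - c‖ ≤ 4 * ‖t - t'‖ := by
      have : t' - c = (t - c) - (t - t') := by ring
      rw [this]
      linarith [norm_sub_le (t - c) (t - t'), norm_nonneg (t - t')]
    have h0 := recipX0_of_mem_ends A hκ hc
    have e4 : (4 * ‖t - t'‖) ^ (1 / 2 : ℝ) = 2 * ‖t - t'‖ ^ (1 / 2 : ℝ) := by
      rw [Real.mul_rpow (by norm_num) (norm_nonneg _), show (4 : ℝ) = 2 ^ (2 : ℝ) by norm_num,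
        ← Real.rpow_mul (by norm_num)]
      norm_num
    have b : ∀ s, ‖s‖ = 1 → ‖s - c‖ ≤ 4 * ‖t - t'‖ →
        ‖density A κ f s‖ ≤ M * (L * (2 * (2 ^ (1 / 2 : ℝ) * ‖t - t'‖ ^ δ))) := by
      intro s hs hsc
      rw [density, norm_mul]
      have h1 := hZ s c hs hc1
      rw [h0, sub_zero] at h1
      have h2 : ‖s - c‖ ^ (1 / 2 : ℝ) ≤ 2 * ‖t - t'‖ ^ (1 / 2 : ℝ) :=
        (Real.rpow_le_rpow (norm_nonneg _) hsc (by norm_num)).trans_eq e4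
      have h3 : ‖recipX0 A κ s‖ ≤ L * (2 * (2 ^ (1 / 2 : ℝ) * ‖t - t'‖ ^ δ)) := by
        refine h1.trans ?_
        gcongr
        linarith
      have := hfM s hs
      gcongr
    have h1 := b t ht (by linarith [norm_nonneg (t - t')])
    have h2 := b t' ht' hct'
    refine (norm_sub_le _ _).trans ((add_le_add h1 h2).trans ?_)
    have : 0 ≤ K * 2 ^ ε * L * ‖t - t'‖ ^ δ := by positivity
    nlinarith

theorem ae_pt_notMem_ends (A : ArcSystem n) : ∀ᵐ φ : ℝ, pt φ ∉ A.ends := by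
  have h := (A.finite_ends.countable.preimage_circleMap 0 one_ne_zero).ae_notMem
    MeasureTheory.volume
  filter_upwards [h] with φ hφ
  rwa [Set.mem_preimage, circleMap_eq_pt] at hφ

theorem div_innerValue_eq (hκ : 1 < κ) {t : ℂ} (ht : ‖t‖ = 1) (hE : t ∉ A.ends) (w : ℂ) :
    f t / (innerValue (X0 A κ) t * w) = density A κ f t / w := by
  rw [density, recipX0_eq A hκ (A.mem_gammaU_union_gammaS_iff.2 ⟨ht, hE⟩), div_mul_eq_div_div,
    div_eq_mul_inv (f t)]

/-- The two integrands may differ only at the end points, a null set. -/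
theorem circleIntegral_div_innerValue (hκ : 1 < κ) (h : ℂ → ℂ) :
    ∮ t in C(0, 1), f t / (innerValue (X0 A κ) t * h t) =
      ∮ t in C(0, 1), density A κ f t / h t := by
  rw [circleIntegral_eq_integral _ 0, circleIntegral_eq_integral _ 0]
  refine intervalIntegral.integral_congr_ae ?_
  filter_upwards [ae_pt_notMem_ends A] with φ hφ _
  rw [div_innerValue_eq hκ (norm_pt φ) hφ]

theorem Omega0_eq (hκ : 1 < κ) (ζ : ℂ) :
    Omega0 A κ f ζ = X0 A κ ζ * ((2 * Real.pi * I)⁻¹ * cauchyT (density A κ f) ζ) := by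
  rw [Omega0, circleIntegral_div_innerValue hκ fun t => t - ζ, cauchyT]
  ring

theorem circleIntegrable_div_innerValue (hκ : 1 < κ) (hf : HolderOnArcs A f) {ζ : ℂ}
    (hζ : ‖ζ‖ ≠ 1) :
    CircleIntegrable (fun t => f t / (innerValue (X0 A κ) t * (t - ζ))) 0 1 := by
  have h := (circleHolder_density hκ hf).circleIntegrable_div hζ
  refine IntervalIntegrable.congr_ae h (MeasureTheory.ae_restrict_of_ae ?_)
  filter_upwards [ae_pt_notMem_ends A] with φ hφ
  rw [circleMap_eq_pt]
  exact (div_innerValue_eq hκ (norm_pt φ) hφ _).symm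

/-- Boundary values of `X₀ (G + R)`, where `G` is the Cauchy integral with the density `f / X₀⁺`. -/
theorem boundaryConditions_Omega0_add (hκ : 1 < κ) (hf : HolderOnArcs A f) {R Ω : ℂ → ℂ}
    (hR : ∀ t, ‖t‖ = 1 → ContinuousAt R t)
    (hΩ : ∀ ζ, ‖ζ‖ ≠ 1 → ζ ≠ 0 → Ω ζ = Omega0 A κ f ζ + X0 A κ ζ * R ζ) :
    BoundaryConditions A κ f Ω := by
  have hg := circleHolder_density hκ hf
  have hpi : (2 * Real.pi * I : ℂ) ≠ 0 := by simp [Real.pi_ne_zero]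
  have hΩ' : ∀ ζ, ‖ζ‖ ≠ 1 → ζ ≠ 0 → X0 A κ ζ * ((2 * Real.pi * I)⁻¹ *
      cauchyT (density A κ f) ζ + R ζ) = Ω ζ := by
    intro ζ h1 h0
    rw [hΩ ζ h1 h0, Omega0_eq hκ]
    ring
  have hne : ∀ t : ℂ, ‖t‖ = 1 → t ≠ 0 := fun t ht =>
    norm_ne_zero_iff.1 (by rw [ht]; exact one_ne_zero)
  have hin : ∀ t ∈ A.gammaU ∪ A.gammaS, Tendsto Ω (𝓝[disk] t) (𝓝 (innerValue (X0 A κ) t *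
      ((2 * Real.pi * I)⁻¹ * (cauchyK (density A κ f) t +
        2 * Real.pi * I * density A κ f t) + R t))) := by
    intro t ht
    have ht1 := (A.mem_gammaU_union_gammaS_iff.1 ht).1
    refine ((boundary_X0 A hκ ht).1.mul (((hg.tendsto_cauchyT_disk ht1).const_mul _).add
      ((hR t ht1).tendsto.mono_left nhdsWithin_le_nhds))).congr' ?_
    filter_upwards [self_mem_nhdsWithin, nhdsWithin_le_nhds (isOpen_ne.mem_nhds (hne t ht1))]
      with ζ hζ h0 using hΩ' ζ (ne_of_lt hζ) h0
  have hout : ∀ t ∈ A.gammaU ∪ A.gammaS, Tendsto Ω (𝓝[exterior] t) (𝓝 (outerValue (X0 A κ) t *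
      ((2 * Real.pi * I)⁻¹ * cauchyK (density A κ f) t + R t))) := by
    intro t ht
    have ht1 := (A.mem_gammaU_union_gammaS_iff.1 ht).1
    refine ((boundary_X0 A hκ ht).2.1.mul (((hg.tendsto_cauchyT_exterior ht1).const_mul _).add
      ((hR t ht1).tendsto.mono_left nhdsWithin_le_nhds))).congr' ?_
    filter_upwards [self_mem_nhdsWithin, nhdsWithin_le_nhds (isOpen_ne.mem_nhds (hne t ht1))]
      with ζ hζ h0 using hΩ' ζ (ne_of_gt hζ) h0
  have hfd : ∀ t ∈ A.gammaU ∪ A.gammaS, innerValue (X0 A κ) t * density A κ f t = f t := by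
    intro t ht
    rw [density, recipX0_eq A hκ ht, mul_comm, mul_assoc, inv_mul_cancel₀ (boundary_X0 A hκ ht).2.2.1,
      mul_one]
  refine ⟨fun t ht => ⟨_, _, hin t (Or.inr ht), hout t (Or.inr ht), ?_⟩,
    fun t ht => ⟨_, _, hin t (Or.inl ht), hout t (Or.inl ht), ?_⟩, fun c hc => ?_⟩
  · rw [← hfd t (Or.inr ht), (boundary_X0_of_mem_gammaS A κ ht).1,
      (boundary_X0_of_mem_gammaS A κ ht).2]
    field_simp
    ring
  · have h := (boundary_X0_of_mem_gammaU A hκ ht).2.2.2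
    rw [← hfd t (Or.inl ht), h]
    field_simp
    ring
  · refine ⟨1 / 2, by norm_num, ?_⟩
    have hc1 := A.norm_of_mem_ends hc
    obtain ⟨B, hB, hbd⟩ := hg.bounded_cauchyT
    have h1 : (fun ζ => (2 * Real.pi * I)⁻¹ * cauchyT (density A κ f) ζ + R ζ)
        =O[𝓝[{ζ | ‖ζ‖ ≠ 1}] c] fun _ => (1 : ℝ) := by
      refine Asymptotics.IsBigO.add (Asymptotics.IsBigO.const_mul_left ?_ _) ?_
      · refine Asymptotics.IsBigO.of_bound B ?_
        filter_upwards [self_mem_nhdsWithin, nhdsWithin_le_nhds (isOpen_ne.mem_nhds (hne c hc1))]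
          with ζ hζ h0
        simpa using hbd ζ h0 hζ
      · exact ((hR c hc1).tendsto.mono_left nhdsWithin_le_nhds).isBigO_one ℝ
    have h2 := (isBigO_X0 A hκ hc).mul h1
    simp only [mul_one] at h2
    refine h2.congr' ?_ EventuallyEq.rfl
    filter_upwards [self_mem_nhdsWithin, nhdsWithin_le_nhds (isOpen_ne.mem_nhds (hne c hc1))]
      with ζ hζ h0 using hΩ' ζ hζ h0

theorem differentiableAt_Omega0 (hκ : 1 < κ) (hf : HolderOnArcs A f) {ζ : ℂ} (hζ : ‖ζ‖ ≠ 1) :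
    DifferentiableAt ℂ (Omega0 A κ f) ζ := by
  have h : Omega0 A κ f = fun ζ =>
      X0 A κ ζ * ((2 * Real.pi * I)⁻¹ * cauchyT (density A κ f) ζ) := by
    ext ζ
    exact Omega0_eq hκ ζ
  rw [h]
  exact (differentiableAt_X0 A κ (A.notMem_of_norm_ne_one hζ)).mul
    (((circleHolder_density hκ hf).differentiableAt_cauchyT hζ).const_mul _)

end Density

/-! ### A Liouville theorem for functions continuous across the circle -/

section Gluing

theorem disk_eq_ball : disk = Metric.ball (0 : ℂ) 1 := by ext; simp [disk]

/-- Laurent coefficients on the unit circle, up to the factor `2πi`. -/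
def circleCoeff (p : ℂ → ℂ) (j : ℤ) : ℂ := ∮ t in C(0, 1), p t * t ^ (-j - 1)

theorem circleCoeff_of_neg {p : ℂ → ℂ} (hp : DiffContOnCl ℂ p (Metric.ball 0 1)) {j : ℤ}
    (hj : j < 0) : circleCoeff p j = 0 := by
  obtain ⟨m, hm⟩ := Int.eq_ofNat_of_zero_le (by omega : 0 ≤ -j - 1)
  have h1 : DiffContOnCl ℂ (fun t : ℂ => t ^ m) (Metric.ball 0 1) :=
    (differentiable_pow m).diffContOnCl
  have h2 := (hp.smul h1).circleIntegral_eq_zero zero_le_one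
  rw [circleCoeff, hm]
  simpa only [zpow_natCast, smul_eq_mul] using h2

/-- The substitution `t ↦ t⁻¹`, that is `φ ↦ -φ`, over the symmetric interval. -/
theorem circleCoeff_inversion {p q : ℂ → ℂ} {M : ℤ}
    (h : ∀ t, ‖t‖ = 1 → q t = t ^ M * p t⁻¹) (j : ℤ) :
    circleCoeff q j = circleCoeff p (M - j) := by
  have hpi : -Real.pi + 2 * Real.pi = Real.pi := by ring
  rw [circleCoeff, circleCoeff, circleIntegral_eq_integral _ (-Real.pi),
    circleIntegral_eq_integral _ (-Real.pi), hpi]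
  have h1 := intervalIntegral.integral_comp_neg (a := -Real.pi) (b := Real.pi)
    (fun φ : ℝ => p (pt φ) * pt φ ^ (-(M - j) - 1) * (I * pt φ))
  rw [neg_neg] at h1
  rw [← h1]
  refine intervalIntegral.integral_congr fun φ _ => ?_
  have h0 := pt_ne_zero φ
  simp only [h _ (norm_pt φ), pt_neg]
  rw [inv_zpow', mul_comm I, mul_comm I, ← mul_assoc, ← mul_assoc]
  congr 1
  have e1 : pt φ ^ M * p (pt φ)⁻¹ * pt φ ^ (-j - 1) * pt φ =
      p (pt φ)⁻¹ * (pt φ ^ M * pt φ ^ (-j - 1) * pt φ ^ (1 : ℤ)) := by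
    rw [zpow_one]
    ring
  have e2 : p (pt φ)⁻¹ * pt φ ^ (-(-(M - j) - 1)) * (pt φ)⁻¹ =
      p (pt φ)⁻¹ * (pt φ ^ (-(-(M - j) - 1)) * pt φ ^ (-1 : ℤ)) := by
    rw [zpow_neg_one]
    ring
  rw [e1, e2, ← zpow_add₀ h0, ← zpow_add₀ h0, ← zpow_add₀ h0]
  congr 2
  ring

theorem hasSum_circleCoeff {p : ℂ → ℂ} (hp : DiffContOnCl ℂ p (Metric.ball 0 1)) {w : ℂ}
    (hw : ‖w‖ < 1) :
    HasSum (fun k : ℕ => (2 * Real.pi * I)⁻¹ * circleCoeff p k * w ^ k) (p w) := by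
  have hc : CircleIntegrable p 0 1 := by
    refine ContinuousOn.circleIntegrable zero_le_one (hp.continuousOn.mono ?_)
    rw [closure_ball _ one_ne_zero]
    exact Metric.sphere_subset_closedBall
  have h1 := hasSum_cauchyPowerSeries_integral hc hw
  rw [zero_add, hp.two_pi_i_inv_smul_circleIntegral_sub_inv_smul (by simpa using hw)] at h1
  refine h1.congr_fun fun k => ?_
  rw [cauchyPowerSeries_apply, smul_eq_mul, mul_assoc, circleCoeff, mul_comm (circleIntegral _ _ _),
    ← circleIntegral.integral_const_mul]
  congr 1
  refine circleIntegral.integral_congr zero_le_one fun t ht => ?_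
  have h0 : t ≠ 0 := norm_ne_zero_iff.1 (by
    have : ‖t‖ = 1 := by simpa using ht
    rw [this]; exact one_ne_zero)
  have h2 : t ^ (-(k : ℤ) - 1) = (t ^ k)⁻¹ * t⁻¹ := by
    rw [zpow_sub₀ h0, zpow_neg, zpow_natCast, zpow_one, div_eq_mul_inv]
  simp only [h2, sub_zero, div_pow, smul_eq_mul]
  ring

/-- Coefficient `k` of `p` equals coefficient `M - k` of `q`, and coefficients of negative index
vanish by Cauchy's theorem. Both Taylor series therefore stop at degree `M` and are reversals of
each other. -/
theorem exists_polynomial_of_inversion {p q : ℂ → ℂ} (hp : DiffContOnCl ℂ p (Metric.ball 0 1))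
    (hq : DiffContOnCl ℂ q (Metric.ball 0 1)) {M : ℕ}
    (h : ∀ t, ‖t‖ = 1 → q t = t ^ M * p t⁻¹) :
    ∃ Q : Polynomial ℂ, Q.natDegree ≤ M ∧ (∀ ζ, ‖ζ‖ < 1 → p ζ = Q.eval ζ) ∧
      ∀ w, w ≠ 0 → ‖w‖ < 1 → q w = w ^ M * Q.eval w⁻¹ := by
  have hz : ∀ t, ‖t‖ = 1 → q t = t ^ (M : ℤ) * p t⁻¹ := fun t ht => by
    rw [h t ht, zpow_natCast]
  have hcoef := circleCoeff_inversion hz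
  have hfin : ∀ r : ℂ → ℂ, DiffContOnCl ℂ r (Metric.ball 0 1) →
      (∀ k : ℕ, k ∉ Finset.range (M + 1) → circleCoeff r k = 0) → ∀ w, ‖w‖ < 1 →
      r w = ∑ k ∈ Finset.range (M + 1), (2 * Real.pi * I)⁻¹ * circleCoeff r k * w ^ k := by
    intro r hr h0 w hw
    refine (hasSum_circleCoeff hr hw).unique (hasSum_sum_of_ne_finset_zero fun k hk => ?_)
    rw [h0 k hk, mul_zero, zero_mul]
  have hp' := hfin p hp fun k hk => by
    rw [Finset.mem_range] at hk
    have := hcoef (M - k)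
    rw [sub_sub_cancel, circleCoeff_of_neg hq (by omega)] at this
    exact this.symm
  have hq' := hfin q hq fun k hk => by
    rw [Finset.mem_range] at hk
    rw [hcoef, circleCoeff_of_neg hp (by omega)]
  refine ⟨∑ k ∈ Finset.range (M + 1),
    Polynomial.C ((2 * Real.pi * I)⁻¹ * circleCoeff p k) * Polynomial.X ^ k, ?_, ?_, ?_⟩
  · refine Polynomial.natDegree_sum_le_of_forall_le _ _ fun k hk => ?_
    refine (Polynomial.natDegree_C_mul_X_pow_le _ _).trans ?_
    rw [Finset.mem_range] at hk
    omega
  · intro ζ hζ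
    rw [hp' ζ hζ, Polynomial.eval_finsetSum]
    simp
  · intro w hw0 hw
    rw [hq' w hw, Polynomial.eval_finsetSum, Finset.mul_sum, ← Finset.sum_range_reflect]
    refine Finset.sum_congr rfl fun k hk => ?_
    rw [Finset.mem_range] at hk
    have hk' : k ≤ M := by omega
    have e : M + 1 - 1 - k = M - k := by omega
    simp only [Polynomial.eval_mul, Polynomial.eval_C, Polynomial.eval_pow, Polynomial.eval_X]
    rw [e, hcoef, Nat.cast_sub hk', sub_sub_cancel, inv_pow]
    have e2 : w ^ M = w ^ (M - k) * w ^ k := by rw [← pow_add, Nat.sub_add_cancel hk']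
    rw [e2]
    field_simp

/-- The singularity at the origin is removable, and limits at all boundary points give a continuous
extension to the closed disk. -/
theorem exists_diffContOnCl_extension {F : ℂ → ℂ}
    (hd : ∀ ζ, ‖ζ‖ < 1 → ζ ≠ 0 → DifferentiableAt ℂ F ζ)
    (h0 : F =O[𝓝[≠] 0] fun _ => (1 : ℂ))
    (hb : ∀ t, ‖t‖ = 1 → ∃ v, Tendsto F (𝓝[disk] t) (𝓝 v)) :
    ∃ p : ℂ → ℂ, DiffContOnCl ℂ p (Metric.ball 0 1) ∧ (∀ ζ, ‖ζ‖ < 1 → ζ ≠ 0 → p ζ = F ζ) ∧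
      ∀ t, ‖t‖ = 1 → Tendsto F (𝓝[disk] t) (𝓝 (p t)) := by
  have ho : (fun z => F z - F 0) =o[𝓝[≠] 0] fun z => (z - 0)⁻¹ := by
    have h1 : (fun z => F z - F 0) =O[𝓝[≠] 0] fun _ => (1 : ℂ) :=
      h0.sub (Asymptotics.isBigO_const_const _ one_ne_zero _)
    refine h1.trans_isLittleO ?_
    rw [Asymptotics.isLittleO_const_left]
    right
    simp only [sub_zero]
    exact tendsto_norm_inv_nhdsNE_zero_atTop
  set F1 := Function.update F 0 (limUnder (𝓝[≠] 0) F) with hF1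
  have hdiff : DifferentiableOn ℂ F1 (Metric.ball 0 1) := by
    refine differentiableOn_update_limUnder_of_isLittleO (Metric.ball_mem_nhds _ one_pos)
      (fun z hz => ?_) ho
    exact (hd z (by simpa using hz.1) (by simpa using hz.2)).differentiableWithinAt
  have hF1F : ∀ ζ, ζ ≠ 0 → F1 ζ = F ζ := fun ζ hζ => Function.update_of_ne hζ _ _
  have hlim : ∀ t, ‖t‖ = 1 → ∀ v, Tendsto F (𝓝[disk] t) (𝓝 v) →
      Tendsto F1 (𝓝[disk] t) (𝓝 v) := by
    intro t ht v hv
    have ht0 : t ≠ 0 := norm_ne_zero_iff.1 (by rw [ht]; exact one_ne_zero)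
    refine hv.congr' ?_
    filter_upwards [nhdsWithin_le_nhds (isOpen_ne.mem_nhds ht0)] with z hz using (hF1F z hz).symm
  rw [← disk_eq_ball] at hdiff ⊢
  have hext : ∀ ζ ∈ disk, extendFrom disk F1 ζ = F1 ζ :=
    fun ζ hζ => extendFrom_extends hdiff.continuousOn ζ hζ
  refine ⟨extendFrom disk F1, ⟨hdiff.congr hext, ?_⟩, fun ζ h1 h2 => ?_, fun t ht => ?_⟩
  · refine continuousOn_extendFrom subset_rfl fun t ht => ?_
    have ht' : ‖t‖ ≤ 1 := by
      rw [disk_eq_ball, closure_ball _ one_ne_zero] at ht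
      simpa using ht
    rcases ht'.lt_or_eq with h1 | h1
    · exact ⟨_, hdiff.continuousOn t h1⟩
    · obtain ⟨v, hv⟩ := hb t h1
      exact ⟨v, hlim t h1 v hv⟩
  · rw [hext ζ h1, hF1F ζ h2]
  · obtain ⟨v, hv⟩ := hb t ht
    rwa [extendFrom_eq (closure_disk_mem ht) (hlim t ht v hv)]

/-- A function holomorphic off the circle and the origin, bounded at the origin, of polynomial
growth at infinity, whose boundary values on both sides of the circle agree, is a polynomial. -/
theorem exists_polynomial_of_glued {T : ℂ → ℂ} {M : ℕ}
    (hd : ∀ ζ, ‖ζ‖ ≠ 1 → ζ ≠ 0 → DifferentiableAt ℂ T ζ)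
    (h0 : T =O[𝓝[≠] 0] fun _ => (1 : ℂ))
    (hb : ∀ t, ‖t‖ = 1 → ∃ v, Tendsto T (𝓝[disk] t) (𝓝 v) ∧ Tendsto T (𝓝[exterior] t) (𝓝 v))
    (hinf : T =O[cobounded ℂ] fun ζ => ζ ^ M) :
    ∃ Q : Polynomial ℂ, Q.natDegree ≤ M ∧ ∀ ζ, ‖ζ‖ ≠ 1 → ζ ≠ 0 → T ζ = Q.eval ζ := by
  have hinv : ∀ t : ℂ, ‖t‖ = 1 → Tendsto (fun w : ℂ => w⁻¹) (𝓝[disk] t) (𝓝[exterior] t⁻¹) := by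
    intro t ht
    have ht0 : t ≠ 0 := norm_ne_zero_iff.1 (by rw [ht]; exact one_ne_zero)
    refine tendsto_nhdsWithin_iff.2 ⟨(tendsto_inv₀ ht0).mono_left nhdsWithin_le_nhds, ?_⟩
    filter_upwards [self_mem_nhdsWithin, nhdsWithin_le_nhds (isOpen_ne.mem_nhds ht0)] with w hw hw0
    change 1 < ‖w⁻¹‖
    rw [norm_inv]
    exact (one_lt_inv₀ (norm_pos_iff.2 hw0)).2 hw
  have hbq : ∀ t v, ‖t‖ = 1 → Tendsto T (𝓝[exterior] t⁻¹) (𝓝 v) →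
      Tendsto (fun w : ℂ => w ^ M * T w⁻¹) (𝓝[disk] t) (𝓝 (t ^ M * v)) := by
    intro t v ht hv
    exact (((continuous_pow M).tendsto t).mono_left nhdsWithin_le_nhds).mul (hv.comp (hinv t ht))
  have hinv1 : ∀ t : ℂ, ‖t‖ = 1 → ‖t⁻¹‖ = 1 := fun t ht => by rw [norm_inv, ht, inv_one]
  obtain ⟨p, hp, hpT, hpb⟩ := exists_diffContOnCl_extension (fun ζ h1 h2 => hd ζ h1.ne h2) h0
    fun t ht => (hb t ht).imp fun v hv => hv.1
  -- Inversion carries the exterior to the punctured disk, and `w ^ M` absorbs the growth of `T` at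
  -- infinity.
  obtain ⟨q, hq, hqT, hqb⟩ := exists_diffContOnCl_extension (F := fun w => w ^ M * T w⁻¹)
    (fun w h1 h2 => by
      refine (differentiableAt_pow M).mul (DifferentiableAt.comp w (hd _ ?_ (inv_ne_zero h2))
        (differentiableAt_inv h2))
      rw [norm_inv]
      exact fun h => h1.ne (inv_eq_one.1 h))
    (by
      have h1 := hinf.comp_tendsto tendsto_inv₀_nhdsNE_zero
      have h2 := (Asymptotics.isBigO_refl (fun w : ℂ => w ^ M) (𝓝[≠] 0)).mul h1
      refine h2.congr' EventuallyEq.rfl ?_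
      filter_upwards [self_mem_nhdsWithin] with w hw
      have hw' : w ≠ 0 := hw
      simp only [Function.comp]
      rw [← mul_pow, mul_inv_cancel₀ hw', one_pow])
    (fun t ht => by
      obtain ⟨v, -, hv⟩ := hb t⁻¹ (hinv1 t ht)
      exact ⟨_, hbq t v ht hv⟩)
  obtain ⟨Q, hQ, hQp, hQq⟩ := exists_polynomial_of_inversion hp hq (M := M) fun t ht => by
    have := neBot_disk ht
    have := neBot_disk (hinv1 t ht)
    obtain ⟨v, hv1, hv2⟩ := hb t⁻¹ (hinv1 t ht)
    rw [tendsto_nhds_unique (hpb t⁻¹ (hinv1 t ht)) hv1]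
    exact tendsto_nhds_unique (hqb t ht) (hbq t v ht hv2)
  refine ⟨Q, hQ, fun ζ h1 h2 => ?_⟩
  rcases lt_or_gt_of_ne h1 with h1 | h1
  · rw [← hpT ζ h1 h2, hQp ζ h1]
  · have h3 : ‖ζ⁻¹‖ < 1 := by
      rw [norm_inv]
      exact inv_lt_one_of_one_lt₀ h1
    have h4 := hQq ζ⁻¹ (inv_ne_zero h2) h3
    rw [hqT ζ⁻¹ h3 (inv_ne_zero h2), inv_inv] at h4
    exact mul_left_cancel₀ (pow_ne_zero _ (inv_ne_zero h2)) h4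

end Gluing

/-! ### The general solution -/

section GeneralSolution

variable {n : ℕ} {A : ArcSystem n} {κ : ℝ} {f : ℂ → ℂ}

theorem isOpen_domain (N : ℕ) : IsOpen (domain N) := by
  have h : domain N = {ζ : ℂ | ‖ζ‖ ≠ 1} ∩ {ζ | ζ ≠ 0 ∨ N ≤ 1} := rfl
  rw [h]
  refine (isOpen_ne_fun continuous_norm continuous_const).inter ?_
  by_cases hN : N ≤ 1
  · simp [hN]
  · simpa [hN] using isOpen_ne

theorem differentiableAt_laurentSum (C : ℤ → ℂ) (m n : ℕ) {ζ : ℂ} (h : ζ ≠ 0 ∨ m = 0) :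
    DifferentiableAt ℂ (laurentSum C m n) ζ := by
  unfold laurentSum
  refine DifferentiableAt.fun_sum fun j hj => (DifferentiableAt.const_mul ?_ _)
  refine differentiableAt_zpow.2 (h.imp id fun h => ?_)
  rw [Finset.mem_Icc] at hj
  omega

/-! ### Functions of the stated form are solutions -/

theorem differentiableAt_solution (hκ : 1 < κ) (hf : HolderOnArcs A f) (C : ℤ → ℂ) {N : ℕ} {ζ : ℂ}
    (hζ : ζ ∈ domain N) :
    DifferentiableAt ℂ (fun ζ => Omega0 A κ f ζ + X0 A κ ζ * laurentSum C (N - 1) n ζ) ζ :=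
  (differentiableAt_Omega0 hκ hf hζ.1).add
    ((differentiableAt_X0 A κ (A.notMem_of_norm_ne_one hζ.1)).mul
      (differentiableAt_laurentSum _ _ _ (hζ.2.imp id fun h => by omega)))

theorem isBigO_X0_cobounded (κ : ℝ) : X0 A κ =O[cobounded ℂ] fun ζ => (ζ ^ n)⁻¹ := by
  have h := (tendsto_pow_mul_X0 A κ).isBigO_one ℂ
  refine ((Asymptotics.isBigO_refl (fun ζ : ℂ => (ζ ^ n)⁻¹) (cobounded ℂ)).mul h).congr' ?_ ?_
  · filter_upwards [eventually_ne_cobounded (0 : ℂ)] with ζ hζ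
    rw [inv_mul_cancel_left₀ (pow_ne_zero _ hζ)]
  · simp only [mul_one]
    rfl

theorem isBigO_inv_X0_cobounded (κ : ℝ) :
    (fun ζ => (X0 A κ ζ)⁻¹) =O[cobounded ℂ] fun ζ => ζ ^ n := by
  have h := ((tendsto_pow_mul_X0 A κ).inv₀ one_ne_zero).isBigO_one ℂ
  refine ((Asymptotics.isBigO_refl (fun ζ : ℂ => ζ ^ n) (cobounded ℂ)).mul h).congr' ?_ ?_
  · filter_upwards [eventually_ne_cobounded (0 : ℂ)] with ζ hζ
    rw [mul_inv, mul_inv_cancel_left₀ (pow_ne_zero _ hζ)]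
  · simp only [mul_one]
    rfl

theorem tendsto_Omega0_cobounded (hκ : 1 < κ) (hf : HolderOnArcs A f) :
    Tendsto (Omega0 A κ f) (cobounded ℂ) (𝓝 0) := by
  have h1 : (X0 A κ) =O[cobounded ℂ] fun _ => (1 : ℂ) := by
    refine (isBigO_X0_cobounded κ).trans (Asymptotics.IsBigO.of_bound 1 ?_)
    filter_upwards [tendsto_norm_cobounded_atTop.eventually_ge_atTop 1] with ζ hζ
    rw [norm_inv, norm_pow, norm_one, mul_one]
    exact inv_le_one_of_one_le₀ (one_le_pow₀ hζ)
  have h2 : (cauchyT (density A κ f)) =o[cobounded ℂ] fun _ => (1 : ℂ) :=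
    (Asymptotics.isLittleO_one_iff ℂ).2 (circleHolder_density hκ hf).tendsto_cauchyT_cobounded
  have h3 := h1.mul_isLittleO (h2.const_mul_left (2 * Real.pi * I)⁻¹)
  simp only [mul_one] at h3
  refine ((Asymptotics.isLittleO_one_iff ℂ).1 h3).congr fun ζ => ?_
  rw [Omega0_eq hκ]

theorem isBigO_zpow_zpow_cobounded {i j : ℤ} (h : i ≤ j) :
    (fun ζ : ℂ => ζ ^ i) =O[cobounded ℂ] fun ζ => ζ ^ j := by
  refine Asymptotics.IsBigO.of_bound 1 ?_
  filter_upwards [tendsto_norm_cobounded_atTop.eventually_ge_atTop 1] with ζ hζ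
  rw [norm_zpow, norm_zpow, one_mul]
  exact zpow_le_zpow_right₀ hζ h

theorem isBigO_zpow_zpow_zero {i j : ℤ} (h : i ≤ j) :
    (fun ζ : ℂ => ζ ^ j) =O[𝓝[≠] 0] fun ζ => ζ ^ i := by
  have h1 := (isBigO_zpow_zpow_cobounded (neg_le_neg h)).comp_tendsto tendsto_inv₀_nhdsNE_zero
  simpa [Function.comp_def] using h1

theorem sectionallyHolomorphic_solution (hκ : 1 < κ) (hf : HolderOnArcs A f) {N : ℕ} {Ω : ℂ → ℂ}
    {C : ℤ → ℂ} (h : ∀ ζ ∈ domain N,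
      Ω ζ = Omega0 A κ f ζ + X0 A κ ζ * laurentSum C (N - 1) n ζ) :
    SectionallyHolomorphic N Ω := by
  have h0' : (0 : ℂ) ∉ A.gammaU ∪ A.ends := A.notMem_of_norm_ne_one (by simp)
  refine ⟨fun ζ hζ => ?_, ?_, ?_⟩
  · refine (differentiableAt_solution hκ hf C hζ).congr_of_eventuallyEq ?_
    filter_upwards [(isOpen_domain N).mem_nhds hζ] with z hz using h z hz
  · have hev : (fun ζ => Omega0 A κ f ζ + X0 A κ ζ * laurentSum C (N - 1) n ζ) =ᶠ[𝓝[≠] 0] Ω := by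
      filter_upwards [self_mem_nhdsWithin, nhdsWithin_le_nhds (Metric.ball_mem_nhds (0 : ℂ) one_pos)]
        with ζ hζ hζ1
      refine (h ζ ⟨?_, Or.inl hζ⟩).symm
      have : ‖ζ‖ < 1 := by simpa using hζ1
      exact this.ne
    refine Asymptotics.IsBigO.congr' ?_ hev EventuallyEq.rfl
    refine Asymptotics.IsBigO.add ?_ ?_
    · have h1 : Omega0 A κ f =O[𝓝[≠] 0] fun ζ : ℂ => ζ ^ (0 : ℤ) := by
        simpa using ((differentiableAt_Omega0 hκ hf (ζ := 0) (by simp)).continuousAt.tendsto.mono_left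
          nhdsWithin_le_nhds).isBigO_one ℂ
      exact h1.trans (isBigO_zpow_zpow_zero (by omega))
    · have h1 : X0 A κ =O[𝓝[≠] 0] fun _ => (1 : ℂ) :=
        ((differentiableAt_X0 A κ h0').continuousAt.tendsto.mono_left
          nhdsWithin_le_nhds).isBigO_one ℂ
      have h2 : laurentSum C (N - 1) n =O[𝓝[≠] 0] fun ζ => ζ ^ (-((N - 1 : ℕ) : ℤ)) := by
        refine Asymptotics.IsBigO.fun_sum fun j hj => ?_
        exact (isBigO_zpow_zpow_zero (Finset.mem_Icc.1 hj).1).const_mul_left _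
      simpa using h1.mul h2
  · have hev : (fun ζ => Omega0 A κ f ζ + X0 A κ ζ * laurentSum C (N - 1) n ζ)
        =ᶠ[cobounded ℂ] Ω := by
      filter_upwards [tendsto_norm_cobounded_atTop.eventually_gt_atTop 1] with ζ hζ
      refine (h ζ ⟨hζ.ne', Or.inl fun h0 => ?_⟩).symm
      rw [h0, norm_zero] at hζ
      linarith
    refine Asymptotics.IsBigO.congr' ?_ hev EventuallyEq.rfl
    refine ((tendsto_Omega0_cobounded hκ hf).isBigO_one ℂ).add ?_
    have h2 : laurentSum C (N - 1) n =O[cobounded ℂ] fun ζ => ζ ^ (n : ℤ) := by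
      refine Asymptotics.IsBigO.fun_sum fun j hj => ?_
      exact (isBigO_zpow_zpow_cobounded (Finset.mem_Icc.1 hj).2).const_mul_left _
    refine ((isBigO_X0_cobounded κ).mul h2).congr' EventuallyEq.rfl ?_
    filter_upwards [eventually_ne_cobounded (0 : ℂ)] with ζ hζ
    rw [zpow_natCast, inv_mul_cancel₀ (pow_ne_zero _ hζ)]

theorem boundaryConditions_solution (hκ : 1 < κ) (hf : HolderOnArcs A f) {N : ℕ} {Ω : ℂ → ℂ}
    {C : ℤ → ℂ} (h : ∀ ζ ∈ domain N,
      Ω ζ = Omega0 A κ f ζ + X0 A κ ζ * laurentSum C (N - 1) n ζ) :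
    BoundaryConditions A κ f Ω := by
  refine boundaryConditions_Omega0_add hκ hf (fun t ht => ?_) fun ζ h1 h0 => h ζ ⟨h1, Or.inl h0⟩
  exact (differentiableAt_laurentSum C _ _ (Or.inl (norm_ne_zero_iff.1
    (by rw [ht]; exact one_ne_zero)))).continuousAt

/-- The quotient of a solution by the canonical function, diminished by the Cauchy integral. -/
def quotient {n : ℕ} (A : ArcSystem n) (κ : ℝ) (f Ω : ℂ → ℂ) (ζ : ℂ) : ℂ :=
  Ω ζ * (X0 A κ ζ)⁻¹ - (2 * Real.pi * I)⁻¹ * cauchyT (density A κ f) ζ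

/-! ### Every solution has the stated form -/

theorem eq_add_quotient (hκ : 1 < κ) (Ω : ℂ → ℂ) {ζ : ℂ} (hζ : ‖ζ‖ ≠ 1) :
    Ω ζ = Omega0 A κ f ζ + X0 A κ ζ * quotient A κ f Ω ζ := by
  have := X0_ne_zero A κ fun h => A.notMem_of_norm_ne_one hζ (Or.inr h)
  rw [Omega0_eq hκ, quotient]
  field_simp
  ring

/-- Division by the boundary values of `X₀` turns either condition into `p/X₀⁺ - f/X₀⁺ = m/X₀⁻`, and
the Plemelj jump of the Cauchy integral removes exactly the term `f/X₀⁺`. -/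
theorem tendsto_quotient (hκ : 1 < κ) (hf : HolderOnArcs A f) {Ω : ℂ → ℂ}
    (hΩ : BoundaryConditions A κ f Ω) {t : ℂ} (ht : t ∈ A.gammaU ∪ A.gammaS) :
    ∃ v, Tendsto (quotient A κ f Ω) (𝓝[disk] t) (𝓝 v) ∧
      Tendsto (quotient A κ f Ω) (𝓝[exterior] t) (𝓝 v) := by
  have hg := circleHolder_density hκ hf
  have ht1 := (A.mem_gammaU_union_gammaS_iff.1 ht).1
  obtain ⟨x1, x2, x3, x4⟩ := boundary_X0 A hκ ht
  have key : ∃ p m : ℂ, Tendsto Ω (𝓝[disk] t) (𝓝 p) ∧ Tendsto Ω (𝓝[exterior] t) (𝓝 m) ∧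
      p * (innerValue (X0 A κ) t)⁻¹ - density A κ f t = m * (outerValue (X0 A κ) t)⁻¹ := by
    rw [density, recipX0_eq A hκ ht]
    rcases ht with hU | hS
    · obtain ⟨p, m, h1, h2, h3⟩ := hΩ.displacement t hU
      refine ⟨p, m, h1, h2, ?_⟩
      have hXX := (boundary_X0_of_mem_gammaU A hκ hU).2.2.2
      have hκ0 : (κ : ℂ) ≠ 0 := ofReal_ne_zero.2 (by linarith)
      rw [← h3, hXX]
      field_simp
      ring
    · obtain ⟨p, m, h1, h2, h3⟩ := hΩ.traction t hS
      refine ⟨p, m, h1, h2, ?_⟩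
      obtain ⟨e1, e2⟩ := boundary_X0_of_mem_gammaS A κ hS
      rw [← h3, e1, e2]
      ring
  obtain ⟨p, m, h1, h2, h3⟩ := key
  refine ⟨m * (outerValue (X0 A κ) t)⁻¹ - (2 * Real.pi * I)⁻¹ * cauchyK (density A κ f) t, ?_,
    (h2.mul (x2.inv₀ x4)).sub ((hg.tendsto_cauchyT_exterior ht1).const_mul _)⟩
  have h4 := (h1.mul (x1.inv₀ x3)).sub ((hg.tendsto_cauchyT_disk ht1).const_mul
    (2 * Real.pi * I)⁻¹)
  have hpi : (2 * Real.pi * I : ℂ) ≠ 0 := by simp [Real.pi_ne_zero]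
  rw [mul_add, inv_mul_cancel_left₀ hpi] at h4
  have h5 : p * (innerValue (X0 A κ) t)⁻¹ - ((2 * Real.pi * I)⁻¹ * cauchyK (density A κ f) t +
      density A κ f t) =
      m * (outerValue (X0 A κ) t)⁻¹ - (2 * Real.pi * I)⁻¹ * cauchyK (density A κ f) t := by
    rw [← h3]
    ring
  rw [h5] at h4
  exact h4

theorem exists_norm_inv_X0_le (hκ : 1 < κ) (A : ArcSystem n) :
    ∃ M : ℝ, 0 ≤ M ∧ ∀ ζ, ‖ζ‖ ≠ 1 → ‖ζ‖ ≤ 3 → ‖(X0 A κ ζ)⁻¹‖ ≤ M := by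
  -- For `‖ζ‖ ≤ 3` the distance to a point of the circle is at most `4`, so each square root is at
  -- most `2`.
  refine ⟨∏ _k : Fin n, κ * (2 * 2), Finset.prod_nonneg fun _ _ => by linarith,
    fun ζ hζ h3 => ?_⟩
  rw [X0, ← Finset.prod_inv_distrib, norm_prod]
  refine Finset.prod_le_prod (fun _ _ => norm_nonneg _) fun k _ => ?_
  have hne : ∀ φ, ζ ≠ pt φ := fun φ h => hζ (by rw [h, norm_pt])
  have h2 : ∀ φ, ‖ζ - pt φ‖ ^ (1 / 2 : ℝ) ≤ 2 := by
    intro φ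
    have : ‖ζ - pt φ‖ ≤ 2 ^ (2 : ℝ) := by
      have := norm_sub_le ζ (pt φ)
      rw [norm_pt] at this
      norm_num
      linarith
    refine (Real.rpow_le_rpow (norm_nonneg _) this (by norm_num)).trans_eq ?_
    rw [← Real.rpow_mul (by norm_num)]
    norm_num
  refine (norm_arcFactor_le hκ (A.start_lt_finish k) (A.finish_lt k) (hne _) (hne _)).2.trans ?_
  have := h2 (A.start k)
  have := h2 (A.finish k)
  gcongr

/-- Here `δ < 1` enters: `(ζ - c) Ω` is of order `‖ζ - c‖ ^ (1 - δ)`, while `1/X₀` and the Cauchy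
integral stay bounded. -/
theorem tendsto_sub_mul_quotient (hκ : 1 < κ) (hf : HolderOnArcs A f) {Ω : ℂ → ℂ}
    (hΩ : BoundaryConditions A κ f Ω) {c : ℂ} (hc : c ∈ A.ends) :
    Tendsto (fun ζ => (ζ - c) * quotient A κ f Ω ζ) (𝓝[{ζ | ‖ζ‖ ≠ 1}] c) (𝓝 0) := by
  have hc1 := A.norm_of_mem_ends hc
  have hc0 : c ≠ 0 := norm_ne_zero_iff.1 (by rw [hc1]; exact one_ne_zero)
  obtain ⟨δ, hδ, hO⟩ := hΩ.ends c hc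
  obtain ⟨M, hM, hXM⟩ := exists_norm_inv_X0_le hκ A
  obtain ⟨B, hB, hbd⟩ := (circleHolder_density hκ hf).bounded_cauchyT
  have hX : (fun ζ => (X0 A κ ζ)⁻¹) =O[𝓝[{ζ | ‖ζ‖ ≠ 1}] c] fun _ => (1 : ℝ) := by
    refine Asymptotics.IsBigO.of_bound M ?_
    filter_upwards [self_mem_nhdsWithin, nhdsWithin_le_nhds (Metric.ball_mem_nhds c two_pos)]
      with ζ hζ hζ3
    rw [norm_one, mul_one]
    refine hXM ζ hζ ?_
    rw [mem_ball_iff_norm] at hζ3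
    have := norm_sub_norm_le ζ c
    linarith
  have hG : (fun ζ => (2 * Real.pi * I)⁻¹ * cauchyT (density A κ f) ζ)
      =O[𝓝[{ζ | ‖ζ‖ ≠ 1}] c] fun _ => (1 : ℝ) := by
    refine Asymptotics.IsBigO.const_mul_left (Asymptotics.IsBigO.of_bound B ?_) _
    filter_upwards [self_mem_nhdsWithin, nhdsWithin_le_nhds (isOpen_ne.mem_nhds hc0)]
      with ζ hζ h0
    simpa using hbd ζ h0 hζ
  have hsub : Tendsto (fun ζ => ζ - c) (𝓝[{ζ | ‖ζ‖ ≠ 1}] c) (𝓝 0) := by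
    have := ((continuous_sub_right c).tendsto c).mono_left
      (nhdsWithin_le_nhds (s := {ζ : ℂ | ‖ζ‖ ≠ 1}))
    rwa [sub_self] at this
  have h1 : (fun ζ => (ζ - c) * Ω ζ) =o[𝓝[{ζ | ‖ζ‖ ≠ 1}] c] fun _ => (1 : ℝ) := by
    have h2 : (fun ζ => (ζ - c) * Ω ζ) =O[𝓝[{ζ | ‖ζ‖ ≠ 1}] c] fun ζ => ‖ζ - c‖ ^ (1 - δ) := by
      refine (((Asymptotics.isBigO_refl (fun ζ => ζ - c) _).norm_right).mul hO).congr'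
        EventuallyEq.rfl ?_
      filter_upwards [self_mem_nhdsWithin] with ζ hζ
      have hpos : 0 < ‖ζ - c‖ := norm_pos_iff.2 (sub_ne_zero.2 fun h => hζ (by rw [h, hc1]))
      rw [sub_eq_add_neg 1 δ, Real.rpow_add hpos, Real.rpow_one]
    refine h2.trans_isLittleO ((Asymptotics.isLittleO_one_iff ℝ).2 ?_)
    have h3 := ((Real.continuous_rpow_const (q := 1 - δ) (by linarith)).tendsto 0).comp
      (tendsto_norm_zero.comp hsub)
    rwa [Real.zero_rpow (by linarith)] at h3
  have h4 := h1.mul_isBigO hX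
  have h5 := ((Asymptotics.isLittleO_one_iff ℝ).2 hsub).mul_isBigO hG
  have h6 := h4.sub h5
  simp only [mul_one] at h6
  refine ((Asymptotics.isLittleO_one_iff ℝ).1 h6).congr fun ζ => ?_
  rw [quotient]
  ring

/-- The polynomial vanishing simply at the end points. -/
def endsPoly {n : ℕ} (A : ArcSystem n) : Polynomial ℂ :=
  ∏ c ∈ A.finite_ends.toFinset, (Polynomial.X - Polynomial.C c)

theorem eval_endsPoly (A : ArcSystem n) (ζ : ℂ) :
    (endsPoly A).eval ζ = ∏ c ∈ A.finite_ends.toFinset, (ζ - c) := by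
  rw [endsPoly, Polynomial.eval_prod]
  simp

theorem monic_endsPoly (A : ArcSystem n) : (endsPoly A).Monic :=
  Polynomial.monic_prod_of_monic _ _ fun c _ => Polynomial.monic_X_sub_C c

theorem isBigO_eval_endsPoly (A : ArcSystem n) :
    (fun ζ => (endsPoly A).eval ζ) =O[cobounded ℂ] fun ζ => ζ ^ (endsPoly A).natDegree := by
  have h1 : (endsPoly A).natDegree = A.finite_ends.toFinset.card := by
    rw [endsPoly, Polynomial.natDegree_prod_of_monic _ _ fun c _ => Polynomial.monic_X_sub_C c]
    simp
  rw [h1]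
  refine Asymptotics.IsBigO.of_bound (2 ^ A.finite_ends.toFinset.card) ?_
  filter_upwards [tendsto_norm_cobounded_atTop.eventually_ge_atTop 1] with ζ hζ
  rw [eval_endsPoly, norm_prod, norm_pow, ← mul_pow, ← Finset.prod_const]
  refine Finset.prod_le_prod (fun _ _ => norm_nonneg _) fun c hc => ?_
  have := A.norm_of_mem_ends (A.finite_ends.mem_toFinset.1 hc)
  linarith [norm_sub_le ζ c]

/-- The factor `ζ ^ (N - 1)` cancels the pole and `endsPoly` makes the product tend to zero at the
end points, so the gluing theorem applies. The resulting polynomial vanishes at the end points and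
is divisible by `endsPoly`, which restores the sharp degree. Truncated subtraction makes the
exponent `max (N - 1, 0)`. -/
theorem exists_polynomial_quotient (hκ : 1 < κ) (hf : HolderOnArcs A f) {N : ℕ} {Ω : ℂ → ℂ}
    (hΩ : SectionallyHolomorphic N Ω) (hΩ' : BoundaryConditions A κ f Ω) :
    ∃ R : Polynomial ℂ, R.natDegree ≤ N - 1 + n ∧ ∀ ζ, ‖ζ‖ ≠ 1 → ζ ≠ 0 →
      ζ ^ (N - 1) * quotient A κ f Ω ζ = R.eval ζ := by
  have hg := circleHolder_density hκ hf
  set P := endsPoly A with hP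
  have h0n : ‖(0 : ℂ)‖ ≠ 1 := by simp
  have hXne : ∀ ζ, ‖ζ‖ ≠ 1 → X0 A κ ζ ≠ 0 := fun ζ hζ =>
    X0_ne_zero A κ fun h => A.notMem_of_norm_ne_one hζ (Or.inr h)
  have hXd : ∀ ζ, ‖ζ‖ ≠ 1 → DifferentiableAt ℂ (fun z => (X0 A κ z)⁻¹) ζ := fun ζ hζ =>
    (differentiableAt_X0 A κ (A.notMem_of_norm_ne_one hζ)).inv (hXne ζ hζ)
  have hGd : ∀ ζ, ‖ζ‖ ≠ 1 → DifferentiableAt ℂ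
      (fun z => (2 * Real.pi * I)⁻¹ * cauchyT (density A κ f) z) ζ := fun ζ hζ =>
    (hg.differentiableAt_cauchyT hζ).const_mul _
  have hvanish : ∀ t ∈ A.ends, Tendsto (fun ζ => ζ ^ (N - 1) * (P.eval ζ * quotient A κ f Ω ζ))
      (𝓝[{ζ | ‖ζ‖ ≠ 1}] t) (𝓝 0) := by
    intro t ht
    have h1 := tendsto_sub_mul_quotient hκ hf hΩ' ht
    have h2 : Tendsto (fun ζ : ℂ => ζ ^ (N - 1) * ∏ c ∈ A.finite_ends.toFinset.erase t, (ζ - c))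
        (𝓝[{ζ | ‖ζ‖ ≠ 1}] t)
        (𝓝 (t ^ (N - 1) * ∏ c ∈ A.finite_ends.toFinset.erase t, (t - c))) := by
      refine (Continuous.tendsto ?_ t).mono_left nhdsWithin_le_nhds
      fun_prop
    have h3 := h2.mul h1
    rw [mul_zero] at h3
    refine h3.congr fun ζ => ?_
    rw [hP, eval_endsPoly, ← Finset.mul_prod_erase _ _ (A.finite_ends.mem_toFinset.2 ht)]
    ring
  have hdisk : ∀ t, 𝓝[disk] t ≤ 𝓝[{ζ : ℂ | ‖ζ‖ ≠ 1}] t := fun t =>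
    nhdsWithin_mono t fun ζ (h : ‖ζ‖ < 1) => h.ne
  have hext : ∀ t, 𝓝[exterior] t ≤ 𝓝[{ζ : ℂ | ‖ζ‖ ≠ 1}] t := fun t =>
    nhdsWithin_mono t fun ζ (h : 1 < ‖ζ‖) => h.ne'
  have hglue : ∃ Q : Polynomial ℂ, Q.natDegree ≤ N - 1 + (P.natDegree + n) ∧
      ∀ ζ, ‖ζ‖ ≠ 1 → ζ ≠ 0 → ζ ^ (N - 1) * (P.eval ζ * quotient A κ f Ω ζ) = Q.eval ζ := by
    refine exists_polynomial_of_glued ?_ ?_ ?_ ?_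
    · intro ζ h1 h0
      exact (differentiableAt_pow _).mul (P.differentiable.differentiableAt.mul
        (((hΩ.holo ζ ⟨h1, Or.inl h0⟩).mul (hXd ζ h1)).sub (hGd ζ h1)))
    · have hP0 : (fun ζ => P.eval ζ) =O[𝓝[≠] 0] fun _ => (1 : ℂ) :=
        ((P.continuous.tendsto 0).mono_left nhdsWithin_le_nhds).isBigO_one ℂ
      have hX1 := ((hXd 0 h0n).continuousAt.tendsto.mono_left
        (nhdsWithin_le_nhds (s := {(0 : ℂ)}ᶜ))).isBigO_one ℂ
      have hG1 := ((hGd 0 h0n).continuousAt.tendsto.mono_left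
        (nhdsWithin_le_nhds (s := {(0 : ℂ)}ᶜ))).isBigO_one ℂ
      have hp1 := (((continuous_pow (N - 1)).tendsto (0 : ℂ)).mono_left
        (nhdsWithin_le_nhds (s := {(0 : ℂ)}ᶜ))).isBigO_one ℂ
      have h1 : (fun ζ => ζ ^ (N - 1) * Ω ζ) =O[𝓝[≠] 0] fun _ => (1 : ℂ) := by
        refine ((Asymptotics.isBigO_refl (fun ζ : ℂ => ζ ^ (N - 1)) _).mul hΩ.origin).congr'
          EventuallyEq.rfl ?_
        filter_upwards [self_mem_nhdsWithin] with ζ hζ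
        rw [zpow_neg, zpow_natCast, mul_inv_cancel₀ (pow_ne_zero _ hζ)]
      have h2 := hP0.mul ((h1.mul hX1).sub (hp1.mul hG1))
      simp only [mul_one] at h2
      refine h2.congr_left fun ζ => ?_
      rw [quotient]
      ring
    · intro t ht
      by_cases hE : t ∈ A.ends
      · exact ⟨0, (hvanish t hE).mono_left (hdisk t), (hvanish t hE).mono_left (hext t)⟩
      · obtain ⟨v, h1, h2⟩ := tendsto_quotient hκ hf hΩ' (A.mem_gammaU_union_gammaS_iff.2 ⟨ht, hE⟩)
        have hpoly : ∀ S : Set ℂ, Tendsto (fun ζ : ℂ => ζ ^ (N - 1)) (𝓝[S] t) (𝓝 (t ^ (N - 1))) :=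
          fun S => ((continuous_pow (N - 1)).tendsto t).mono_left nhdsWithin_le_nhds
        have hP1 : ∀ S : Set ℂ, Tendsto (fun ζ : ℂ => P.eval ζ) (𝓝[S] t) (𝓝 (P.eval t)) :=
          fun S => (P.continuous.tendsto t).mono_left nhdsWithin_le_nhds
        exact ⟨_, (hpoly _).mul ((hP1 _).mul h1), (hpoly _).mul ((hP1 _).mul h2)⟩
    · have h1 : quotient A κ f Ω =O[cobounded ℂ] fun ζ => ζ ^ n := by
        refine Asymptotics.IsBigO.sub ?_ ?_
        · simpa using hΩ.infinity.mul (isBigO_inv_X0_cobounded (A := A) κ)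
        · have h2 := (hg.tendsto_cauchyT_cobounded.const_mul (2 * Real.pi * I)⁻¹).isBigO_one ℂ
          refine h2.trans ?_
          have h3 := isBigO_zpow_zpow_cobounded (i := 0) (j := n) (by omega)
          simpa using h3
      have h2 := (Asymptotics.isBigO_refl (fun ζ : ℂ => ζ ^ (N - 1)) (cobounded ℂ)).mul
        ((isBigO_eval_endsPoly A).mul h1)
      refine h2.congr_right fun ζ => ?_
      rw [pow_add, pow_add]
  obtain ⟨Q, hQ, hQT⟩ := hglue
  have hroot : ∀ c ∈ A.ends, Q.IsRoot c := by
    intro c hc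
    have hc1 := A.norm_of_mem_ends hc
    have hc0 : c ≠ 0 := norm_ne_zero_iff.1 (by rw [hc1]; exact one_ne_zero)
    have := neBot_disk hc1
    refine tendsto_nhds_unique ((Q.continuous.tendsto c).mono_left
      (nhdsWithin_le_nhds (s := disk))) (((hvanish c hc).mono_left (hdisk c)).congr' ?_)
    filter_upwards [self_mem_nhdsWithin, nhdsWithin_le_nhds (isOpen_ne.mem_nhds hc0)]
      with ζ hζ h0 using hQT ζ (ne_of_lt hζ) h0
  -- The linear factors of `P` belong to distinct end points, hence are pairwise coprime.
  have hdvd : P ∣ Q := by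
    refine Finset.prod_dvd_of_coprime
      ((Polynomial.pairwise_coprime_X_sub_C Function.injective_id).set_pairwise _) ?_
    intro c hc
    exact Polynomial.dvd_iff_isRoot.2 (hroot c (A.finite_ends.mem_toFinset.1 hc))
  obtain ⟨R, rfl⟩ := hdvd
  refine ⟨R, ?_, fun ζ h1 h0 => ?_⟩
  · by_cases hR : R = 0
    · simp [hR]
    · rw [Polynomial.natDegree_mul (monic_endsPoly A).ne_zero hR] at hQ
      rw [← hP] at hQ
      omega
  · have h2 := hQT ζ h1 h0
    have hPne : P.eval ζ ≠ 0 := by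
      rw [hP, eval_endsPoly]
      refine Finset.prod_ne_zero_iff.2 fun c hc => sub_ne_zero.2 fun h => h1 ?_
      rw [h]
      exact A.norm_of_mem_ends (A.finite_ends.mem_toFinset.1 hc)
    rw [Polynomial.eval_mul] at h2
    refine mul_left_cancel₀ hPne ?_
    rw [← h2]
    ring

theorem laurentSum_of_polynomial {R : Polynomial ℂ} {m n : ℕ} (hR : R.natDegree ≤ m + n) {ζ : ℂ}
    (hζ : ζ ≠ 0) :
    ζ ^ m * laurentSum (fun j => R.coeff (j + m).toNat) m n ζ = R.eval ζ := by
  rw [Polynomial.eval_eq_sum_range' (Nat.lt_succ_of_le hR), laurentSum, Finset.mul_sum]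
  refine Finset.sum_nbij' (fun j : ℤ => (j + m).toNat) (fun i : ℕ => (i : ℤ) - m) ?_ ?_ ?_ ?_ ?_
  · intro j hj
    rw [Finset.mem_Icc] at hj
    rw [Finset.mem_range]
    omega
  · intro i hi
    rw [Finset.mem_range] at hi
    rw [Finset.mem_Icc]
    omega
  · intro j hj
    rw [Finset.mem_Icc] at hj
    omega
  · intro i _
    omega
  · intro j hj
    rw [Finset.mem_Icc] at hj
    have h1 : ζ ^ (j + m).toNat = ζ ^ m * ζ ^ j := by
      rw [← zpow_natCast ζ (j + m).toNat, Int.toNat_of_nonneg (by omega), zpow_add₀ hζ,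
        zpow_natCast, mul_comm]
    rw [h1]
    ring

theorem exists_laurentSum (hκ : 1 < κ) (hf : HolderOnArcs A f) {N : ℕ} {Ω : ℂ → ℂ}
    (hΩ : SectionallyHolomorphic N Ω) (hΩ' : BoundaryConditions A κ f Ω) :
    ∃ C : ℤ → ℂ, ∀ ζ ∈ domain N,
      Ω ζ = Omega0 A κ f ζ + X0 A κ ζ * laurentSum C (N - 1) n ζ := by
  obtain ⟨R, hR, h⟩ := exists_polynomial_quotient hκ hf hΩ hΩ'
  have hne : ∀ ζ, ‖ζ‖ ≠ 1 → ζ ≠ 0 → Ω ζ = Omega0 A κ f ζ + X0 A κ ζ *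
      laurentSum (fun j => R.coeff (j + (N - 1 : ℕ)).toNat) (N - 1) n ζ := by
    intro ζ h1 h0
    rw [eq_add_quotient hκ Ω h1]
    congr 2
    refine mul_left_cancel₀ (pow_ne_zero (N - 1) h0) ?_
    rw [h ζ h1 h0, laurentSum_of_polynomial hR h0]
  refine ⟨fun j => R.coeff (j + (N - 1 : ℕ)).toNat, fun ζ hζ => ?_⟩
  -- The origin lies in the domain only if `N ≤ 1`; the identity extends to it by continuity of both
  -- sides.
  by_cases h0 : ζ = 0
  · subst h0
    refine tendsto_nhds_unique (l := 𝓝[≠] (0 : ℂ))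
      ((hΩ.holo 0 hζ).continuousAt.tendsto.mono_left nhdsWithin_le_nhds) ?_
    refine ((differentiableAt_solution hκ hf _ hζ).continuousAt.tendsto.mono_left
      nhdsWithin_le_nhds).congr' ?_
    filter_upwards [self_mem_nhdsWithin, nhdsWithin_le_nhds (Metric.ball_mem_nhds (0 : ℂ) one_pos)]
      with z hz hz1
    have : ‖z‖ < 1 := by simpa using hz1
    exact (hne z this.ne hz).symm
  · exact hne ζ hζ.1 h0

theorem solution_iff (hκ : 1 < κ) (hf : HolderOnArcs A f) (N : ℕ) (Ω : ℂ → ℂ) :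
    (SectionallyHolomorphic N Ω ∧ BoundaryConditions A κ f Ω) ↔
      ∃ C : ℤ → ℂ, ∀ ζ ∈ domain N,
        Ω ζ = Omega0 A κ f ζ + X0 A κ ζ * laurentSum C (N - 1) n ζ :=
  ⟨fun h => exists_laurentSum hκ hf h.1 h.2, fun ⟨_, hC⟩ =>
    ⟨sectionallyHolomorphic_solution hκ hf hC, boundaryConditions_solution hκ hf hC⟩⟩

end GeneralSolution

/-! ### The function built from the potentials -/

section Potentials

/-- An entire function has no jump on the circle, so the gluing theorem applies; the identity
theorem then covers the circle and the origin. -/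
theorem exists_polynomial_of_entire {ω : ℂ → ℂ} {N : ℕ} (hω : Differentiable ℂ ω)
    (hO : ω =O[cobounded ℂ] fun ζ => ζ ^ N) :
    ∃ Q : Polynomial ℂ, Q.natDegree ≤ N ∧ ∀ ζ, ω ζ = Q.eval ζ := by
  obtain ⟨Q, hQ, h⟩ := exists_polynomial_of_glued (T := ω) (M := N) (fun ζ _ _ => hω ζ)
    ((hω.continuous.tendsto 0 |>.mono_left nhdsWithin_le_nhds).isBigO_one ℂ)
    (fun t _ => ⟨ω t, (hω.continuous.tendsto t).mono_left nhdsWithin_le_nhds,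
      (hω.continuous.tendsto t).mono_left nhdsWithin_le_nhds⟩) hO
  refine ⟨Q, hQ, fun ζ => ?_⟩
  have hmem : exterior ∈ 𝓝 (2 : ℂ) := isOpen_exterior.mem_nhds (by simp [exterior])
  have heq : ω =ᶠ[𝓝 2] fun ζ => Q.eval ζ := by
    filter_upwards [hmem] with z hz
    have hz' : 1 < ‖z‖ := hz
    refine h z hz'.ne' fun h0 => ?_
    rw [h0, norm_zero] at hz'
    linarith
  exact congrFun (AnalyticOnNhd.eq_of_eventuallyEq (fun z _ => hω.analyticAt z)
    (fun z _ => Q.differentiable.analyticAt z) heq) ζ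

theorem reflect_eq (l : ℂ → ℂ) (ζ : ℂ) : reflect l ζ = conj (l (conj ζ⁻¹)) := by
  rw [reflect, one_div, ← map_inv₀]

theorem reflect_polynomial {ω : ℂ → ℂ} {Q : Polynomial ℂ} (h : ∀ ζ, ω ζ = Q.eval ζ) (ζ : ℂ) :
    reflect ω ζ = (Q.map (starRingEnd ℂ)).eval ζ⁻¹ := by
  rw [reflect_eq, h, ← Polynomial.eval_map_apply, conj_conj]

theorem conj_inv_mem_disk {ζ : ℂ} (hζ : 1 < ‖ζ‖) : conj ζ⁻¹ ∈ disk := by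
  change ‖conj ζ⁻¹‖ < 1
  rw [norm_conj, norm_inv]
  exact inv_lt_one_of_one_lt₀ hζ

theorem differentiableAt_reflect {l : ℂ → ℂ} (hl : DifferentiableOn ℂ l disk) {ζ : ℂ}
    (hζ : 1 < ‖ζ‖) : DifferentiableAt ℂ (reflect l) ζ := by
  have h0 : ζ ≠ 0 := fun h => by rw [h, norm_zero] at hζ; linarith
  have h1 : reflect l = (conj ∘ l ∘ conj) ∘ fun z => z⁻¹ := by
    ext z
    simp [reflect_eq]
  have h2 : DifferentiableAt ℂ l (conj ζ⁻¹) :=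
    hl.differentiableAt (isOpen_disk.mem_nhds (conj_inv_mem_disk hζ))
  rw [h1]
  refine DifferentiableAt.comp ζ ?_ (differentiableAt_inv h0)
  have h3 := h2.conj_conj
  rwa [conj_conj] at h3

theorem tendsto_reflect_cobounded {l : ℂ → ℂ} (hl : ContinuousAt l 0) :
    Tendsto (reflect l) (cobounded ℂ) (𝓝 (conj (l 0))) := by
  have h1 : Tendsto (fun ζ : ℂ => conj ζ⁻¹) (cobounded ℂ) (𝓝 0) := by
    have := (continuous_conj.tendsto 0).comp (tendsto_inv₀_cobounded (α := ℂ))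
    rwa [map_zero] at this
  refine ((continuous_conj.tendsto _).comp (hl.tendsto.comp h1)).congr fun ζ => ?_
  simp [reflect_eq]

theorem isBigO_eval_inv {Q : Polynomial ℂ} {d : ℕ} (hQ : Q.natDegree ≤ d) :
    (fun ζ : ℂ => Q.eval ζ⁻¹) =O[𝓝[≠] 0] fun ζ => ζ ^ (-(d : ℤ)) := by
  have h : (fun ζ : ℂ => ∑ i ∈ Finset.range (d + 1), Q.coeff i * ζ ^ (-(i : ℤ)))
      =O[𝓝[≠] 0] fun ζ => ζ ^ (-(d : ℤ)) := by
    refine Asymptotics.IsBigO.fun_sum fun i hi => ?_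
    rw [Finset.mem_range] at hi
    exact (isBigO_zpow_zpow_zero (by omega)).const_mul_left _
  refine h.congr_left fun ζ => ?_
  rw [Polynomial.eval_eq_sum_range' (Nat.lt_succ_of_le hQ)]
  simp

theorem natDegree_conj_le {Q : Polynomial ℂ} {d : ℕ} (h : Q.natDegree ≤ d) :
    (Q.map (starRingEnd ℂ)).natDegree ≤ d :=
  Polynomial.natDegree_map_le.trans h

theorem deriv_polynomial {ω : ℂ → ℂ} {Q : Polynomial ℂ} (h : ∀ ζ, ω ζ = Q.eval ζ) (ζ : ℂ) :
    deriv ω ζ = Q.derivative.eval ζ := by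
  rw [funext h]
  exact Q.deriv

variable {ω Φ Ψ : ℂ → ℂ}

theorem OmegaOf_of_lt {ζ : ℂ} (h : ‖ζ‖ < 1) : OmegaOf ω Φ Ψ ζ =
    reflect (deriv ω) ζ * Φ ζ - ζ ^ 2 * (reflect ω ζ * deriv Φ ζ + deriv ω ζ * Ψ ζ) :=
  if_pos h

theorem OmegaOf_of_gt {ζ : ℂ} (h : 1 < ‖ζ‖) : OmegaOf ω Φ Ψ ζ =
    -(reflect (deriv ω) ζ * reflect Φ ζ) :=
  if_neg h.not_gt

theorem differentiableAt_deriv_of_mem_disk (hΦ : DifferentiableOn ℂ Φ disk) {ζ : ℂ}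
    (hζ : ζ ∈ disk) : DifferentiableAt ℂ (deriv Φ) ζ :=
  (hΦ.deriv isOpen_disk).differentiableAt (isOpen_disk.mem_nhds hζ)

/-- The function built from the potentials when the mapping is `ω(ζ) = w₀ + w₁ ζ`. -/
theorem OmegaOf_affine {w₀ w₁ : ℂ} (hω : ∀ ζ, ω ζ = w₀ + w₁ * ζ) {ζ : ℂ} (hζ : ‖ζ‖ < 1) :
    OmegaOf ω Φ Ψ ζ = conj w₁ * Φ ζ -
      ((conj w₀ * ζ ^ 2 + conj w₁ * ζ) * deriv Φ ζ + w₁ * ζ ^ 2 * Ψ ζ) := by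
  have hd : ∀ z, deriv ω z = w₁ := fun z => by
    have h1 : HasDerivAt ω w₁ z := by
      rw [funext hω]
      simpa using ((hasDerivAt_id z).const_mul w₁).const_add w₀
    exact h1.deriv
  have h1 : reflect ω ζ = conj w₀ + conj w₁ * ζ⁻¹ := by
    rw [reflect_eq, hω]
    simp
  have h2 : reflect (deriv ω) ζ = conj w₁ := by rw [reflect_eq, hd]
  rw [OmegaOf_of_lt hζ, h1, h2, hd]
  -- The convention `0⁻¹ = 0` makes `reflect ω 0` a default value; the factor `ζ ^ 2` suppresses it.
  by_cases h0 : ζ = 0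
  · simp [h0]
  · field_simp

theorem differentiableAt_OmegaOf_affine {w₀ w₁ : ℂ} (hω : ∀ ζ, ω ζ = w₀ + w₁ * ζ)
    (hΦ : DifferentiableOn ℂ Φ disk) (hΨ : DifferentiableOn ℂ Ψ disk) {ζ : ℂ} (hζ : ζ ∈ disk) :
    DifferentiableAt ℂ (OmegaOf ω Φ Ψ) ζ := by
  have hmem := isOpen_disk.mem_nhds hζ
  have h1 := hΦ.differentiableAt hmem
  have h2 := hΨ.differentiableAt hmem
  have h3 := differentiableAt_deriv_of_mem_disk hΦ hζ
  have h4 : DifferentiableAt ℂ (fun ζ => conj w₁ * Φ ζ -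
      ((conj w₀ * ζ ^ 2 + conj w₁ * ζ) * deriv Φ ζ + w₁ * ζ ^ 2 * Ψ ζ)) ζ := by
    fun_prop
  refine h4.congr_of_eventuallyEq ?_
  filter_upwards [hmem] with z hz using OmegaOf_affine hω hz

theorem exists_affine {N : ℕ} (hN : N ≤ 1) (hω : Differentiable ℂ ω)
    (hO : ω =O[cobounded ℂ] fun ζ => ζ ^ N) : ∃ w₀ w₁ : ℂ, ∀ ζ, ω ζ = w₀ + w₁ * ζ := by
  obtain ⟨Q, hQ, h⟩ := exists_polynomial_of_entire hω hO
  refine ⟨Q.coeff 0, Q.coeff 1, fun ζ => ?_⟩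
  rw [h, Polynomial.eval_eq_sum_range' (Nat.lt_succ_of_le (hQ.trans hN)), Finset.sum_range_succ,
    Finset.sum_range_one]
  simp

/-- As `ω` is a polynomial of degree at most `N`, its reflection and that of its derivative are
polynomials in `1/ζ` of degrees at most `N` and `N - 1`. The factor `ζ ^ 2` lowers the pole of the
former to order `N - 2`, so `(ω')_R` determines the bound. -/
theorem sectionallyHolomorphic_OmegaOf {N : ℕ} (hω : Differentiable ℂ ω)
    (hO : ω =O[cobounded ℂ] fun ζ => ζ ^ N) (hΦ : DifferentiableOn ℂ Φ disk)
    (hΨ : DifferentiableOn ℂ Ψ disk) : SectionallyHolomorphic N (OmegaOf ω Φ Ψ) := by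
  obtain ⟨Q, hQ, hQω⟩ := exists_polynomial_of_entire hω hO
  have hQd := deriv_polynomial hQω
  have hr := reflect_polynomial hQω
  have hrd := reflect_polynomial hQd
  have hdeg : Q.derivative.natDegree ≤ N - 1 := (Polynomial.natDegree_derivative_le Q).trans
    (Nat.sub_le_sub_right hQ 1)
  have h0 : (0 : ℂ) ∈ disk := by simp [disk]
  have hdω : Differentiable ℂ (deriv ω) := by
    rw [funext hQd]
    exact Q.derivative.differentiable
  refine ⟨fun ζ hζ => ?_, ?_, ?_⟩
  · rcases lt_or_gt_of_ne hζ.1 with h1 | h1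
    · by_cases hz : ζ = 0
      · obtain ⟨w₀, w₁, h⟩ := exists_affine (hζ.2.resolve_left fun h => h hz) hω hO
        exact differentiableAt_OmegaOf_affine h hΦ hΨ h1
      · have hmem : disk ∈ 𝓝 ζ := isOpen_disk.mem_nhds h1
        have e1 := hΦ.differentiableAt hmem
        have e2 := hΨ.differentiableAt hmem
        have e3 := differentiableAt_deriv_of_mem_disk hΦ h1
        have e4 : ∀ S : Polynomial ℂ, DifferentiableAt ℂ (fun z : ℂ => S.eval z⁻¹) ζ := fun S =>
          S.differentiable.differentiableAt.comp ζ (differentiableAt_inv hz)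
        have e5 := (((e4 (Q.derivative.map (starRingEnd ℂ))).mul e1).sub
          ((differentiableAt_pow 2).mul (((e4 (Q.map (starRingEnd ℂ))).mul e3).add
            ((hdω ζ).mul e2))))
        refine e5.congr_of_eventuallyEq ?_
        filter_upwards [hmem] with z hz
        rw [OmegaOf_of_lt hz, hr, hrd]
        rfl
    · refine (((Q.derivative.map (starRingEnd ℂ)).differentiable.differentiableAt.comp ζ
        (differentiableAt_inv (norm_pos_iff.1 (by linarith)))).mul
        (differentiableAt_reflect hΦ h1)).neg.congr_of_eventuallyEq ?_
      filter_upwards [isOpen_exterior.mem_nhds h1] with z hz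
      rw [OmegaOf_of_gt hz, hrd]
      rfl
  · have hmem : disk ∈ 𝓝 (0 : ℂ) := isOpen_disk.mem_nhds h0
    have hc : ∀ F : ℂ → ℂ, DifferentiableAt ℂ F 0 → F =O[𝓝[≠] 0] fun _ => (1 : ℂ) := fun F hF =>
      (hF.continuousAt.tendsto.mono_left nhdsWithin_le_nhds).isBigO_one ℂ
    have e1 := (isBigO_eval_inv (natDegree_conj_le hdeg)).mul (hc _ (hΦ.differentiableAt hmem))
    have e2 := ((Asymptotics.isBigO_refl (fun ζ : ℂ => ζ ^ (2 : ℤ)) (𝓝[≠] 0)).mul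
      (isBigO_eval_inv (natDegree_conj_le hQ))).mul
      (hc _ (differentiableAt_deriv_of_mem_disk hΦ h0))
    have e3 := ((hc _ (differentiableAt_pow (𝕜 := ℂ) 2)).mul (hc _ (hdω 0))).mul
      (hc _ (hΨ.differentiableAt hmem))
    simp only [mul_one] at e1 e2 e3
    have e2' : (fun ζ : ℂ => ζ ^ (2 : ℤ) * ζ ^ (-(N : ℤ)))
        =O[𝓝[≠] 0] fun ζ => ζ ^ (-((N - 1 : ℕ) : ℤ)) := by
      refine (isBigO_zpow_zpow_zero (i := -((N - 1 : ℕ) : ℤ)) (j := 2 - N) (by omega)).congr' ?_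
        EventuallyEq.rfl
      filter_upwards [self_mem_nhdsWithin] with ζ hζ
      rw [sub_eq_add_neg, zpow_add₀ hζ]
    have e3' := e3.trans (k := fun ζ : ℂ => ζ ^ (-((N - 1 : ℕ) : ℤ))) (by
      simpa using isBigO_zpow_zpow_zero (i := -((N - 1 : ℕ) : ℤ)) (j := 0) (by omega))
    refine (e1.sub ((e2.trans e2').add e3')).congr' ?_ EventuallyEq.rfl
    filter_upwards [nhdsWithin_le_nhds hmem] with z hz
    rw [OmegaOf_of_lt hz, hr, hrd, zpow_ofNat]
    ring
  · have e1 := tendsto_reflect_cobounded (l := deriv ω) hdω.continuous.continuousAt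
    have e2 := tendsto_reflect_cobounded (l := Φ)
      (hΦ.differentiableAt (isOpen_disk.mem_nhds h0)).continuousAt
    refine ((e1.mul e2).neg.isBigO_one ℂ).congr' ?_ EventuallyEq.rfl
    filter_upwards [tendsto_norm_cobounded_atTop.eventually_gt_atTop 1] with ζ hζ
    exact (OmegaOf_of_gt hζ).symm

end Potentials

/-! ### A single displacement arc -/

section SingleArc

variable {A : ArcSystem 1} {κ : ℝ} {f : ℂ → ℂ}

/-- The general solution for a single arc without a pole at the origin. -/
def oneArc (A : ArcSystem 1) (κ : ℝ) (f : ℂ → ℂ) (C₀ C₁ ζ : ℂ) : ℂ :=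
  Omega0 A κ f ζ + X0 A κ ζ * (C₀ + C₁ * ζ)

theorem X0_single (A : ArcSystem 1) (κ : ℝ) (ζ : ℂ) :
    X0 A κ ζ = arcFactor κ (A.start 0) (A.finish 0) ζ := by
  simp [X0]

theorem laurentSum_zero_one (C : ℤ → ℂ) (ζ : ℂ) : laurentSum C 0 1 ζ = C 0 + C 1 * ζ := by
  have : Finset.Icc (-((0 : ℕ) : ℤ)) ((1 : ℕ) : ℤ) = {0, 1} := by decide
  rw [laurentSum, this, Finset.sum_pair (by decide)]
  simp

theorem mem_domain_of_le_one {N : ℕ} (hN : N ≤ 1) {ζ : ℂ} : ζ ∈ domain N ↔ ‖ζ‖ ≠ 1 :=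
  ⟨fun h => h.1, fun h => ⟨h, Or.inr hN⟩⟩

theorem solution_iff_oneArc (hκ : 1 < κ) (hf : HolderOnArcs A f) {N : ℕ} (hN : N ≤ 1)
    (Ω : ℂ → ℂ) : (SectionallyHolomorphic N Ω ∧ BoundaryConditions A κ f Ω) ↔
      ∃ C₀ C₁ : ℂ, ∀ ζ : ℂ, ‖ζ‖ ≠ 1 → Ω ζ = oneArc A κ f C₀ C₁ ζ := by
  rw [solution_iff hκ hf]
  have h0 : N - 1 = 0 := by omega
  simp only [h0, laurentSum_zero_one, mem_domain_of_le_one hN]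
  constructor
  · rintro ⟨C, h⟩
    exact ⟨C 0, C 1, h⟩
  · rintro ⟨C₀, C₁, h⟩
    refine ⟨fun j => if j = 0 then C₀ else C₁, fun ζ hζ => ?_⟩
    simpa [oneArc] using h ζ hζ

theorem oneArc_eq (hκ : 1 < κ) (C₀ C₁ ζ : ℂ) : oneArc A κ f C₀ C₁ ζ = X0 A κ ζ *
    ((2 * Real.pi * I)⁻¹ * cauchyT (density A κ f) ζ + (C₀ + C₁ * ζ)) := by
  rw [oneArc, Omega0_eq hκ]
  ring

theorem pt_mem_gammaS (A : ArcSystem 1) {φ : ℝ}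
    (hφ : φ ∈ Set.Ioo (A.finish 0) (A.start 0 + 2 * Real.pi)) : pt φ ∈ A.gammaS := by
  have h1 : pt φ ∉ A.gammaU ∪ A.ends := by
    rw [A.gammaU_union_ends, Set.mem_iUnion]
    rintro ⟨k, ψ, hψ, h⟩
    rw [Subsingleton.elim k 0] at hψ
    have := eq_of_pt_eq_pt h (by linarith [hψ.2, hφ.1, Real.pi_pos]) (by linarith [hψ.1, hφ.2])
    linarith [hψ.2, hφ.1]
  exact ⟨norm_pt φ, fun h => h1 (Or.inl h), fun h => h1 (Or.inr h)⟩

theorem pt_mem_gammaU (A : ArcSystem 1) {φ : ℝ} (hφ : φ ∈ Set.Ioo (A.start 0) (A.finish 0)) :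
    pt φ ∈ A.gammaU := ⟨0, φ, hφ, rfl⟩

theorem density_of_eq_zero {t : ℂ} (h : f t = 0) : density A κ f t = 0 := by
  rw [density, h, zero_mul]

/-- The integrand `F(t) dt / t²` in the angle. -/
def kern (F : ℂ → ℂ) (ζ : ℂ) : ℂ := F ζ / ζ ^ 2 * (I * ζ)

theorem norm_kern (F : ℂ → ℂ) {ζ : ℂ} (hζ : ζ ≠ 0) : ‖kern F ζ‖ = ‖F ζ‖ * ‖ζ‖⁻¹ := by
  have : kern F ζ = F ζ * (I * ζ⁻¹) := by
    rw [kern]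
    field_simp
  rw [this, norm_mul, norm_mul, norm_I, one_mul, norm_inv]

/-- An integrable bound of order `-1/2` at both end points. -/
def endWeight (A : ArcSystem 1) (φ : ℝ) : ℝ :=
  ‖pt φ - pt (A.start 0)‖ ^ (-(1 / 2) : ℝ) * ‖pt φ - pt (A.finish 0)‖ ^ (-(1 / 2) : ℝ)

theorem endWeight_nonneg (A : ArcSystem 1) (φ : ℝ) : 0 ≤ endWeight A φ := by
  unfold endWeight
  positivity

/-- With `m` half the distance of the end points, every point is at least `m` away from one of them.
So one factor is at most `m ^ (-1/2)` and the sum of the two singularities dominates. -/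
theorem intervalIntegrable_endWeight (A : ArcSystem 1) (a b : ℝ) :
    IntervalIntegrable (endWeight A) MeasureTheory.volume a b := by
  have hne := pt_ne_pt (A.start_lt_finish 0) (A.finish_lt 0)
  have hm : 0 < ‖pt (A.start 0) - pt (A.finish 0)‖ / 2 :=
    half_pos (norm_pos_iff.2 (sub_ne_zero.2 hne))
  set m := ‖pt (A.start 0) - pt (A.finish 0)‖ / 2 with hmdef
  have hint : ∀ ψ, IntervalIntegrable (fun φ : ℝ => ‖pt φ - pt ψ‖ ^ (-(1 / 2) : ℝ))
      MeasureTheory.volume a b := fun ψ =>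
    intervalIntegrable_norm_pt_sub_rpow (by norm_num) (by norm_num) (norm_pt ψ) a b
  refine (((hint (A.start 0)).add (hint (A.finish 0))).const_mul (m ^ (-(1 / 2) : ℝ))).mono_fun
    ?_ ?_
  · have h1 := continuous_pt.measurable
    have : Measurable (endWeight A) := by
      unfold endWeight
      fun_prop
    exact this.aestronglyMeasurable
  · refine Eventually.of_forall fun φ => ?_
    have p1 : 0 ≤ ‖pt φ - pt (A.start 0)‖ ^ (-(1 / 2) : ℝ) := by positivity
    have p2 : 0 ≤ ‖pt φ - pt (A.finish 0)‖ ^ (-(1 / 2) : ℝ) := by positivity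
    have p3 : 0 ≤ m ^ (-(1 / 2) : ℝ) := by positivity
    beta_reduce
    rw [Real.norm_of_nonneg (endWeight_nonneg A φ), Real.norm_of_nonneg (by positivity), endWeight]
    have htri : 2 * m ≤ ‖pt φ - pt (A.start 0)‖ + ‖pt φ - pt (A.finish 0)‖ := by
      have h1 : pt (A.start 0) - pt (A.finish 0) =
        (pt φ - pt (A.finish 0)) - (pt φ - pt (A.start 0)) := by ring
      have h2 := norm_sub_le (pt φ - pt (A.finish 0)) (pt φ - pt (A.start 0))
      rw [← h1] at h2
      rw [hmdef]
      linarith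
    by_cases hA : m ≤ ‖pt φ - pt (A.start 0)‖
    · have h1 := Real.rpow_le_rpow_of_nonpos hm hA (by norm_num : (-(1 / 2) : ℝ) ≤ 0)
      have h2 := mul_le_mul_of_nonneg_right h1 p2
      nlinarith [mul_nonneg p3 p1]
    · have hB : m ≤ ‖pt φ - pt (A.finish 0)‖ := by linarith
      have h1 := Real.rpow_le_rpow_of_nonpos hm hB (by norm_num : (-(1 / 2) : ℝ) ≤ 0)
      have h2 := mul_le_mul_of_nonneg_left h1 p1
      nlinarith [mul_nonneg p3 p2]

theorem pt_ne_ends {φ : ℝ} (hφ : pt φ ∉ A.ends) :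
    pt φ ≠ pt (A.start 0) ∧ pt φ ≠ pt (A.finish 0) :=
  ⟨fun h => hφ ⟨0, Or.inl h⟩, fun h => hφ ⟨0, Or.inr h⟩⟩

/-- Moving radially off the circle cannot bring the point much closer to an end point. The bound is
uniform in `r`, as a passage to the limit `r → 1` under the integral needs. -/
theorem norm_X0_le (hκ : 1 < κ) {φ : ℝ} (hφ : pt φ ∉ A.ends) {r : ℝ} (hr : 0 < r) :
    ‖X0 A κ (r * pt φ)‖ ≤ 4 * κ * endWeight A φ := by
  have hr0 : (r : ℂ) * pt φ ≠ 0 := mul_ne_zero (ofReal_ne_zero.2 hr.ne') (pt_ne_zero φ)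
  have hnorm : ‖(r : ℂ) * pt φ‖ = r := by
    rw [norm_mul, norm_pt, mul_one, norm_real, Real.norm_of_nonneg hr.le]
  have hdir : (r : ℂ) * pt φ / (‖(r : ℂ) * pt φ‖ : ℂ) = pt φ := by
    rw [hnorm, mul_div_cancel_left₀ _ (ofReal_ne_zero.2 hr.ne')]
  have hle : ∀ ψ, ‖pt φ - pt ψ‖ ≤ 2 * ‖r * pt φ - pt ψ‖ := by
    intro ψ
    have := norm_sub_direction_le (norm_pt ψ) hr0
    rwa [hdir, norm_sub_rev, norm_sub_rev (pt ψ)] at this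
  have hpow : ∀ ψ, pt φ ≠ pt ψ → ‖r * pt φ - pt ψ‖ ^ (-(1 / 2) : ℝ) ≤
      2 * ‖pt φ - pt ψ‖ ^ (-(1 / 2) : ℝ) := by
    intro ψ hne
    have hpos : 0 < ‖pt φ - pt ψ‖ := norm_pos_iff.2 (sub_ne_zero.2 hne)
    -- The constant `4`, weaker than the available `2`, has an integral square root.
    have h1 : ‖pt φ - pt ψ‖ / 4 ≤ ‖r * pt φ - pt ψ‖ := by linarith [hle ψ]
    refine (Real.rpow_le_rpow_of_nonpos (by positivity) h1 (by norm_num)).trans_eq ?_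
    rw [Real.div_rpow hpos.le (by norm_num), show (4 : ℝ) = 2 ^ (2 : ℝ) by norm_num,
      ← Real.rpow_mul (by norm_num), show (2 : ℝ) * -(1 / 2) = -1 by norm_num, Real.rpow_neg_one,
      div_inv_eq_mul, mul_comm]
  obtain ⟨ha, hb⟩ := pt_ne_ends hφ
  have hne : ∀ ψ, pt φ ≠ pt ψ → (r : ℂ) * pt φ ≠ pt ψ := by
    intro ψ h hc
    have := hle ψ
    rw [hc, sub_self, norm_zero, mul_zero] at this
    exact h (sub_eq_zero.1 (norm_le_zero_iff.1 this))
  rw [X0_single]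
  refine (norm_arcFactor_le hκ (A.start_lt_finish 0) (A.finish_lt 0) (hne _ ha) (hne _ hb)).1.trans
    ?_
  have h1 := mul_le_mul (hpow _ ha) (hpow _ hb) (by positivity) (by positivity)
  have h2 := mul_le_mul_of_nonneg_left h1 (by linarith : (0 : ℝ) ≤ κ)
  refine h2.trans_eq ?_
  rw [endWeight]
  ring

theorem norm_ofReal_mul_pt {r : ℝ} (hr : 0 < r) (φ : ℝ) : ‖(r : ℂ) * pt φ‖ = r := by
  rw [norm_mul, norm_pt, mul_one, norm_real, Real.norm_of_nonneg hr.le]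

/-- The range `1/2 ≤ r ≤ 2` is stable under `r ↦ 1/r`, so one majorant serves the limits from both
sides of the circle. -/
theorem exists_norm_kern_oneArc_le (hκ : 1 < κ) (hf : HolderOnArcs A f) (C₀ C₁ : ℂ) :
    ∃ B : ℝ, 0 ≤ B ∧ ∀ (φ r : ℝ), pt φ ∉ A.ends → 1 / 2 ≤ r → r ≤ 2 → r ≠ 1 →
      ‖kern (oneArc A κ f C₀ C₁) (r * pt φ)‖ ≤ B * endWeight A φ := by
  obtain ⟨B, hB, hbd⟩ := (circleHolder_density hκ hf).bounded_cauchyT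
  refine ⟨4 * κ * (‖((2 * Real.pi * I)⁻¹ : ℂ)‖ * B + (‖C₀‖ + ‖C₁‖ * 2)) * 2, by positivity,
    fun φ r hφ h1 h2 h3 => ?_⟩
  have hr : 0 < r := by linarith
  have hn := norm_ofReal_mul_pt hr φ
  have hζ : (r : ℂ) * pt φ ≠ 0 := norm_pos_iff.1 (by rw [hn]; exact hr)
  rw [norm_kern _ hζ, oneArc_eq hκ, norm_mul, hn]
  have e1 := norm_X0_le hκ hφ hr
  have e2 : ‖(2 * Real.pi * I)⁻¹ * cauchyT (density A κ f) (r * pt φ) + (C₀ + C₁ * (r * pt φ))‖ ≤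
      ‖((2 * Real.pi * I)⁻¹ : ℂ)‖ * B + (‖C₀‖ + ‖C₁‖ * 2) := by
    refine (norm_add_le _ _).trans (add_le_add ?_ ((norm_add_le _ _).trans ?_))
    · rw [norm_mul]
      gcongr
      exact hbd _ hζ (by rwa [hn])
    · rw [norm_mul C₁, hn]
      gcongr
  have e3 : r⁻¹ ≤ 2 := by
    rw [inv_le_comm₀ hr two_pos]
    linarith
  have e4 := endWeight_nonneg A φ
  have e5 : 0 ≤ 4 * κ * endWeight A φ := by
    have : 0 < κ := by linarith
    positivity
  have e6 := mul_le_mul (mul_le_mul e1 e2 (norm_nonneg _) e5) e3 (by positivity)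
    (by positivity)
  refine e6.trans_eq ?_
  ring

theorem Omega0_pt (hκ : 1 < κ) (hf0 : ∀ t ∈ A.gammaS, f t = 0) {t : ℂ} (ht : t ∈ A.gammaS) :
    Omega0 A κ f t = X0 A κ t * ((2 * Real.pi * I)⁻¹ * cauchyK (density A κ f) t) := by
  rw [Omega0_eq hκ, cauchyT_eq_cauchyK_of_eq_zero ht.1 (density_of_eq_zero (hf0 t ht))]

theorem finish_lt_start_add_two_pi (A : ArcSystem 1) : A.finish 0 ≤ A.start 0 + 2 * Real.pi :=
  (A.finish_lt 0).le

/-- Integrability over the traction arc of a continuous function with weak singularities. -/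
theorem integrableS_of_le {F : ℂ → ℂ} {B : ℝ}
    (hc : ∀ t ∈ A.gammaS, ContinuousWithinAt F A.gammaS t)
    (hb : ∀ φ, pt φ ∈ A.gammaS → ‖F (pt φ)‖ ≤ B * endWeight A φ) : IntegrableS A F := by
  rw [IntegrableS, intervalIntegrable_iff_integrableOn_Ioo_of_le (finish_lt_start_add_two_pi A)]
  have hcont : ContinuousOn (fun φ : ℝ => F (pt φ) * (I * pt φ))
      (Set.Ioo (A.finish 0) (A.start 0 + 2 * Real.pi)) := by
    have h1 : ContinuousOn F A.gammaS := hc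
    exact (h1.comp continuous_pt.continuousOn fun φ hφ => pt_mem_gammaS A hφ).mul
      (continuous_const.mul continuous_pt).continuousOn
  have hint : MeasureTheory.IntegrableOn (fun φ => B * endWeight A φ)
      (Set.Ioo (A.finish 0) (A.start 0 + 2 * Real.pi)) := by
    rw [← intervalIntegrable_iff_integrableOn_Ioo_of_le (finish_lt_start_add_two_pi A)]
    exact (intervalIntegrable_endWeight A _ _).const_mul B
  refine MeasureTheory.Integrable.mono' hint (hcont.aestronglyMeasurable measurableSet_Ioo) ?_
  rw [MeasureTheory.ae_restrict_iff' measurableSet_Ioo]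
  refine Eventually.of_forall fun φ hφ => ?_
  rw [norm_mul, norm_mul, norm_I, norm_pt, mul_one, mul_one]
  exact hb φ (pt_mem_gammaS A hφ)

theorem norm_X0_pt_le (hκ : 1 < κ) {φ : ℝ} (hφ : pt φ ∉ A.ends) :
    ‖X0 A κ (pt φ)‖ ≤ 4 * κ * endWeight A φ := by
  have := norm_X0_le hκ hφ one_pos
  rwa [ofReal_one, one_mul] at this

theorem integrableS_X0_mul (hκ : 1 < κ) {W : ℂ → ℂ} {B : ℝ} (hB : ∀ t, ‖t‖ = 1 → ‖W t‖ ≤ B)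
    (hW : ∀ t, ‖t‖ = 1 → ContinuousAt W t) {F : ℂ → ℂ}
    (hF : ∀ t ∈ A.gammaS, F t = X0 A κ t * W t / t ^ 2) : IntegrableS A F := by
  have ht0 : ∀ t : ℂ, ‖t‖ = 1 → t ≠ 0 := fun t ht =>
    norm_pos_iff.1 (by rw [ht]; exact one_pos)
  refine integrableS_of_le (B := 4 * κ * B) (fun t ht => ?_) fun φ hφ => ?_
  · have h1 : ContinuousAt (fun t => X0 A κ t * W t / t ^ 2) t :=
      ((continuousAt_X0_of_mem_gammaS A κ ht).mul (hW t ht.1)).div (by fun_prop)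
        (pow_ne_zero _ (ht0 t ht.1))
    exact h1.continuousWithinAt.congr hF (hF t ht)
  · rw [hF _ hφ, norm_div, norm_mul, norm_pow, norm_pt, one_pow, div_one]
    have e1 := norm_X0_pt_le hκ hφ.2.2
    have e2 := hB _ (norm_pt φ)
    have e3 : 0 ≤ 4 * κ * endWeight A φ := (norm_nonneg _).trans e1
    refine (mul_le_mul e1 e2 (norm_nonneg _) e3).trans_eq ?_
    ring

theorem integrableS_Omega0 (hκ : 1 < κ) (hf : HolderOnArcs A f)
    (hf0 : ∀ t ∈ A.gammaS, f t = 0) : IntegrableS A (fun t => Omega0 A κ f t / t ^ 2) := by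
  have hg := circleHolder_density hκ hf
  obtain ⟨B, hB, hbd⟩ := hg.bounded_cauchyK
  have ht0 : ∀ t : ℂ, ‖t‖ = 1 → t ≠ 0 := fun t ht =>
    norm_pos_iff.1 (by rw [ht]; exact one_pos)
  refine integrableS_X0_mul hκ (W := fun t => (2 * Real.pi * I)⁻¹ * cauchyK (density A κ f) t)
    (B := ‖((2 * Real.pi * I)⁻¹ : ℂ)‖ * B) (fun t ht => ?_) (fun t ht => ?_) fun t ht => ?_
  · rw [norm_mul]
    have := hbd t (ht0 t ht)
    gcongr
  · exact (hg.continuousAt_cauchyK (ht0 t ht)).const_mul _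
  · rw [Omega0_pt hκ hf0 ht]

theorem integrableS_X0 (hκ : 1 < κ) (C₀ C₁ : ℂ) :
    IntegrableS A (fun t => X0 A κ t * (C₀ + C₁ * t) / t ^ 2) := by
  refine integrableS_X0_mul hκ (W := fun t => C₀ + C₁ * t) (B := ‖C₀‖ + ‖C₁‖)
    (fun t ht => ?_) (fun t _ => by fun_prop) fun t _ => rfl
  refine (norm_add_le _ _).trans ?_
  rw [norm_mul, ht, mul_one]

theorem differentiableAt_oneArc (hκ : 1 < κ) (hf : HolderOnArcs A f) (C₀ C₁ : ℂ) {ζ : ℂ}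
    (hζ : ‖ζ‖ ≠ 1) : DifferentiableAt ℂ (oneArc A κ f C₀ C₁) ζ :=
  (differentiableAt_Omega0 hκ hf hζ).add
    ((differentiableAt_X0 A κ (A.notMem_of_norm_ne_one hζ)).mul (by fun_prop))

/-- Since `ζ X₀ → 1` and `Ω₀ → 0`, the constant `C₁` is the value of the solution at infinity. -/
theorem tendsto_oneArc_cobounded (hκ : 1 < κ) (hf : HolderOnArcs A f) (C₀ C₁ : ℂ) :
    Tendsto (oneArc A κ f C₀ C₁) (cobounded ℂ) (𝓝 C₁) := by
  have h1 := tendsto_pow_mul_X0 A κ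
  have h2 : Tendsto (fun ζ : ℂ => C₀ * ζ⁻¹ + C₁) (cobounded ℂ) (𝓝 (C₀ * 0 + C₁)) :=
    (tendsto_inv₀_cobounded.const_mul C₀).add_const C₁
  have h3 := (tendsto_Omega0_cobounded hκ hf).add (h1.mul h2)
  rw [mul_zero, zero_add, one_mul, zero_add] at h3
  refine h3.congr' ?_
  filter_upwards [eventually_ne_cobounded (0 : ℂ)] with ζ hζ
  rw [oneArc, pow_one]
  field_simp

/-! ### Contour integrals of `Ω dt / t²` -/

theorem circleIntegral_eq_integral_radius (F : ℂ → ℂ) (r s : ℝ) :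
    ∮ t in C(0, r), F t = ∫ φ in s..s + 2 * Real.pi, F (r * pt φ) * (I * (r * pt φ)) := by
  have hp : Function.Periodic (fun φ : ℝ => F (r * pt φ) * (I * (r * pt φ))) (2 * Real.pi) := by
    intro φ
    simp only [pt_add_two_pi]
  rw [hp.intervalIntegral_add_eq s 0, zero_add, circleIntegral]
  refine intervalIntegral.integral_congr fun φ _ => ?_
  have : circleMap 0 r φ = r * pt φ := by simp [circleMap, pt]
  simp only [deriv_circleMap, this, smul_eq_mul]
  ring

theorem integral_kern_of_lt {Ω : ℂ → ℂ} (hd : ∀ ζ, ‖ζ‖ < 1 → DifferentiableAt ℂ Ω ζ) {r : ℝ}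
    (hr : 0 < r) (hr1 : r < 1) (s : ℝ) :
    ∫ φ in s..s + 2 * Real.pi, kern Ω (r * pt φ) = 2 * Real.pi * I * deriv Ω 0 := by
  have h1 := circleIntegral_eq_integral_radius (fun t => Ω t / t ^ 2) r s
  have h2 := two_pi_I_inv_smul_circleIntegral_sub_sq_inv_smul_of_differentiable (f := Ω)
    isOpen_disk (c := 0) (w₀ := 0) (R := r) (fun z hz => by
      have : ‖z‖ ≤ r := by simpa using hz
      exact this.trans_lt hr1) (fun z hz => (hd z hz).differentiableWithinAt)
    (Metric.mem_ball_self hr)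
  have hpi : (2 * Real.pi * I : ℂ) ≠ 0 := by simp [Real.pi_ne_zero]
  change ∮ t in C(0, r), Ω t / t ^ 2 = ∫ φ in s..s + 2 * Real.pi, kern Ω (r * pt φ) at h1
  rw [← h1, ← h2, smul_eq_mul, mul_inv_cancel_left₀ hpi]
  congr 1
  ext z
  rw [sub_zero, smul_eq_mul, div_eq_mul_inv, mul_comm]

/-- The contour can be moved to infinity, where `Ω / t ^ 2` is of order `R ^ (-2)` on a circle of
length `2πR`. -/
theorem integral_kern_of_gt {Ω : ℂ → ℂ} (hd : ∀ ζ, 1 < ‖ζ‖ → DifferentiableAt ℂ Ω ζ)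
    (hO : Ω =O[cobounded ℂ] fun _ => (1 : ℂ)) {r : ℝ} (hr : 1 < r) (s : ℝ) :
    ∫ φ in s..s + 2 * Real.pi, kern Ω (r * pt φ) = 0 := by
  have h1 : ∀ R : ℝ, ∮ t in C(0, R), Ω t / t ^ 2 =
      ∫ φ in s..s + 2 * Real.pi, kern Ω (R * pt φ) := fun R =>
    circleIntegral_eq_integral_radius (fun t => Ω t / t ^ 2) R s
  rw [← h1]
  have hdk : ∀ ζ, 1 < ‖ζ‖ → DifferentiableAt ℂ (fun t => Ω t / t ^ 2) ζ := fun ζ hζ =>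
    (hd ζ hζ).div (by fun_prop) (pow_ne_zero _ (norm_pos_iff.1 (by linarith)))
  have hconst : ∀ R, r ≤ R → ∮ t in C(0, R), Ω t / t ^ 2 = ∮ t in C(0, r), Ω t / t ^ 2 := by
    intro R hR
    refine circleIntegral_eq_of_differentiable_on_annulus_off_countable (by linarith) hR
      Set.countable_empty (fun z hz => ?_) fun z hz => hdk z ?_
    · have : r ≤ ‖z‖ := by simpa using hz.2
      exact (hdk z (by linarith)).continuousAt.continuousWithinAt
    · have : r < ‖z‖ := by simpa using hz.1.2
      linarith
  obtain ⟨B, hB⟩ := hO.bound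
  have hlim : Tendsto (fun R : ℝ => 2 * Real.pi * (|B| / R)) atTop (𝓝 0) := by
    simpa using (tendsto_const_nhds.div_atTop tendsto_id).const_mul (2 * Real.pi)
  have hsq : Tendsto (fun R : ℝ => ∮ t in C(0, R), Ω t / t ^ 2) atTop (𝓝 0) := by
    refine squeeze_zero_norm' ?_ hlim
    obtain ⟨R₀, hR₀⟩ := (hasBasis_cobounded_norm.eventually_iff).1 hB
    filter_upwards [eventually_ge_atTop (max R₀ 1)] with R hR
    have hR0 : R₀ ≤ R := (le_max_left _ _).trans hR
    have hR1 : 1 ≤ R := (le_max_right _ _).trans hR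
    refine (circleIntegral.norm_integral_le_of_norm_le_const (C := |B| / R ^ 2) (by linarith)
      fun z hz => ?_).trans_eq ?_
    · have hz' : ‖z‖ = R := by simpa using hz
      have h2 := hR₀.2 (show z ∈ {x : ℂ | R₀ ≤ ‖x‖} by rw [← hz'] at hR0; exact hR0)
      rw [norm_one, mul_one] at h2
      rw [norm_div, norm_pow, hz']
      gcongr
      exact h2.trans (le_abs_self B)
    · field_simp
  refine tendsto_nhds_unique (tendsto_const_nhds.congr' ?_) hsq
  filter_upwards [eventually_ge_atTop r] with R hR using (hconst R hR).symm

end SingleArc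

/-! ### The linear system for the constants -/

section LinearSystem

variable {A : ArcSystem 1} {κ : ℝ} {f : ℂ → ℂ}

theorem tendsto_kern {Ω : ℂ → ℂ} {l : Filter ℂ} {t p : ℂ} (ht : t ≠ 0) (hl : l ≤ 𝓝 t)
    (h : Tendsto Ω l (𝓝 p)) : Tendsto (kern Ω) l (𝓝 (p / t ^ 2 * (I * t))) := by
  have h1 : Tendsto (fun ζ : ℂ => ζ) l (𝓝 t) := hl
  exact (h.div (h1.pow 2) (pow_ne_zero 2 ht)).mul (h1.const_mul I)

theorem tendsto_radial_disk (φ : ℝ) :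
    Tendsto (fun r : ℝ => (r : ℂ) * pt φ) (𝓝[<] 1) (𝓝[disk] (pt φ)) := by
  refine tendsto_nhdsWithin_iff.2 ⟨?_, ?_⟩
  · have h : Continuous fun r : ℝ => (r : ℂ) * pt φ := by fun_prop
    have := (h.tendsto 1).mono_left (nhdsWithin_le_nhds (s := Set.Iio 1))
    rwa [ofReal_one, one_mul] at this
  · filter_upwards [self_mem_nhdsWithin, nhdsWithin_le_nhds (lt_mem_nhds one_pos)] with r hr hr0
    change ‖(r : ℂ) * pt φ‖ < 1
    rw [norm_ofReal_mul_pt hr0]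
    exact hr

theorem tendsto_radial_exterior (φ : ℝ) :
    Tendsto (fun r : ℝ => ((r⁻¹ : ℝ) : ℂ) * pt φ) (𝓝[<] 1) (𝓝[exterior] (pt φ)) := by
  refine tendsto_nhdsWithin_iff.2 ⟨?_, ?_⟩
  · have h1 : ContinuousAt (fun r : ℝ => r⁻¹) 1 := continuousAt_inv₀ one_ne_zero
    have h : ContinuousAt (fun r : ℝ => ((r⁻¹ : ℝ) : ℂ) * pt φ) 1 :=
      (continuous_ofReal.continuousAt.comp h1).mul continuousAt_const
    have := h.tendsto.mono_left (nhdsWithin_le_nhds (s := Set.Iio 1))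
    rwa [inv_one, ofReal_one, one_mul] at this
  · filter_upwards [self_mem_nhdsWithin, nhdsWithin_le_nhds (lt_mem_nhds one_pos)] with r hr hr0
    change 1 < ‖((r⁻¹ : ℝ) : ℂ) * pt φ‖
    rw [norm_ofReal_mul_pt (inv_pos.2 hr0)]
    exact (one_lt_inv₀ hr0).2 hr

theorem tendsto_oneArc_of_mem_gammaS (hκ : 1 < κ) (hf : HolderOnArcs A f)
    (hf0 : ∀ t ∈ A.gammaS, f t = 0) (C₀ C₁ : ℂ) {t : ℂ} (ht : t ∈ A.gammaS) :
    Tendsto (oneArc A κ f C₀ C₁) (𝓝[disk] t) (𝓝 (oneArc A κ f C₀ C₁ t)) ∧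
      Tendsto (oneArc A κ f C₀ C₁) (𝓝[exterior] t) (𝓝 (oneArc A κ f C₀ C₁ t)) := by
  have hg := circleHolder_density hκ hf
  have hX := (continuousAt_X0_of_mem_gammaS A κ ht).tendsto
  have hp : Tendsto (fun ζ => C₀ + C₁ * ζ) (𝓝 t) (𝓝 (C₀ + C₁ * t)) :=
    Continuous.tendsto (by fun_prop) t
  have h1 := hg.tendsto_cauchyT_disk ht.1
  rw [density_of_eq_zero (hf0 t ht), mul_zero, add_zero] at h1
  have hval : oneArc A κ f C₀ C₁ t = X0 A κ t *
      ((2 * Real.pi * I)⁻¹ * cauchyK (density A κ f) t + (C₀ + C₁ * t)) := by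
    rw [oneArc, Omega0_pt hκ hf0 ht]
    ring
  rw [hval]
  constructor
  · refine ((hX.mono_left nhdsWithin_le_nhds).mul
      ((h1.const_mul _).add (hp.mono_left nhdsWithin_le_nhds))).congr fun ζ => ?_
    rw [oneArc_eq hκ]
  · refine ((hX.mono_left nhdsWithin_le_nhds).mul
      (((hg.tendsto_cauchyT_exterior ht.1).const_mul _).add
        (hp.mono_left nhdsWithin_le_nhds))).congr fun ζ => ?_
    rw [oneArc_eq hκ]

theorem continuousOn_comp_pt (hf : HolderOnArcs A f) :
    ContinuousOn (fun φ => f (pt φ)) (Set.Ioo (A.start 0) (A.finish 0)) := by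
  obtain ⟨ε, hε, K, h⟩ := hf
  have hE : ∀ φ ∈ Set.Ioo (A.start 0) (A.finish 0), pt φ ∉ A.ends := fun φ hφ =>
    A.notMem_ends_of_mem_gammaU (pt_mem_gammaU A hφ)
  have hle : ∀ φ ∈ Set.Ioo (A.start 0) (A.finish 0), ∀ ψ ∈ Set.Ioo (A.start 0) (A.finish 0),
      ‖f (pt φ) - f (pt ψ)‖ ≤ K * |φ - ψ| ^ ε := by
    intro φ hφ ψ hψ
    rcases le_total φ ψ with hl | hl
    · rw [norm_sub_rev, abs_sub_comm, abs_of_nonneg (sub_nonneg.2 hl)]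
      exact h φ ψ hl fun r hr => hE r ⟨hφ.1.trans_le hr.1, hr.2.trans_lt hψ.2⟩
    · rw [abs_of_nonneg (sub_nonneg.2 hl)]
      exact h ψ φ hl fun r hr => hE r ⟨hψ.1.trans_le hr.1, hr.2.trans_lt hφ.2⟩
  intro ψ hψ
  rw [ContinuousWithinAt, tendsto_iff_norm_sub_tendsto_zero]
  have hlim : Tendsto (fun φ : ℝ => K * |φ - ψ| ^ ε)
      (𝓝[Set.Ioo (A.start 0) (A.finish 0)] ψ) (𝓝 0) := by
    have hc : Continuous fun φ : ℝ => K * |φ - ψ| ^ ε :=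
      continuous_const.mul (Continuous.rpow_const (by fun_prop) fun _ => Or.inr hε.le)
    have := (hc.tendsto ψ).mono_left
      (nhdsWithin_le_nhds (s := Set.Ioo (A.start 0) (A.finish 0)))
    simpa [Real.zero_rpow hε.ne'] using this
  refine squeeze_zero' (Eventually.of_forall fun _ => norm_nonneg _) ?_ hlim
  filter_upwards [self_mem_nhdsWithin] with φ hφ using hle φ hφ ψ hψ

theorem intervalIntegrable_kern (hf : HolderOnArcs A f) :
    IntervalIntegrable (fun φ => kern f (pt φ)) MeasureTheory.volume (A.start 0) (A.finish 0) := by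
  have hlt := A.start_lt_finish 0
  obtain ⟨M, hM, hb⟩ := hf.exists_norm_le
  rw [intervalIntegrable_iff_integrableOn_Ioo_of_le hlt.le]
  have hc : ContinuousOn (fun φ => kern f (pt φ)) (Set.Ioo (A.start 0) (A.finish 0)) :=
    ((continuousOn_comp_pt hf).div (continuous_pt.pow 2).continuousOn
      fun φ _ => pow_ne_zero _ (pt_ne_zero φ)).mul (continuous_const.mul continuous_pt).continuousOn
  have hconst : MeasureTheory.IntegrableOn (fun _ : ℝ => M)
      (Set.Ioo (A.start 0) (A.finish 0)) := by
    rw [← intervalIntegrable_iff_integrableOn_Ioo_of_le hlt.le]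
    exact intervalIntegrable_const
  refine MeasureTheory.Integrable.mono' hconst (hc.aestronglyMeasurable measurableSet_Ioo) ?_
  refine Eventually.of_forall fun φ => ?_
  rw [norm_kern f (pt_ne_zero φ), norm_pt, inv_one, mul_one]
  exact hb _ (norm_pt φ)

/-- The integral of the data over the displacement arc. -/
theorem integral_kern_displacement (hf : HolderOnArcs A f) {μ : ℝ} {u u' : ℝ → ℂ}
    (hu : ContinuousOn u (Set.Icc (A.start 0) (A.finish 0)))
    (hu' : ∀ φ ∈ Set.Ioo (A.start 0) (A.finish 0), HasDerivAt u (u' φ) φ ∧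
      f (pt φ) = -2 * μ * I * pt φ * conj (u' φ)) :
    ∫ φ in A.start 0..A.finish 0, kern f (pt φ) =
      2 * μ * (conj (u (A.finish 0)) - conj (u (A.start 0))) := by
  have h := intervalIntegral.integral_eq_sub_of_hasDerivAt_of_le (A.start_lt_finish 0).le
    (f := fun φ => 2 * μ * conj (u φ)) (f' := fun φ => kern f (pt φ))
    (continuousOn_const.mul (continuous_conj.comp_continuousOn hu)) (fun φ hφ => ?_)
    (intervalIntegrable_kern hf)
  · rw [h]
    ring
  · obtain ⟨h1, h2⟩ := hu' φ hφ
    -- The factor `-2μi t` in `f` meets `dt/t² = (i/t) dφ`, which leaves `2μ conj (u')`.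
    refine (h1.star.const_mul (2 * μ : ℂ)).congr_deriv ?_
    have h0 := pt_ne_zero φ
    rw [kern, h2]
    change 2 * (μ : ℂ) * conj (u' φ) = _
    field_simp
    linear_combination ((μ : ℂ) * conj (u' φ)) * I_sq

/-- The contour integrals on both sides of the circle combine to the derivative at the origin. -/
theorem integral_boundary_eq_deriv (hκ : 1 < κ) (hf : HolderOnArcs A f)
    (hf0 : ∀ t ∈ A.gammaS, f t = 0) (C₀ C₁ : ℂ) :
    (∫ φ in A.start 0..A.finish 0, kern f (pt φ)) +
      (κ + 1) * ∫ φ in A.finish 0..A.start 0 + 2 * Real.pi, kern (oneArc A κ f C₀ C₁) (pt φ) =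
    2 * Real.pi * I * deriv (oneArc A κ f C₀ C₁) 0 := by
  set Ω := oneArc A κ f C₀ C₁ with hΩ
  set s := A.start 0
  set e := A.finish 0
  have hse : s < e := A.start_lt_finish 0
  have hes : e < s + 2 * Real.pi := A.finish_lt 0
  have hd : ∀ ζ, ‖ζ‖ ≠ 1 → DifferentiableAt ℂ Ω ζ := fun ζ hζ =>
    differentiableAt_oneArc hκ hf C₀ C₁ hζ
  have hBC : BoundaryConditions A κ f Ω :=
    boundaryConditions_Omega0_add hκ hf (R := fun ζ => C₀ + C₁ * ζ) (fun t _ => by fun_prop)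
      fun ζ _ _ => rfl
  have hcont : ∀ r : ℝ, 0 < r → r ≠ 1 → Continuous fun φ : ℝ => kern Ω (r * pt φ) := by
    intro r hr hr1
    rw [continuous_iff_continuousAt]
    intro φ
    have hn := norm_ofReal_mul_pt hr φ
    have h0 : (r * pt φ : ℂ) ≠ 0 := norm_pos_iff.1 (by rw [hn]; exact hr)
    have h1 : ContinuousAt (kern Ω) (r * pt φ) :=
      tendsto_kern h0 le_rfl (hd _ (by rwa [hn])).continuousAt
    exact ContinuousAt.comp (f := fun φ : ℝ => (r : ℂ) * pt φ) h1
      (continuousAt_const.mul continuous_pt.continuousAt)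
  obtain ⟨B, hB, hbd⟩ := exists_norm_kern_oneArc_le hκ hf C₀ C₁
  -- The limit of the inner integrand plus `κ` times the outer one: on the displacement arc `p + κ m
  -- = f`, and on the free arc both boundary values are `Ω`, which gives `κ + 1`.
  set G : ℝ → ℂ := fun φ => if φ < e then kern f (pt φ) else (κ + 1) * kern Ω (pt φ) with hG
  have hev : ∀ᶠ r : ℝ in 𝓝[<] 1, 1 / 2 < r ∧ r < 1 := by
    filter_upwards [self_mem_nhdsWithin,
      nhdsWithin_le_nhds (lt_mem_nhds (by norm_num : (1 / 2 : ℝ) < 1))] with r hr hr'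
    exact ⟨hr', hr⟩
  have hinv : ∀ r : ℝ, 1 / 2 < r → r < 1 → 1 < r⁻¹ ∧ r⁻¹ ≤ 2 := by
    intro r hr hr1
    refine ⟨(one_lt_inv₀ (by linarith)).2 hr1, ?_⟩
    rw [inv_le_comm₀ (by linarith) two_pos]
    linarith
  have hlim : Tendsto (fun r : ℝ => ∫ φ in s..s + 2 * Real.pi,
      (kern Ω (r * pt φ) + κ * kern Ω ((r⁻¹ : ℝ) * pt φ))) (𝓝[<] 1)
      (𝓝 (∫ φ in s..s + 2 * Real.pi, G φ)) := by
    refine intervalIntegral.tendsto_integral_filter_of_dominated_convergence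
      (fun φ => B * endWeight A φ + κ * (B * endWeight A φ)) ?_ ?_ ?_ ?_
    · filter_upwards [hev] with r hr
      have hr' := hinv r hr.1 hr.2
      exact ((hcont r (by linarith [hr.1]) hr.2.ne).add
        (continuous_const.mul (hcont r⁻¹ (by linarith [hr'.1]) hr'.1.ne'))).aestronglyMeasurable
    · filter_upwards [hev] with r hr
      have hr' := hinv r hr.1 hr.2
      filter_upwards [ae_pt_notMem_ends A] with φ hφ _
      refine (norm_add_le _ _).trans (add_le_add
        (hbd φ r hφ hr.1.le (by linarith [hr.2]) hr.2.ne) ?_)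
      rw [norm_mul, norm_real, Real.norm_of_nonneg (by linarith)]
      have := hbd φ r⁻¹ hφ (by linarith [hr'.1]) hr'.2 hr'.1.ne'
      gcongr
    · have := (intervalIntegrable_endWeight A s (s + 2 * Real.pi)).const_mul B
      exact this.add (this.const_mul κ)
    · filter_upwards [ae_pt_notMem_ends A] with φ hφ hmem
      rw [Set.uIoc_of_le (by linarith [Real.pi_pos])] at hmem
      obtain ⟨hφs, hφe⟩ := pt_ne_ends hφ
      have h0 := pt_ne_zero φ
      have hcomb : ∀ p m : ℂ, Tendsto Ω (𝓝[disk] (pt φ)) (𝓝 p) →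
          Tendsto Ω (𝓝[exterior] (pt φ)) (𝓝 m) →
          Tendsto (fun r : ℝ => kern Ω (r * pt φ) + κ * kern Ω ((r⁻¹ : ℝ) * pt φ)) (𝓝[<] 1)
            (𝓝 ((p + κ * m) / pt φ ^ 2 * (I * pt φ))) := by
        intro p m hp hm
        have h1 := (tendsto_kern h0 nhdsWithin_le_nhds hp).comp (tendsto_radial_disk φ)
        have h2 := (tendsto_kern h0 nhdsWithin_le_nhds hm).comp (tendsto_radial_exterior φ)
        have h3 := h1.add (h2.const_mul (κ : ℂ))
        have hv : (p + κ * m) / pt φ ^ 2 * (I * pt φ) =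
            p / pt φ ^ 2 * (I * pt φ) + κ * (m / pt φ ^ 2 * (I * pt φ)) := by ring
        rw [hv]
        exact h3
      by_cases hlt : φ < e
      · obtain ⟨p, m, h1, h2, h3⟩ := hBC.displacement (pt φ) (pt_mem_gammaU A ⟨hmem.1, hlt⟩)
        have h4 := hcomb p m h1 h2
        rw [h3] at h4
        rw [hG]
        simp only [if_pos hlt]
        exact h4
      · have hφe' : e < φ := lt_of_le_of_ne (not_lt.1 hlt) fun h => hφe (by rw [← h])
        have hφs' : φ < s + 2 * Real.pi := lt_of_le_of_ne hmem.2 fun h => hφs (by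
          rw [h, pt_add_two_pi])
        obtain ⟨h1, h2⟩ := tendsto_oneArc_of_mem_gammaS hκ hf hf0 C₀ C₁
          (pt_mem_gammaS A ⟨hφe', hφs'⟩)
        have h4 := hcomb _ _ h1 h2
        rw [hG]
        simp only [if_neg hlt]
        convert h4 using 2
        rw [kern]
        ring
  -- Before the limit the value does not depend on `r`: the inner circle gives the derivative at the
  -- origin, the outer one zero.
  have hval : ∀ᶠ r : ℝ in 𝓝[<] 1, 2 * Real.pi * I * deriv Ω 0 = ∫ φ in s..s + 2 * Real.pi,
      (kern Ω (r * pt φ) + κ * kern Ω ((r⁻¹ : ℝ) * pt φ)) := by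
    filter_upwards [hev] with r hr
    have hr' := hinv r hr.1 hr.2
    have c1 := hcont r (by linarith [hr.1]) hr.2.ne
    have c2 := hcont r⁻¹ (by linarith [hr'.1]) hr'.1.ne'
    have c3 : Continuous fun φ : ℝ => (κ : ℂ) * kern Ω ((r⁻¹ : ℝ) * pt φ) :=
      continuous_const.mul c2
    rw [intervalIntegral.integral_add (c1.intervalIntegrable _ _) (c3.intervalIntegrable _ _), intervalIntegral.integral_const_mul,
      integral_kern_of_lt (fun ζ hζ => hd ζ hζ.ne) (by linarith [hr.1]) hr.2,
      integral_kern_of_gt (fun ζ hζ => hd ζ hζ.ne')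
        ((tendsto_oneArc_cobounded hκ hf C₀ C₁).isBigO_one ℂ) hr'.1, mul_zero, add_zero]
  have hmain : ∫ φ in s..s + 2 * Real.pi, G φ = 2 * Real.pi * I * deriv Ω 0 :=
    tendsto_nhds_unique hlim (tendsto_const_nhds.congr' hval)
  have hI2 : IntervalIntegrable (fun φ => kern Ω (pt φ)) MeasureTheory.volume e
      (s + 2 * Real.pi) := by
    have h1 : IntervalIntegrable _ _ _ _ := integrableS_Omega0 hκ hf hf0
    have h2 : IntervalIntegrable _ _ _ _ := integrableS_X0 (A := A) hκ C₀ C₁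
    refine (h1.add h2).congr fun φ _ => ?_
    simp only [kern, hΩ, oneArc]
    ring
  have hG1 : Set.EqOn G (fun φ => kern f (pt φ)) (Set.Ioo s e) := fun φ hφ => if_pos hφ.2
  have hG2 : Set.EqOn G (fun φ => (κ + 1) * kern Ω (pt φ)) (Set.Ioo e (s + 2 * Real.pi)) :=
    fun φ hφ => if_neg hφ.1.not_gt
  have hGI1 : IntervalIntegrable G MeasureTheory.volume s e := by
    have := intervalIntegrable_kern hf
    rw [intervalIntegrable_iff_integrableOn_Ioo_of_le hse.le] at this ⊢
    exact this.congr_fun hG1.symm measurableSet_Ioo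
  have hGI2 : IntervalIntegrable G MeasureTheory.volume e (s + 2 * Real.pi) := by
    have := hI2.const_mul (κ + 1 : ℂ)
    rw [intervalIntegrable_iff_integrableOn_Ioo_of_le hes.le] at this ⊢
    exact this.congr_fun hG2.symm measurableSet_Ioo
  rw [← hmain, ← intervalIntegral.integral_add_adjacent_intervals hGI1 hGI2,
    intervalIntegral.integral_congr_Ioo_of_le hse.le hG1,
    intervalIntegral.integral_congr_Ioo_of_le hes.le hG2, intervalIntegral.integral_const_mul]

theorem integralS_oneArc (hκ : 1 < κ) (hf : HolderOnArcs A f) (hf0 : ∀ t ∈ A.gammaS, f t = 0)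
    (C₀ C₁ : ℂ) : integralS A (fun t => Omega0 A κ f t / t ^ 2) +
      integralS A (fun t => X0 A κ t * (C₀ + C₁ * t) / t ^ 2) =
    ∫ φ in A.finish 0..A.start 0 + 2 * Real.pi, kern (oneArc A κ f C₀ C₁) (pt φ) := by
  have h1 : IntervalIntegrable _ _ _ _ := integrableS_Omega0 hκ hf hf0
  have h2 : IntervalIntegrable _ _ _ _ := integrableS_X0 (A := A) hκ C₀ C₁
  rw [integralS, integralS, ← intervalIntegral.integral_add h1 h2]
  refine intervalIntegral.integral_congr fun φ _ => ?_
  simp only [kern, oneArc]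
  ring

/-- The condition on the displacements at the ends of the arc says that the derivative of the
solution vanishes at the origin. -/
theorem displacement_condition_iff (hκ : 1 < κ) (hf : HolderOnArcs A f)
    (hf0 : ∀ t ∈ A.gammaS, f t = 0) {μ : ℝ} {u u' : ℝ → ℂ}
    (hu : ContinuousOn u (Set.Icc (A.start 0) (A.finish 0)))
    (hu' : ∀ φ ∈ Set.Ioo (A.start 0) (A.finish 0), HasDerivAt u (u' φ) φ ∧
      f (pt φ) = -2 * μ * I * pt φ * conj (u' φ)) (C₀ C₁ : ℂ) :
    (κ + 1) * integralS A (fun t => Omega0 A κ f t / t ^ 2)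
      + (κ + 1) * integralS A (fun t => X0 A κ t * (C₀ + C₁ * t) / t ^ 2)
    = 2 * μ * (conj (u (A.start 0)) - conj (u (A.finish 0))) ↔
    deriv (oneArc A κ f C₀ C₁) 0 = 0 := by
  have h := integral_boundary_eq_deriv hκ hf hf0 C₀ C₁
  rw [← integralS_oneArc hκ hf hf0, integral_kern_displacement hf hu hu'] at h
  have hpi : (2 * Real.pi * I : ℂ) ≠ 0 := by simp [Real.pi_ne_zero]
  constructor
  · intro h1
    refine (mul_eq_zero.1 (?_ : 2 * Real.pi * I * deriv (oneArc A κ f C₀ C₁) 0 = 0)).resolve_left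
      hpi
    rw [← h]
    linear_combination h1
  · intro h1
    rw [h1, mul_zero] at h
    linear_combination h

/-! ### Unique solvability for the constants -/

theorem existsUnique_add_conj_eq {p q r : ℂ} (h : ‖p‖ ≠ ‖q‖) : ∃! z : ℂ, p * z + q * conj z = r := by
  have hΔ : (p * conj p - q * conj q : ℂ) ≠ 0 := by
    rw [mul_conj, mul_conj, ← ofReal_sub, ofReal_ne_zero, ← Complex.sq_norm, ← Complex.sq_norm]
    intro h0
    exact h ((sq_eq_sq₀ (norm_nonneg _) (norm_nonneg _)).1 (sub_eq_zero.1 h0))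
  -- Cramer's rule: `conj p` times the equation minus `q` times its conjugate eliminates `conj z`,
  -- with determinant `‖p‖² - ‖q‖²`.
  refine ⟨(conj p * r - q * conj r) / (p * conj p - q * conj q), ?_, fun z hz => ?_⟩
  · have hc : conj (p * conj p - q * conj q) = p * conj p - q * conj q := by
      simp only [map_sub, map_mul, conj_conj]
      ring
    simp only [map_div₀, hc]
    rw [mul_div_assoc', mul_div_assoc', ← add_div, div_eq_iff hΔ]
    simp only [map_sub, map_mul, conj_conj]
    ring
  · rw [eq_div_iff hΔ, ← hz]
    simp only [map_add, map_mul, conj_conj]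
    ring

/-- To be applied with `x = X₀(0)`, `d = X₀'(0)` and `l` their quotient. The first equation is
complex-linear and eliminates `C₁`; the second becomes an equation in `C₀` and its conjugate with
coefficients of moduli `‖x‖` and `‖l‖`, as `‖τ‖ = 1`. -/
theorem existsUnique_constants {x d l τ D E : ℂ} (hd : d = x * l) (hx : x ≠ 0) (hl : ‖l‖ ≠ ‖x‖)
    (hτ : ‖τ‖ = 1) : ∃ C₀ C₁ : ℂ, (D + d * C₀ + x * C₁ = 0 ∧ E + C₀ * x + τ * conj C₁ = 0) ∧
      ∀ C₀' C₁' : ℂ, D + d * C₀' + x * C₁' = 0 ∧ E + C₀' * x + τ * conj C₁' = 0 →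
        C₀' = C₀ ∧ C₁' = C₁ := by
  have hne : ‖x‖ ≠ ‖-(τ * conj l)‖ := by
    rw [norm_neg, norm_mul, hτ, norm_conj, one_mul]
    exact hl.symm
  obtain ⟨z, hz, huniq⟩ := existsUnique_add_conj_eq (r := τ * conj (D / x) - E) hne
  have hsolve : ∀ C₀ C₁ : ℂ, D + d * C₀ + x * C₁ = 0 ↔ C₁ = -(D / x) - l * C₀ := by
    intro C₀ C₁
    rw [hd]
    constructor
    · intro h
      field_simp
      linear_combination h
    · intro h
      rw [h]
      field_simp
      ring
  have hsecond : ∀ C₀ : ℂ, E + C₀ * x + τ * conj (-(D / x) - l * C₀) = 0 ↔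
      x * C₀ + -(τ * conj l) * conj C₀ = τ * conj (D / x) - E := by
    intro C₀
    simp only [map_sub, map_neg, map_mul]
    constructor <;> intro h <;> linear_combination h
  refine ⟨z, -(D / x) - l * z, ⟨(hsolve _ _).2 rfl, (hsecond z).2 hz⟩, fun C₀' C₁' h => ?_⟩
  have h1 := (hsolve _ _).1 h.1
  have h2 := h.2
  rw [h1] at h2
  have h3 := huniq C₀' ((hsecond _).1 h2)
  exact ⟨h3, by rw [h1, h3]⟩

/-- The logarithmic derivative of the canonical function at the origin. -/
def logDerivX0 (A : ArcSystem 1) (κ : ℝ) : ℂ :=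
  (-1 / 2 + I * beta κ) * (0 - pt (A.start 0))⁻¹ + (-1 / 2 - I * beta κ) * (0 - pt (A.finish 0))⁻¹

theorem hasDerivAt_X0_zero (A : ArcSystem 1) (κ : ℝ) :
    HasDerivAt (X0 A κ) (X0 A κ 0 * logDerivX0 A κ) 0 := by
  have h : X0 A κ = arcFactor κ (A.start 0) (A.finish 0) := funext (X0_single A κ)
  rw [h]
  exact hasDerivAt_arcFactor κ (A.start_lt_finish 0) (A.finish_lt 0)
    (notMem_closedArc_of_mem_disk (by simp [disk]))

/-- With `α` half the opening of the arc, explicit evaluation gives `|cos α + 2β sin α| < 1 + 2βα ≤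
exp (2βα)`. The left side is the modulus of the logarithmic derivative, the right side that of
`X₀(0)`; strictness comes from `β > 0` and `sin α < α`. -/
theorem norm_logDerivX0_lt (hκ : 1 < κ) (A : ArcSystem 1) : ‖logDerivX0 A κ‖ < ‖X0 A κ 0‖ := by
  have hlt := A.start_lt_finish 0
  have hlt' := A.finish_lt 0
  have hne : ∀ φ, (0 : ℂ) ≠ pt φ := fun φ => (pt_ne_zero φ).symm
  set s := A.start 0
  set e := A.finish 0
  set α := (e - s) / 2 with hα
  have hα0 : 0 < α := by linarith
  have hαpi : α < Real.pi := by linarith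
  have hβ : 0 < beta κ := div_pos (Real.log_pos hκ) Real.two_pi_pos
  -- At the origin `arcW` equals `exp (-iα)`, and the normalisation of the branch subtracts another
  -- `iα`.
  have hlog : (arcLog s e 0).im = -(2 * α) := by
    have hw : arcW s e 0 = exp ((-α : ℝ) * I) := by
      have h1 : arcW s e 0 = pt α * (pt s / pt e) := by
        rw [arcW, zero_sub, zero_sub, neg_div_neg_eq]
        rfl
      rw [h1, div_eq_mul_inv, ← pt_neg, ← pt_add, ← pt_add]
      change _ = pt (-α)
      congr 1
      rw [hα]
      ring
    rw [arcLog_eq, hw, log_exp (by simpa using hαpi) (by simp; linarith), sub_im,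
      im_ofReal_mul, im_ofReal_mul, I_im]
    rw [hα]
    ring
  have hX : ‖X0 A κ 0‖ = Real.exp (2 * beta κ * α) := by
    rw [X0_single, norm_arcFactor (hne _) (hne _), hlog]
    simp only [zero_sub, norm_neg, norm_pt, Real.one_rpow, mul_one]
    congr 1
    ring
  have hL : logDerivX0 A κ =
      pt (-((s + e) / 2)) * ((Real.cos α + 2 * beta κ * Real.sin α : ℝ) : ℂ) := by
    have h1 : pt (-s) = pt (-((s + e) / 2)) * pt α := by
      rw [← pt_add]; congr 1; rw [hα]; ring
    have h2 : pt (-e) = pt (-((s + e) / 2)) * pt (-α) := by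
      rw [← pt_add]; congr 1; rw [hα]; ring
    have h3 : logDerivX0 A κ = (1 / 2 - I * beta κ) * pt (-s) + (1 / 2 + I * beta κ) * pt (-e) := by
      rw [logDerivX0, zero_sub, zero_sub, inv_neg, inv_neg, ← pt_neg, ← pt_neg]
      ring
    have h4 : pt α = Real.cos α + Real.sin α * I := by
      rw [pt, exp_mul_I, ofReal_cos, ofReal_sin]
    have h5 : pt (-α) = Real.cos α - Real.sin α * I := by
      rw [pt, exp_mul_I, ofReal_neg, Complex.cos_neg, Complex.sin_neg, ofReal_cos, ofReal_sin]
      ring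
    rw [h3, h1, h2, h4, h5]
    push_cast
    linear_combination (-2 * pt (-((s + e) / 2)) * beta κ * Complex.sin α) * I_sq
  rw [hL, norm_mul, norm_pt, one_mul, norm_real, Real.norm_eq_abs, hX]
  have hsin0 : 0 < Real.sin α := Real.sin_pos_of_pos_of_lt_pi hα0 hαpi
  have hsin : Real.sin α < α := Real.sin_lt hα0
  have hprod : beta κ * Real.sin α < beta κ * α := mul_lt_mul_of_pos_left hsin hβ
  have hprod0 : 0 < beta κ * Real.sin α := mul_pos hβ hsin0
  refine lt_of_lt_of_le (b := 2 * beta κ * α + 1) (abs_lt.2 ⟨?_, ?_⟩)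
    (Real.add_one_le_exp _)
  · linarith [Real.neg_one_le_cos α]
  · linarith [Real.cos_le_one α]

theorem deriv_oneArc_zero (hκ : 1 < κ) (hf : HolderOnArcs A f) (C₀ C₁ : ℂ) :
    deriv (oneArc A κ f C₀ C₁) 0 =
      deriv (Omega0 A κ f) 0 + X0 A κ 0 * logDerivX0 A κ * C₀ + X0 A κ 0 * C₁ := by
  have h1 : HasDerivAt (fun ζ : ℂ => C₀ + C₁ * ζ) (C₁ * 1) 0 :=
    ((hasDerivAt_id (0 : ℂ)).const_mul C₁).const_add C₀
  have h2 := (differentiableAt_Omega0 hκ hf (ζ := 0) (by simp)).hasDerivAt.add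
    ((hasDerivAt_X0_zero A κ).mul h1)
  refine h2.deriv.trans ?_
  ring

theorem regularity_condition_eq (τ C₀ C₁ : ℂ) :
    X0 A κ 0 / (2 * Real.pi * I) * (∮ t in C(0, 1), f t / (innerValue (X0 A κ) t * t))
      + C₀ * X0 A κ 0 + τ * conj C₁ = Omega0 A κ f 0 + C₀ * X0 A κ 0 + τ * conj C₁ := by
  rw [Omega0]
  simp only [sub_zero]

theorem norm_conj_div_self {w : ℂ} (hw : w ≠ 0) : ‖conj w / w‖ = 1 := by
  rw [norm_div, norm_conj, div_self (norm_ne_zero_iff.2 hw)]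

/-- The constants of a function built from potentials satisfy both conditions. -/
theorem constants_of_OmegaOf (hκ : 1 < κ) (hf : HolderOnArcs A f) {ω Φ Ψ : ℂ → ℂ} {w₀ w₁ : ℂ}
    (hω : ∀ ζ, ω ζ = w₀ + w₁ * ζ) (hw : w₁ ≠ 0) (hΦ : DifferentiableOn ℂ Φ disk)
    (hΨ : DifferentiableOn ℂ Ψ disk) {C₀ C₁ : ℂ}
    (h : ∀ ζ : ℂ, ‖ζ‖ ≠ 1 → OmegaOf ω Φ Ψ ζ = oneArc A κ f C₀ C₁ ζ) :
    deriv (oneArc A κ f C₀ C₁) 0 = 0 ∧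
      Omega0 A κ f 0 + C₀ * X0 A κ 0 + conj w₁ / w₁ * conj C₁ = 0 := by
  have h0 : (0 : ℂ) ∈ disk := by simp [disk]
  have hmem : disk ∈ 𝓝 (0 : ℂ) := isOpen_disk.mem_nhds h0
  constructor
  · have hev : oneArc A κ f C₀ C₁ =ᶠ[𝓝 0] fun ζ => conj w₁ * Φ ζ -
        ((conj w₀ * ζ ^ 2 + conj w₁ * ζ) * deriv Φ ζ + w₁ * ζ ^ 2 * Ψ ζ) := by
      filter_upwards [hmem] with ζ hζ
      rw [← h ζ (ne_of_lt hζ), OmegaOf_affine hω hζ]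
    rw [hev.deriv_eq]
    have e1 := (hΦ.differentiableAt hmem).hasDerivAt
    have e2 := (differentiableAt_deriv_of_mem_disk hΦ h0).hasDerivAt
    have e3 := (hΨ.differentiableAt hmem).hasDerivAt
    have e4 : HasDerivAt (fun ζ : ℂ => ζ ^ 2) (2 * 0) 0 := by
      simpa using hasDerivAt_pow 2 (0 : ℂ)
    -- At the origin the derivative of `conj w₁ * Φ` cancels against that of `conj w₁ * ζ * deriv
    -- Φ`; the other terms vanish to second order.
    have e5 := (e1.const_mul (conj w₁)).sub
      ((((e4.const_mul (conj w₀)).add ((hasDerivAt_id (0 : ℂ)).const_mul (conj w₁))).mul e2).add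
        ((e4.const_mul w₁).mul e3))
    refine e5.deriv.trans ?_
    simp
  · have e1 : oneArc A κ f C₀ C₁ 0 = Omega0 A κ f 0 + C₀ * X0 A κ 0 := by
      rw [oneArc]
      ring
    have e2 : oneArc A κ f C₀ C₁ 0 = conj w₁ * Φ 0 := by
      rw [← h 0 (by simp), OmegaOf_affine hω h0]
      simp
    have hdω : deriv ω = fun _ => w₁ := by
      ext z
      have h1 : HasDerivAt ω w₁ z := by
        rw [funext hω]
        simpa using ((hasDerivAt_id z).const_mul w₁).const_add w₀
      exact h1.deriv
    -- Both sides are the value of `Ω` at infinity, where the reflected potential tends to `conj (Φ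
    -- 0)`.
    have e3 : C₁ = -(conj w₁ * conj (Φ 0)) := by
      refine tendsto_nhds_unique (tendsto_oneArc_cobounded hκ hf C₀ C₁) ?_
      have h1 := tendsto_reflect_cobounded (l := deriv ω) (by rw [hdω]; exact continuousAt_const)
      have h2 := tendsto_reflect_cobounded (l := Φ) (hΦ.differentiableAt hmem).continuousAt
      have h3 := (h1.mul h2).neg
      rw [hdω] at h3
      refine h3.congr' ?_
      filter_upwards [tendsto_norm_cobounded_atTop.eventually_gt_atTop 1] with ζ hζ
      rw [← h ζ hζ.ne', OmegaOf_of_gt hζ, hdω]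
    rw [← e1, e2, e3]
    simp only [map_neg, map_mul, conj_conj]
    field_simp
    ring

end LinearSystem

theorem linearSystem_iff {A : ArcSystem 1} {κ : ℝ} {f : ℂ → ℂ} (hκ : 1 < κ)
    (hf : HolderOnArcs A f) (hf0 : ∀ t ∈ A.gammaS, f t = 0) {μ : ℝ} {u u' : ℝ → ℂ}
    (hu : ContinuousOn u (Set.Icc (A.start 0) (A.finish 0)))
    (hu' : ∀ φ ∈ Set.Ioo (A.start 0) (A.finish 0), HasDerivAt u (u' φ) φ ∧
      f (pt φ) = -2 * μ * I * pt φ * conj (u' φ)) {ω : ℂ → ℂ} {w₁ : ℂ} (hω : deriv ω 0 = w₁)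
    (C₀ C₁ : ℂ) : LinearSystem A κ μ ω u f C₀ C₁ ↔
      deriv (Omega0 A κ f) 0 + X0 A κ 0 * logDerivX0 A κ * C₀ + X0 A κ 0 * C₁ = 0 ∧
      Omega0 A κ f 0 + C₀ * X0 A κ 0 + conj w₁ / w₁ * conj C₁ = 0 := by
  rw [LinearSystem, displacement_condition_iff hκ hf hf0 hu hu', deriv_oneArc_zero hκ hf,
    regularity_condition_eq, hω]

/-- The linear system has exactly one solution, and it gives the constants of every function built
from potentials that satisfies the boundary conditions. -/
theorem exists_constants {A : ArcSystem 1} {κ : ℝ} {f : ℂ → ℂ} (hκ : 1 < κ)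
    (hf : HolderOnArcs A f) (hf0 : ∀ t ∈ A.gammaS, f t = 0) {μ : ℝ} {u u' : ℝ → ℂ}
    (hu : ContinuousOn u (Set.Icc (A.start 0) (A.finish 0)))
    (hu' : ∀ φ ∈ Set.Ioo (A.start 0) (A.finish 0), HasDerivAt u (u' φ) φ ∧
      f (pt φ) = -2 * μ * I * pt φ * conj (u' φ)) {ω : ℂ → ℂ} (hω : Differentiable ℂ ω)
    (hinj : Set.InjOn ω disk) (hO : ω =O[cobounded ℂ] fun ζ => ζ) :
    ∃ C₀ C₁ : ℂ, LinearSystem A κ μ ω u f C₀ C₁ ∧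
      (∀ C₀' C₁' : ℂ, LinearSystem A κ μ ω u f C₀' C₁' → C₀' = C₀ ∧ C₁' = C₁) ∧
      ∀ Φ Ψ : ℂ → ℂ, DifferentiableOn ℂ Φ disk → DifferentiableOn ℂ Ψ disk →
        BoundaryConditions A κ f (OmegaOf ω Φ Ψ) →
        ∀ ζ : ℂ, ‖ζ‖ ≠ 1 → OmegaOf ω Φ Ψ ζ = oneArc A κ f C₀ C₁ ζ := by
  have hO' : ω =O[cobounded ℂ] fun ζ => ζ ^ 1 := by simpa only [pow_one] using hO
  obtain ⟨w₀, w₁, hw⟩ := exists_affine le_rfl hω hO'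
  -- A constant map is not injective on the disk, so `ω'(0) ≠ 0` and the quotient of `conj (ω'(0))`
  -- by `ω'(0)` has modulus one.
  have hw₁ : w₁ ≠ 0 := by
    intro h
    have h1 : (0 : ℂ) = 1 / 2 := hinj (by simp [disk]) (by norm_num [disk]) (by simp [hw, h])
    norm_num at h1
  have hdω : deriv ω 0 = w₁ := by
    rw [funext hw]
    simp
  have h0 : (0 : ℂ) ∉ A.ends := fun h => by simpa using A.norm_of_mem_ends h
  obtain ⟨C₀, C₁, hC, huniq⟩ := existsUnique_constants (D := deriv (Omega0 A κ f) 0)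
    (E := Omega0 A κ f 0) (rfl : X0 A κ 0 * logDerivX0 A κ = _) (X0_ne_zero A κ h0)
    (norm_logDerivX0_lt hκ A).ne (norm_conj_div_self hw₁)
  have hiff := linearSystem_iff hκ hf hf0 hu hu' hdω
  refine ⟨C₀, C₁, (hiff _ _).2 hC, fun C₀' C₁' h => huniq _ _ ((hiff _ _).1 h), ?_⟩
  intro Φ Ψ hΦ hΨ hBC
  obtain ⟨C₀', C₁', h⟩ := (solution_iff_oneArc hκ hf le_rfl _).1
    ⟨sectionallyHolomorphic_OmegaOf hω hO' hΦ hΨ, hBC⟩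
  have h1 := constants_of_OmegaOf hκ hf hw hw₁ hΦ hΨ h
  rw [deriv_oneArc_zero hκ hf] at h1
  obtain ⟨rfl, rfl⟩ := huniq _ _ h1
  exact h

end RHProblem

end

/-! ### The theorem: the general case and the single displacement arc -/

theorem mainTheorem2 (κ : ℝ) (hκ₁ : 1 < κ) (hκ₃ : κ < 3) :
    -- the general case
    (∀ (n : ℕ) (A : RHProblem.ArcSystem n),
      -- the canonical function
      (∀ ζ ∉ A.gammaU ∪ A.ends, DifferentiableAt ℂ (RHProblem.X0 A κ) ζ ∧ RHProblem.X0 A κ ζ ≠ 0) ∧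
      Tendsto (fun ζ => ζ ^ n * RHProblem.X0 A κ ζ) (cobounded ℂ) (𝓝 1) ∧
      (∀ t ∈ A.gammaU ∪ A.gammaS,
        Tendsto (RHProblem.X0 A κ) (𝓝[RHProblem.disk] t)
          (𝓝 (RHProblem.innerValue (RHProblem.X0 A κ) t)) ∧
        Tendsto (RHProblem.X0 A κ) (𝓝[RHProblem.exterior] t)
          (𝓝 (RHProblem.outerValue (RHProblem.X0 A κ) t)) ∧
        RHProblem.innerValue (RHProblem.X0 A κ) t ≠ 0) ∧
      (∀ t ∈ A.gammaU,
        RHProblem.innerValue (RHProblem.X0 A κ) t = -κ * RHProblem.outerValue (RHProblem.X0 A κ) t) ∧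
      (∀ t ∈ A.gammaS,
        RHProblem.innerValue (RHProblem.X0 A κ) t = RHProblem.outerValue (RHProblem.X0 A κ) t) ∧
      ∀ f : ℂ → ℂ, RHProblem.HolderOnArcs A f →
        (∀ ζ : ℂ, ‖ζ‖ ≠ 1 →
          CircleIntegrable (fun t => f t / (RHProblem.innerValue (RHProblem.X0 A κ) t * (t - ζ))) 0 1) ∧
        -- the general solution of the Riemann-Hilbert problem
        (∀ (N : ℕ) (Ω : ℂ → ℂ),
          (RHProblem.SectionallyHolomorphic N Ω ∧ RHProblem.BoundaryConditions A κ f Ω) ↔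
            ∃ C : ℤ → ℂ, ∀ ζ ∈ RHProblem.domain N,
              Ω ζ = RHProblem.Omega0 A κ f ζ
                + RHProblem.X0 A κ ζ * RHProblem.laurentSum C (N - 1) n ζ) ∧
        -- the function built from the potentials is covered
        (∀ (N : ℕ) (ω Φ Ψ : ℂ → ℂ), Differentiable ℂ ω →
          (ω =O[cobounded ℂ] fun ζ => ζ ^ N) →
          DifferentiableOn ℂ Φ RHProblem.disk → DifferentiableOn ℂ Ψ RHProblem.disk →
          RHProblem.SectionallyHolomorphic N (RHProblem.OmegaOf ω Φ Ψ) ∧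
          (RHProblem.BoundaryConditions A κ f (RHProblem.OmegaOf ω Φ Ψ) →
            ∃ C : ℤ → ℂ, ∀ ζ ∈ RHProblem.domain N,
              RHProblem.OmegaOf ω Φ Ψ ζ = RHProblem.Omega0 A κ f ζ
                + RHProblem.X0 A κ ζ * RHProblem.laurentSum C (N - 1) n ζ))) ∧
    -- a single displacement arc, no pole of `Ω` at the origin
    (∀ (A : RHProblem.ArcSystem 1) (f : ℂ → ℂ), RHProblem.HolderOnArcs A f →
      (∀ (N : ℕ), N ≤ 1 → ∀ Ω : ℂ → ℂ,
        (RHProblem.SectionallyHolomorphic N Ω ∧ RHProblem.BoundaryConditions A κ f Ω) ↔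
          ∃ C₀ C₁ : ℂ, ∀ ζ : ℂ, ‖ζ‖ ≠ 1 →
            Ω ζ = RHProblem.Omega0 A κ f ζ + RHProblem.X0 A κ ζ * (C₀ + C₁ * ζ)) ∧
      -- traction-free `γ_σ`, displacements `u` prescribed on `γ_u`
      (∀ (μ : ℝ) (u u' : ℝ → ℂ) (ω : ℂ → ℂ), 0 < μ →
        (∀ t ∈ A.gammaS, f t = 0) →
        ContinuousOn u (Set.Icc (A.start 0) (A.finish 0)) →
        (∀ φ ∈ Set.Ioo (A.start 0) (A.finish 0), HasDerivAt u (u' φ) φ ∧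
          f (RHProblem.pt φ) = -2 * μ * I * RHProblem.pt φ * conj (u' φ)) →
        Differentiable ℂ ω → Set.InjOn ω RHProblem.disk →
        (ω =O[cobounded ℂ] fun ζ => ζ) →
        RHProblem.IntegrableS A (fun t => RHProblem.Omega0 A κ f t / t ^ 2) ∧
        (∀ C₀ C₁ : ℂ,
          RHProblem.IntegrableS A (fun t => RHProblem.X0 A κ t * (C₀ + C₁ * t) / t ^ 2)) ∧
        ∃ C₀ C₁ : ℂ, RHProblem.LinearSystem A κ μ ω u f C₀ C₁ ∧
          (∀ C₀' C₁' : ℂ, RHProblem.LinearSystem A κ μ ω u f C₀' C₁' → C₀' = C₀ ∧ C₁' = C₁) ∧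
          ∀ Φ Ψ : ℂ → ℂ,
            DifferentiableOn ℂ Φ RHProblem.disk → DifferentiableOn ℂ Ψ RHProblem.disk →
            RHProblem.BoundaryConditions A κ f (RHProblem.OmegaOf ω Φ Ψ) →
            ∀ ζ : ℂ, ‖ζ‖ ≠ 1 →
              RHProblem.OmegaOf ω Φ Ψ ζ
                = RHProblem.Omega0 A κ f ζ + RHProblem.X0 A κ ζ * (C₀ + C₁ * ζ))) := by
  refine ⟨fun n A => ⟨fun ζ hζ => ⟨RHProblem.differentiableAt_X0 A κ hζ,
      RHProblem.X0_ne_zero A κ fun h => hζ (Or.inr h)⟩, RHProblem.tendsto_pow_mul_X0 A κ,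
      fun t ht => ?_, fun t ht => (RHProblem.boundary_X0_of_mem_gammaU A hκ₁ ht).2.2.2,
      fun t ht => ?_, fun f hf => ⟨fun ζ hζ => RHProblem.circleIntegrable_div_innerValue hκ₁ hf hζ,
        RHProblem.solution_iff hκ₁ hf, fun N ω Φ Ψ hω hO hΦ hΨ => ?_⟩⟩,
    fun A f hf => ⟨fun N hN Ω => RHProblem.solution_iff_oneArc hκ₁ hf hN Ω,
      fun μ u u' ω _ hf0 hu hu' hω hinj hO => ⟨RHProblem.integrableS_Omega0 hκ₁ hf hf0,
        RHProblem.integrableS_X0 hκ₁,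
        RHProblem.exists_constants hκ₁ hf hf0 hu hu' hω hinj hO⟩⟩⟩
  · obtain ⟨h1, h2, h3, -⟩ := RHProblem.boundary_X0 A hκ₁ ht
    exact ⟨h1, h2, h3⟩
  · obtain ⟨h1, h2⟩ := RHProblem.boundary_X0_of_mem_gammaS A κ ht
    exact h1.trans h2.symm
  · have h := RHProblem.sectionallyHolomorphic_OmegaOf hω hO hΦ hΨ
    exact ⟨h, fun hBC => RHProblem.exists_laurentSum hκ₁ hf h hBC⟩
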